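/- Let $n,m\ge 0$ be integers, let $\prod^{n,m}=\mathrm{span}\{z^iw^j: -n\le i\le n,\ -m\le j\le m\}$ and $\hat\prod^{n,m}=\mathrm{span}\{z^iw^j: 0\le i\le n,\ 0\le j\le m\}$ (complex coefficients). For a polynomial $q$ let $q^\dagger(z,w)=\overline{q(1/\bar z,1/\bar w)}$. Let $\mathcal L:\prod^{n,m}\to\mathbb C$ be a positive definite linear functional, that is, $\mathcal L(z^{-i}w^{-j})=\overline{\mathcal L(z^iw^j)}$ for $|i|\le n$, $|j|\le m$, and $\mathcal L(p\,p^\dagger)>0$ for every nonzero $p\in\hat\prod^{n,m}$. Write $\langle p,q\rangle=\mathcal L(p\,q^\dagger)$ for $p,q\in\hat\prod^{n,m}$. For $0\le n'\le n$, $0\le m'\le m$ and $0\le l\le m'$ let $\phi^l_{n',m'}$ be the unique polynomial such that $$\phi^l_{n',m'}\in\mathrm{span}\{z^iw^j:(i,j)\in S\cup\{(n',l)\}\},\qquad S=\{(i,j): 0\le i<n',\,0\le j\le m'\}\cup\{(n',j):0\le j<l\},$$ with positive coefficient at $z^{n'}w^l$, $\langle\phi^l_{n',m'},z^iw^j\rangle=0$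 for $(i,j)\in S$, and $\langle\phi^l_{n',m'},\phi^l_{n',m'}\rangle=1$ (orthonormalization in the lexicographical ordering). Let $\tilde\phi^l_{n',m'}$, $0\le l\le n'$, be the polynomials obtained in the same way with the roles of $z$ and $w$, and of $n'$ and $m'$, interchanged (reverse lexicographical ordering; the leading term of $\tilde\phi^l_{n',m'}$ is at $z^lw^{m'}$). Let $$\mathcal K_{n,m}=\big(\langle \phi_{n,m-1}^{m-1-r},\ \tilde\phi_{n-1,m}^{\,n-1-s}\rangle\big)_{0\le r\le m-1,\ 0\le s\le n-1}\in\mathbb C^{m\times n}$$ (the empty matrix, regarded as $0$, if $n=0$ or $m=0$). For $p=\sum_{i=0}^n\sum_{j=0}^m p_{i,j}z^iw^j$ let $\overleftarrow p(z,w)=z^nw^m\,\bar p(1/z,1/w)=\sum_{i,j}\overline{p_{i,j}}\,z^{n-i}w^{m-j}$. Such a $p$ has degree $(n,m)$ if $p_{n,m}\neq0$. A polynomial is stable if it has no zero with $|z|\le1$ and $|w|\le1$. Then: 1. If $\mathcal K_{n,m}=0$, then $\overleftarrow\phi^m_{n,m}$ is stable and $$\mathcal L(z^kw^l)=\frac1{(2\pi)^2}\int_0^{2\pi}\!\!\int_0^{2\pi}\frac{e^{ik\theta}e^{il\varphi}}{|\phi^m_{n,m}(e^{i\theta},e^{i\varphi})|^2}\,d\theta\,d\varphi,\qquad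 |k|\le n,\ |l|\le m.$$ 2. Conversely, if $\pi_{n,m}$ is a polynomial of degree $(n,m)$ such that $\overleftarrow\pi_{n,m}$ is stable and $$\mathcal L(z^kw^l)=\frac1{(2\pi)^2}\int_0^{2\pi}\!\!\int_0^{2\pi}\frac{e^{ik\theta}e^{il\varphi}}{|\pi_{n,m}(e^{i\theta},e^{i\varphi})|^2}\,d\theta\,d\varphi,\qquad |k|\le n,\ |l|\le m,$$ then $\mathcal K_{n,m}=0$. -/

import Mathlib

open scoped ComplexOrder

noncomputable section

namespace Bicircle

/-- Laurent polynomials in `z, w`: the coefficient at `(i, j)` is that of `z ^ i * w ^ j`. -/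
abbrev Laurent : Type := AddMonoidAlgebra ℂ (ℤ × ℤ)

/-- The monomial `z ^ i * w ^ j`. -/
def monomial (i j : ℤ) : Laurent := AddMonoidAlgebra.single (i, j) 1

/-- `p† (z, w) = conj (p (1 / conj z, 1 / conj w))`: the coefficient of `p†` at `a` is the
conjugate of the coefficient of `p` at `-a`. On `|z| = |w| = 1` it is the conjugate of `p`, so that
`p * p†` stands for `|p| ^ 2`. -/
def dagger (p : Laurent) : Laurent :=
  AddMonoidAlgebra.ofCoeff
    ((p.coeff.equivMapDomain (Equiv.neg (ℤ × ℤ))).mapRange (starRingEnd ℂ) (map_zero _))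

/-- The value of `p` at `(z, w)`. -/
def eval (p : Laurent) (z w : ℂ) : ℂ := p.coeff.sum fun a c => c * z ^ a.1 * w ^ a.2

/-- The space of Laurent polynomials spanned by `z ^ i * w ^ j`, `-n ≤ i ≤ n`, `-m ≤ j ≤ m`. -/
def laurentSpace (n m : ℕ) : Submodule ℂ Laurent :=
  AddMonoidAlgebra.supported ℂ ℂ (Set.Icc (-n : ℤ) n ×ˢ Set.Icc (-m : ℤ) m)

/-- The space of polynomials spanned by `z ^ i * w ^ j`, `0 ≤ i ≤ n`, `0 ≤ j ≤ m`. -/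
def polySpace (n m : ℕ) : Submodule ℂ Laurent :=
  AddMonoidAlgebra.supported ℂ ℂ (Set.Icc (0 : ℤ) n ×ˢ Set.Icc (0 : ℤ) m)

theorem dagger_coeff (p : Laurent) (a : ℤ × ℤ) :
    (dagger p).coeff a = (starRingEnd ℂ) (p.coeff (-a)) := by
  simp [dagger, Finsupp.equivMapDomain_apply]

theorem dagger_add (p q : Laurent) : dagger (p + q) = dagger p + dagger q := by
  ext a; simp [dagger_coeff]

theorem dagger_smul (c : ℂ) (p : Laurent) :
    dagger (c • p) = (starRingEnd ℂ) c • dagger p := by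
  ext a; simp [dagger_coeff]

theorem monomial_mem_laurentSpace {n m : ℕ} {i j : ℤ} (hi : |i| ≤ n) (hj : |j| ≤ m) :
    monomial i j ∈ laurentSpace n m := by
  rw [laurentSpace, AddMonoidAlgebra.mem_supported']
  intro a ha
  rw [monomial, AddMonoidAlgebra.coeff_single, Finsupp.single_apply, if_neg]
  rintro rfl
  exact ha ⟨abs_le.1 hi, abs_le.1 hj⟩

theorem mul_dagger_mem {n m : ℕ} {p q : Laurent} (hp : p ∈ polySpace n m)
    (hq : q ∈ polySpace n m) : p * dagger q ∈ laurentSpace n m := by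
  rw [polySpace, AddMonoidAlgebra.mem_supported'] at hp hq
  rw [laurentSpace, AddMonoidAlgebra.mem_supported]
  intro a ha
  classical
  have h1 := AddMonoidAlgebra.support_coeff_mul_subset p (dagger q) ha
  obtain ⟨b, hb, c, hc, rfl⟩ := Finset.mem_add.1 h1
  have hb' : b ∈ Set.Icc (0 : ℤ) n ×ˢ Set.Icc (0 : ℤ) m := by
    by_contra h
    exact (Finsupp.mem_support_iff.1 hb) (hp b h)
  have hc' : -c ∈ Set.Icc (0 : ℤ) n ×ˢ Set.Icc (0 : ℤ) m := by
    by_contra h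
    refine (Finsupp.mem_support_iff.1 hc) ?_
    rw [dagger_coeff, hq _ h, map_zero]
  simp only [Set.mem_prod, Set.mem_Icc, Prod.fst_add, Prod.snd_add, Prod.fst_neg,
    Prod.snd_neg] at *
  omega

/-- `⟨p, q⟩ = L (p * q†)`. -/
def pairing {n m : ℕ} (L : laurentSpace n m →ₗ[ℂ] ℂ) (p q : polySpace n m) : ℂ :=
  L ⟨(p : Laurent) * dagger q, mul_dagger_mem p.2 q.2⟩

/-- A positive definite moment functional on the Laurent space of level `(n, m)`: its moments are
Hermitian, and `L (|p| ^ 2) > 0` for every nonzero polynomial `p` of degree at most `(n, m)`. -/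
structure PositiveDefinite {n m : ℕ} (L : laurentSpace n m →ₗ[ℂ] ℂ) : Prop where
  hermitian : ∀ (i j : ℤ) (hi : |i| ≤ n) (hj : |j| ≤ m),
    L ⟨monomial (-i) (-j),
        monomial_mem_laurentSpace ((abs_neg i).trans_le hi) ((abs_neg j).trans_le hj)⟩ =
      (starRingEnd ℂ) (L ⟨monomial i j, monomial_mem_laurentSpace hi hj⟩)
  pos : ∀ p : polySpace n m, p ≠ 0 → 0 < pairing L p p

/-! ### Gram-Schmidt orthonormalisation -/

/-- The exponents `(i, j)` with `0 ≤ i ≤ N`, `0 ≤ j ≤ M`. -/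
abbrev Box (N M : ℕ) : Type := Fin (N + 1) × Fin (M + 1)

/-- The exponent `b` as an element of `ℤ × ℤ`. -/
def Box.toInt {N M : ℕ} (b : Box N M) : ℤ × ℤ := ((b.1 : ℕ), (b.2 : ℕ))

/-- The monomial `z ^ b.1 * w ^ b.2`. -/
def boxMonomial {N M : ℕ} (b : Box N M) : polySpace N M :=
  ⟨monomial b.toInt.1 b.toInt.2, by
    rw [polySpace, AddMonoidAlgebra.mem_supported']
    intro a ha
    rw [monomial, AddMonoidAlgebra.coeff_single, Finsupp.single_apply, if_neg]
    rintro rfl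
    refine ha ?_
    simp only [Box.toInt, Set.mem_prod, Set.mem_Icc]
    omega⟩

/-- The coefficient of `z ^ b.1 * w ^ b.2` in `p`. -/
def boxCoeff {N M : ℕ} (p : polySpace N M) (b : Box N M) : ℂ := (p : Laurent).coeff b.toInt

/-- `φ` is the unit polynomial with positive leading coefficient at `a`, all other terms in `S`,
which is orthogonal to the monomials in `S`. -/
structure IsOrthonormalAt {N M : ℕ} (L : laurentSpace N M →ₗ[ℂ] ℂ) (S : Set (Box N M))
    (a : Box N M) (φ : polySpace N M) : Prop where
  terms : ∀ b, boxCoeff φ b ≠ 0 → b = a ∨ b ∈ S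
  leading : 0 < boxCoeff φ a
  orthogonal : ∀ b ∈ S, pairing L φ (boxMonomial b) = 0
  unit : pairing L φ φ = 1

/-- The form `pairing` as a sesquilinear map. -/
def innerForm {n m : ℕ} (L : laurentSpace n m →ₗ[ℂ] ℂ) :
    polySpace n m →ₗ[ℂ] polySpace n m →ₛₗ[starRingEnd ℂ] ℂ :=
  LinearMap.mk₂'ₛₗ (RingHom.id ℂ) (starRingEnd ℂ) (pairing L)
    (fun p p' q => by
      rw [pairing, pairing, pairing, ← map_add]; congr 1; ext1; simp [add_mul])
    (fun c p q => by
      rw [pairing, pairing, RingHom.id_apply, ← map_smul]; congr 1; ext1; simp)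
    (fun p q q' => by
      rw [pairing, pairing, pairing, ← map_add]; congr 1; ext1; simp [dagger_add, mul_add])
    (fun c p q => by
      rw [pairing, pairing, ← map_smul]; congr 1; ext1; simp [dagger_smul])

theorem innerForm_apply {n m : ℕ} (L : laurentSpace n m →ₗ[ℂ] ℂ) (p q : polySpace n m) :
    innerForm L p q = pairing L p q := rfl

theorem Box.toInt_injective {N M : ℕ} : Function.Injective (Box.toInt (N := N) (M := M)) := by
  rintro ⟨i, j⟩ ⟨i', j'⟩ h
  simp only [Box.toInt, Prod.mk.injEq, Nat.cast_inj] at h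
  exact Prod.ext (Fin.ext h.1) (Fin.ext h.2)

theorem boxCoeff_boxMonomial {N M : ℕ} (b b' : Box N M) :
    boxCoeff (boxMonomial b) b' = if b = b' then 1 else 0 := by
  simp only [boxCoeff, boxMonomial, monomial, AddMonoidAlgebra.coeff_single, Finsupp.single_apply]
  exact if_congr Box.toInt_injective.eq_iff rfl rfl

theorem boxCoeff_add {N M : ℕ} (p q : polySpace N M) (b : Box N M) :
    boxCoeff (p + q) b = boxCoeff p b + boxCoeff q b := by
  simp [boxCoeff]

theorem boxCoeff_sub {N M : ℕ} (p q : polySpace N M) (b : Box N M) :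
    boxCoeff (p - q) b = boxCoeff p b - boxCoeff q b := by
  simp [boxCoeff]

theorem boxCoeff_smul {N M : ℕ} (c : ℂ) (p : polySpace N M) (b : Box N M) :
    boxCoeff (c • p) b = c * boxCoeff p b := by
  simp [boxCoeff]

theorem boxCoeff_sum {N M : ℕ} {ι : Type*} (s : Finset ι) (f : ι → polySpace N M) (b : Box N M) :
    boxCoeff (∑ i ∈ s, f i) b = ∑ i ∈ s, boxCoeff (f i) b := by
  simp [boxCoeff]

theorem boxCoeff_ext {N M : ℕ} {p q : polySpace N M} (h : ∀ b, boxCoeff p b = boxCoeff q b) :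
    p = q := by
  have hp := AddMonoidAlgebra.mem_supported'.1 p.2
  have hq := AddMonoidAlgebra.mem_supported'.1 q.2
  ext a
  by_cases ha : a ∈ Set.Icc (0 : ℤ) N ×ˢ Set.Icc (0 : ℤ) M
  · simp only [Set.mem_prod, Set.mem_Icc] at ha
    have := h (⟨a.1.toNat, by omega⟩, ⟨a.2.toNat, by omega⟩)
    have ht : Box.toInt (N := N) (M := M) (⟨a.1.toNat, by omega⟩, ⟨a.2.toNat, by omega⟩) = a := by
      simp only [Box.toInt]
      exact Prod.ext (by simp; omega) (by simp; omega)
    simpa only [boxCoeff, ht] using this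
  · rw [hp a ha, hq a ha]

theorem eq_sum_boxMonomial {N M : ℕ} (p : polySpace N M) :
    p = ∑ b, boxCoeff p b • boxMonomial b := by
  refine boxCoeff_ext fun b => ?_
  simp [boxCoeff_sum, boxCoeff_smul, boxCoeff_boxMonomial]

theorem inner_eq_zero_of_terms {N M : ℕ} {L : laurentSpace N M →ₗ[ℂ] ℂ} {S : Set (Box N M)}
    {p q : polySpace N M} (hp : ∀ b ∈ S, pairing L p (boxMonomial b) = 0)
    (hq : ∀ b, boxCoeff q b ≠ 0 → b ∈ S) : pairing L p q = 0 := by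
  rw [eq_sum_boxMonomial q, ← innerForm_apply, map_sum]
  refine Finset.sum_eq_zero fun b _ => ?_
  rw [map_smulₛₗ, innerForm_apply]
  by_cases h : boxCoeff q b = 0
  · simp [h]
  · simp [hp b (hq b h)]

theorem existsUnique_isOrthonormalAt {N M : ℕ} {L : laurentSpace N M →ₗ[ℂ] ℂ}
    (hL : PositiveDefinite L) (S : Set (Box N M)) (a : Box N M) (ha : a ∉ S) :
    ∃! φ, IsOrthonormalAt L S a φ := by
  classical
  refine existsUnique_of_exists_of_unique ?_ ?_
  · let u : (S → ℂ) →ₗ[ℂ] polySpace N M := Fintype.linearCombination ℂ fun b : S => boxMonomial b.1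
    let T : (S → ℂ) →ₗ[ℂ] (S → ℂ) :=
      LinearMap.pi fun b : S => ((innerForm L).flip (boxMonomial b.1)).comp u
    have hT : ∀ c b, T c b = pairing L (u c) (boxMonomial b.1) := fun c b => rfl
    have hu : ∀ c b, boxCoeff (u c) b = if h : b ∈ S then c ⟨b, h⟩ else 0 := by
      intro c b
      simp only [u, Fintype.linearCombination_apply, boxCoeff_sum, boxCoeff_smul,
        boxCoeff_boxMonomial]
      split_ifs with h
      · rw [Finset.sum_eq_single ⟨b, h⟩]
        · simp
        · intro b' _ hb'
          rw [if_neg, mul_zero]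
          exact fun h' => hb' (Subtype.ext h')
        · simp
      · refine Finset.sum_eq_zero fun b' _ => ?_
        rw [if_neg, mul_zero]
        rintro rfl
        exact h b'.2
    have huS : ∀ c b, boxCoeff (u c) b ≠ 0 → b ∈ S := by
      intro c b h
      by_contra hb
      exact h (by rw [hu, dif_neg hb])
    have hinj : Function.Injective T := by
      rw [← LinearMap.ker_eq_bot, LinearMap.ker_eq_bot']
      intro c hc
      have h0 : pairing L (u c) (u c) = 0 :=
        inner_eq_zero_of_terms (fun b hb => by rw [← hT c ⟨b, hb⟩, hc]; rfl) (huS c)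
      have h1 : u c = 0 := by
        by_contra h
        exact (hL.pos _ h).ne' h0
      funext b
      have := hu c b
      rw [h1, dif_pos b.2] at this
      simpa [boxCoeff] using this.symm
    obtain ⟨c, hc⟩ := LinearMap.injective_iff_surjective.1 hinj
      fun b => pairing L (boxMonomial a) (boxMonomial b.1)
    set ψ : polySpace N M := boxMonomial a - u c with hψ
    have hψa : boxCoeff ψ a = 1 := by
      rw [hψ, boxCoeff_sub, boxCoeff_boxMonomial, hu, dif_neg ha]; simp
    have hψ0 : ψ ≠ 0 := by
      intro h
      rw [h] at hψa
      simp [boxCoeff] at hψa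
    have hψS : ∀ b ∈ S, pairing L ψ (boxMonomial b) = 0 := by
      intro b hb
      have := congrFun hc ⟨b, hb⟩
      rw [hT] at this
      rw [hψ, ← innerForm_apply, map_sub, LinearMap.sub_apply, innerForm_apply, innerForm_apply,
        this, sub_self]
    have hpos := hL.pos ψ hψ0
    obtain ⟨hre, him⟩ := Complex.pos_iff.1 hpos
    have hr : pairing L ψ ψ = ((pairing L ψ ψ).re : ℂ) := Complex.ext rfl (by simp [← him])
    set r : ℝ := (pairing L ψ ψ).re
    refine ⟨((Real.sqrt r)⁻¹ : ℂ) • ψ, ⟨?_, ?_, ?_, ?_⟩⟩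
    · intro b hb
      by_contra! h
      apply hb
      rw [boxCoeff_smul, hψ, boxCoeff_sub, boxCoeff_boxMonomial, hu, dif_neg h.2,
        if_neg (Ne.symm h.1)]
      simp
    · rw [boxCoeff_smul, hψa, mul_one, ← Complex.ofReal_inv, Complex.zero_lt_real]
      exact inv_pos.2 (Real.sqrt_pos.2 hre)
    · intro b hb
      rw [← innerForm_apply, map_smul, LinearMap.smul_apply, innerForm_apply, hψS b hb, smul_zero]
    · rw [← innerForm_apply, map_smulₛₗ, map_smulₛₗ, LinearMap.smul_apply, innerForm_apply, hr,
        RingHom.id_apply,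
        ← Complex.ofReal_inv, Complex.conj_ofReal, smul_eq_mul, smul_eq_mul, ← Complex.ofReal_mul,
        ← Complex.ofReal_mul, ← Complex.ofReal_one, Complex.ofReal_inj]
      have := Real.mul_self_sqrt hre.le
      have h2 := (Real.sqrt_pos.2 hre).ne'
      field_simp
      nlinarith
  · intro φ φ' h h'
    set k := boxCoeff φ a
    set k' := boxCoeff φ' a
    have hk : 0 < k := h.leading
    have hk' : 0 < k' := h'.leading
    have hd : k' • φ - k • φ' = 0 := by
      by_contra hne
      refine (hL.pos _ hne).ne' (inner_eq_zero_of_terms (S := S) ?_ ?_)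
      · intro b hb
        rw [← innerForm_apply, map_sub, map_smul, map_smul, LinearMap.sub_apply,
          LinearMap.smul_apply, LinearMap.smul_apply, innerForm_apply, innerForm_apply,
          h.orthogonal b hb, h'.orthogonal b hb]
        simp
      · intro b hb
        by_contra hbS
        apply hb
        rw [boxCoeff_sub, boxCoeff_smul, boxCoeff_smul]
        by_cases hba : b = a
        · subst hba; exact sub_eq_zero.2 (mul_comm _ _)
        · have e1 : boxCoeff φ b = 0 := by
            by_contra e; exact (h.terms b e).elim hba hbS
          have e2 : boxCoeff φ' b = 0 := by
            by_contra e; exact (h'.terms b e).elim hba hbS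
          rw [e1, e2]; simp
    have hd' : k' • φ = k • φ' := sub_eq_zero.1 hd
    have hn : innerForm L (k' • φ) (k' • φ) = innerForm L (k • φ') (k • φ') := by rw [hd']
    simp only [map_smul, LinearMap.smul_apply, map_smulₛₗ, innerForm_apply, h.unit, h'.unit,
      smul_eq_mul, mul_one] at hn
    obtain ⟨a1, b1⟩ := Complex.pos_iff.1 hk
    obtain ⟨a2, b2⟩ := Complex.pos_iff.1 hk'
    have hkk : k = k' := by
      have := congrArg Complex.re hn
      simp only [Complex.mul_re, Complex.conj_re, Complex.conj_im, ← b1, ← b2] at this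
      refine Complex.ext ?_ (b1.symm.trans b2)
      nlinarith
    rw [hkk] at hd'
    exact smul_right_injective _ hk'.ne' hd'

/-- The monomials of degree at most `m` in `w` preceding `z ^ n * w ^ l` lexicographically. -/
def lexBelow {N M : ℕ} (n m l : ℕ) : Set (Box N M) :=
  {b | (b.1 : ℕ) < n ∧ (b.2 : ℕ) ≤ m ∨ (b.1 : ℕ) = n ∧ (b.2 : ℕ) < l}

/-- The monomials of degree at most `n` in `z` preceding `w ^ m * z ^ l` in the reverse
lexicographical ordering. -/
def revlexBelow {N M : ℕ} (n m l : ℕ) : Set (Box N M) :=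
  {b | (b.2 : ℕ) < m ∧ (b.1 : ℕ) ≤ n ∨ (b.2 : ℕ) = m ∧ (b.1 : ℕ) < l}

/-- The polynomial `φ_{n,m}^l`, `0 ≤ l ≤ m`, orthonormal in the lexicographical ordering, with
leading term at `z ^ n * w ^ l`. -/
def lexPoly {N M : ℕ} {L : laurentSpace N M →ₗ[ℂ] ℂ} (hL : PositiveDefinite L) (n m l : ℕ)
    (hn : n ≤ N) (hm : m ≤ M) (hl : l ≤ m) : polySpace N M :=
  (existsUnique_isOrthonormalAt hL (lexBelow n m l)
    (⟨n, Nat.lt_succ_of_le hn⟩, ⟨l, Nat.lt_succ_of_le (hl.trans hm)⟩)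
    (by simp [lexBelow])).choose

/-- The polynomial `φ̃_{n,m}^l`, `0 ≤ l ≤ n`, orthonormal in the reverse lexicographical ordering,
with leading term at `w ^ m * z ^ l`. -/
def revlexPoly {N M : ℕ} {L : laurentSpace N M →ₗ[ℂ] ℂ} (hL : PositiveDefinite L) (n m l : ℕ)
    (hn : n ≤ N) (hm : m ≤ M) (hl : l ≤ n) : polySpace N M :=
  (existsUnique_isOrthonormalAt hL (revlexBelow n m l)
    (⟨l, Nat.lt_succ_of_le (hl.trans hn)⟩, ⟨m, Nat.lt_succ_of_le hm⟩)
    (by simp [revlexBelow])).choose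

/-- The `m × n` matrix `𝒦_{n,m} = ⟨Φ_{n,m-1}, Φ̃_{n-1,m}⟩`, where
`Φ_{n,m-1} = (φ_{n,m-1}^{m-1}, …, φ_{n,m-1}^0)` and
`Φ̃_{n-1,m} = (φ̃_{n-1,m}^{n-1}, …, φ̃_{n-1,m}^0)`. It is empty if `n = 0` or `m = 0`. -/
def matK {n m : ℕ} {L : laurentSpace n m →ₗ[ℂ] ℂ} (hL : PositiveDefinite L) :
    Matrix (Fin m) (Fin n) ℂ :=
  Matrix.of fun r s =>
    pairing L
      (lexPoly hL n (m - 1) (m - 1 - r) le_rfl (Nat.sub_le m 1) (Nat.sub_le _ _))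
      (revlexPoly hL (n - 1) m (n - 1 - s) (Nat.sub_le n 1) le_rfl (Nat.sub_le _ _))

/-! ### Stability and spectral matching -/

/-- The reversed polynomial `z ^ n * w ^ m * p† (z, w)`, i.e. `∑ conj (p i j) z ^ (n - i) w ^ (m - j)`
for `p = ∑ p i j z ^ i w ^ j`. -/
def reverse {n m : ℕ} (p : polySpace n m) : polySpace n m :=
  ⟨monomial n m * dagger p, by
    have hp := AddMonoidAlgebra.mem_supported'.1 p.2
    refine AddMonoidAlgebra.mem_supported'.2 fun a ha => ?_
    rw [monomial, AddMonoidAlgebra.coeff_single_mul_apply, one_mul, dagger_coeff, hp, map_zero]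
    simp only [Set.mem_prod, Set.mem_Icc, Prod.fst_neg, Prod.snd_neg, Prod.fst_add,
      Prod.snd_add] at ha ⊢
    omega⟩

/-- `p` has no zero in the closed bidisk. -/
def IsStable {n m : ℕ} (p : polySpace n m) : Prop :=
  ∀ z w : ℂ, ‖z‖ ≤ 1 → ‖w‖ ≤ 1 → eval p z w ≠ 0

/-- `p` has degree `(n, m)`: the coefficient of `z ^ n * w ^ m` does not vanish. -/
def HasFullDegree {n m : ℕ} (p : polySpace n m) : Prop :=
  (p : Laurent).coeff ((n : ℤ), (m : ℤ)) ≠ 0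

/-- The moments of `L` up to `(n, m)` are those of the density `1 / |p| ^ 2` with respect to the
normalised Lebesgue measure on the bicircle. -/
def SpectralMatching {n m : ℕ} (L : laurentSpace n m →ₗ[ℂ] ℂ) (p : polySpace n m) : Prop :=
  ∀ (k l : ℤ) (hk : |k| ≤ n) (hl : |l| ≤ m),
    L ⟨monomial k l, monomial_mem_laurentSpace hk hl⟩ =
      (1 / (2 * (Real.pi : ℂ)) ^ 2) *
        ∫ t in Set.Icc (0 : ℝ) (2 * Real.pi) ×ˢ Set.Icc (0 : ℝ) (2 * Real.pi),
          Complex.exp (Complex.I * t.1) ^ k * Complex.exp (Complex.I * t.2) ^ l /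
            ((‖eval p (Complex.exp (Complex.I * t.1)) (Complex.exp (Complex.I * t.2))‖ ^ 2 : ℝ) : ℂ)

end Bicircle

end

noncomputable section

namespace Bicircle

/-! ### Algebra of Laurent polynomials -/

/-! Let Λ be `L` extended by zero (`extend`); only its values on products p q† with p, q in the box
of degree (n, m) matter. Call an increment in z a polynomial of degree at most (n, m-1) orthogonal
to those of degree at most (n-1, m-1), and an increment in w the same with the variables
interchanged. The entries of `matK` pair bases of the two increment spaces, so `matK hL = 0` says
that these spaces are orthogonal (`matK_eq_zero_iff`, `SplitOrthogonal`). Everything else is about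
split orthogonality.

Stability. Under split orthogonality a basis of the small box, the two kinds of increments and the
top polynomial φ form an orthonormal basis of the full box. Reversal is antiunitary for a moment
functional, so it preserves sums of R(p, p) over an orthonormal basis for every sesquilinear R.
Comparing these sums at the various degrees gives `christoffel_darboux`, which expresses R(rev φ,
rev φ) - R(φ, φ) through the other basis elements. With R the evaluation at (z, w) this bounds |rev
φ|² - |φ|² below by a positive multiple of (1-|z|²)(1-|w|²), and this excludes zeros of rev φ in the
closed bidisk, the boundary included (`eval_ne_zero_of_lower_bound`).

Moments. Let μ be the functional of 1/|φ|² (`szego`). With R extracting the coefficient of z^i, the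
same identity writes the sum of a_s times conjugated coefficient over the w-increments a_s through φ
alone (`sum_rowSesq_eq_kernelPoly`). On each circle w = const this makes the a_s orthonormal for the
weight 1/|φ|² (`form_slice_perp_basis`), hence all w^k a_s orthonormal for μ. A shift argument with
Bessel's inequality then shows that the a_s are also orthogonal to the small box for μ
(`form_szego_perp_basis_eq_zero`). So Λ and μ have the same w-increments, and this determines the
form on degrees (n-1, m) (`form_eq_form_szego`); by symmetry they agree on (n, m-1). Split
orthogonality of both functionals, together with their common top polynomial φ, gives agreement on
the full box (`IsTop.form_eq`).

Converse. It remains that μ is split orthogonal whenever the reversal of q is stable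
(`szego_splitOrthogonal`). This is also used in the moment step. A z-increment f is shown to be
orthogonal to the whole closed span of z^i w^j with 0 ≤ i < n and j ≥ 0, because the projection of f
there is again a polynomial in the small box. -/

theorem smul_monomial (c : ℂ) (i j : ℤ) :
    c • monomial i j = AddMonoidAlgebra.single (i, j) c := by
  simp [monomial]

theorem coeff_monomial (i j : ℤ) (a : ℤ × ℤ) :
    (monomial i j).coeff a = if (i, j) = a then 1 else 0 := by
  simp [monomial, Finsupp.single_apply]

@[elab_as_elim]
theorem Laurent.induction {P : Laurent → Prop} (p : Laurent)
    (add : ∀ p q, P p → P q → P (p + q)) (mon : ∀ (c : ℂ) i j, P (c • monomial i j)) : P p := by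
  obtain ⟨f⟩ := p
  induction f using Finsupp.induction_linear with
  | zero => simpa using mon 0 0 0
  | add f g hf hg => exact add _ _ hf hg
  | single a c => simpa [smul_monomial] using mon c a.1 a.2

theorem monomial_mul (i j k l : ℤ) :
    monomial i j * monomial k l = monomial (i + k) (j + l) := by
  simp [monomial, AddMonoidAlgebra.single_mul_single]

theorem monomial_zero : monomial 0 0 = 1 := rfl

theorem coeff_monomial_mul (i j : ℤ) (p : Laurent) (k l : ℤ) :
    (monomial i j * p).coeff (k, l) = p.coeff (k - i, l - j) := by
  rw [monomial, AddMonoidAlgebra.coeff_single_mul_apply, one_mul]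
  congr 1
  simp [Prod.ext_iff]; constructor <;> ring

theorem dagger_monomial (i j : ℤ) : dagger (monomial i j) = monomial (-i) (-j) := by
  ext ⟨k, l⟩
  rw [dagger_coeff, coeff_monomial, coeff_monomial]
  simp only [Prod.neg_mk, Prod.mk.injEq]
  by_cases h : i = -k ∧ j = -l
  · rw [if_pos h, if_pos (by omega)]; simp
  · rw [if_neg h, if_neg (by omega)]; simp

theorem dagger_dagger (p : Laurent) : dagger (dagger p) = p := by
  ext a; simp [dagger_coeff]

theorem dagger_zero : dagger 0 = 0 := by
  ext a; simp [dagger_coeff]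

theorem dagger_mul (p q : Laurent) : dagger (p * q) = dagger p * dagger q := by
  induction p using Laurent.induction with
  | add p p' h h' => rw [add_mul, dagger_add, h, h', dagger_add, add_mul]
  | mon c i j =>
    induction q using Laurent.induction with
    | add p p' h h' => rw [mul_add, dagger_add, h, h', dagger_add, mul_add]
    | mon d k l =>
      simp only [smul_mul_smul_comm, monomial_mul, dagger_smul, dagger_monomial, map_mul]
      congr 2 <;> ring

/-- The involution `dagger` as a conjugate-linear map. -/
def daggerMap : Laurent →ₛₗ[starRingEnd ℂ] Laurent where
  toFun := dagger
  map_add' := dagger_add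
  map_smul' := dagger_smul

theorem dagger_sum {ι : Type*} (s : Finset ι) (f : ι → Laurent) :
    dagger (∑ i ∈ s, f i) = ∑ i ∈ s, dagger (f i) := map_sum daggerMap f s

theorem dagger_one : dagger 1 = 1 := by
  rw [← monomial_zero, dagger_monomial]; simp

/-! ### Boxes of exponents. -/

/-- The polynomials with exponents in `[0, a) × [0, b)`. -/
def box (a b : ℤ) : Submodule ℂ Laurent :=
  AddMonoidAlgebra.supported ℂ ℂ (Set.Ico 0 a ×ˢ Set.Ico 0 b)

theorem mem_box {a b : ℤ} {p : Laurent} :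
    p ∈ box a b ↔ ∀ i j, p.coeff (i, j) ≠ 0 → (0 ≤ i ∧ i < a) ∧ 0 ≤ j ∧ j < b := by
  rw [box, AddMonoidAlgebra.mem_supported']
  simp only [Prod.forall, Set.mem_prod, Set.mem_Ico]
  exact forall₂_congr fun i j => not_imp_comm

theorem polySpace_eq_box (n m : ℕ) : polySpace n m = box (n + 1) (m + 1) := by
  ext p
  rw [mem_box, polySpace, AddMonoidAlgebra.mem_supported']
  simp only [Prod.forall, Set.mem_prod, Set.mem_Icc]
  refine forall₂_congr fun i j => ?_
  rw [not_imp_comm]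
  constructor <;> intro h h' <;> have := h h' <;> omega

theorem box_mono {a b a' b' : ℤ} (ha : a ≤ a') (hb : b ≤ b') : box a b ≤ box a' b' := by
  intro p hp
  rw [mem_box] at hp ⊢
  intro i j h
  have := hp i j h
  omega

theorem monomial_mem_box {a b i j : ℤ} (hi : 0 ≤ i) (hi' : i < a) (hj : 0 ≤ j) (hj' : j < b) :
    monomial i j ∈ box a b := by
  rw [mem_box]
  intro k l h
  rw [coeff_monomial] at h
  simp at h
  omega

theorem eq_sum_monomial (p : Laurent) {s : Finset (ℤ × ℤ)} (hs : p.coeff.support ⊆ s) :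
    p = ∑ a ∈ s, p.coeff a • monomial a.1 a.2 := by
  ext b
  simp only [AddMonoidAlgebra.coeff_sum, AddMonoidAlgebra.coeff_smul, Finsupp.finsetSum_apply,
    Finsupp.smul_apply, coeff_monomial, Prod.mk.eta, smul_eq_mul, mul_ite, mul_one, mul_zero,
    Finset.sum_ite_eq']
  split_ifs with h
  · rfl
  · exact Finsupp.notMem_support_iff.1 fun h' => h (hs h')

theorem support_subset_box {a b : ℤ} {p : Laurent} (hp : p ∈ box a b) :
    p.coeff.support ⊆ Finset.Ico 0 a ×ˢ Finset.Ico 0 b := by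
  intro c hc
  have := mem_box.1 hp c.1 c.2 (Finsupp.mem_support_iff.1 hc)
  simp only [Finset.mem_product, Finset.mem_Ico]
  exact this

theorem eq_sum_box {a b : ℤ} {p : Laurent} (hp : p ∈ box a b) :
    p = ∑ c ∈ Finset.Ico 0 a ×ˢ Finset.Ico 0 b, p.coeff c • monomial c.1 c.2 :=
  eq_sum_monomial p (support_subset_box hp)

theorem box_le {a b : ℤ} {U : Submodule ℂ Laurent}
    (h : ∀ i j, 0 ≤ i → i < a → 0 ≤ j → j < b → monomial i j ∈ U) : box a b ≤ U := by
  intro p hp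
  rw [eq_sum_box hp]
  refine Submodule.sum_mem _ fun c hc => Submodule.smul_mem _ _ ?_
  simp only [Finset.mem_product, Finset.mem_Ico] at hc
  exact h _ _ hc.1.1 hc.1.2 hc.2.1 hc.2.2

instance (a b : ℤ) : FiniteDimensional ℂ (box a b) := by
  have : box a b ≤ Submodule.span ℂ
      (((Finset.Ico 0 a ×ˢ Finset.Ico 0 b).image fun c => monomial c.1 c.2 : Finset Laurent) :
        Set Laurent) := by
    refine box_le fun i j h1 h2 h3 h4 => Submodule.subset_span ?_
    simp only [Finset.coe_image, Set.mem_image, Finset.mem_coe, Finset.mem_product, Finset.mem_Ico]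
    exact ⟨(i, j), ⟨⟨h1, h2⟩, h3, h4⟩, rfl⟩
  have hf : FiniteDimensional ℂ (Submodule.span ℂ
      (((Finset.Ico 0 a ×ˢ Finset.Ico 0 b).image fun c => monomial c.1 c.2 : Finset Laurent) :
        Set Laurent)) := FiniteDimensional.span_finset _ _
  exact Submodule.finiteDimensional_of_le this

theorem monomial_mul_mem_box {a b a' b' i j : ℤ} {p : Laurent} (hp : p ∈ box a b) (hi : 0 ≤ i)
    (hj : 0 ≤ j) (ha : a + i ≤ a') (hb : b + j ≤ b') : monomial i j * p ∈ box a' b' := by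
  rw [mem_box] at hp ⊢
  intro k l h
  rw [coeff_monomial_mul] at h
  have := hp _ _ h
  omega

/-- A polynomial without the corner term splits along the two sides of the corner. -/
theorem exists_add_of_coeff_corner {n m : ℤ} {p : Laurent} (hp : p ∈ box (n + 1) (m + 1))
    (h : p.coeff (n, m) = 0) : ∃ q ∈ box n (m + 1), ∃ r ∈ box (n + 1) m, p = q + r := by
  rw [mem_box] at hp
  refine ⟨.ofCoeff (p.coeff.filter fun a => a.1 < n), ?_,
    .ofCoeff (p.coeff.filter fun a => ¬ a.1 < n), ?_, ?_⟩
  · rw [mem_box]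
    intro i j hij
    rw [AddMonoidAlgebra.coeff_ofCoeff, Finsupp.filter_apply] at hij
    have h1 : i < n := by by_contra h'; simp [h'] at hij
    simp only [h1, if_true] at hij
    have := hp i j hij
    omega
  · rw [mem_box]
    intro i j hij
    rw [AddMonoidAlgebra.coeff_ofCoeff, Finsupp.filter_apply] at hij
    have h1 : ¬ i < n := by by_contra h'; simp [h'] at hij
    simp only [h1, not_false_eq_true, if_true] at hij
    have := hp i j hij
    by_cases h2 : i = n ∧ j = m
    · rw [h2.1, h2.2] at hij; exact absurd h hij
    · omega
  · apply AddMonoidAlgebra.ext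
    exact (Finsupp.filter_add_filter_not _ _).symm

/-! ### Reversal and coefficient rows. -/

/-- `z ^ n * w ^ m * p†`. -/
def rev (n m : ℤ) (p : Laurent) : Laurent := monomial n m * dagger p

theorem coeff_rev (n m : ℤ) (p : Laurent) (i j : ℤ) :
    (rev n m p).coeff (i, j) = starRingEnd ℂ (p.coeff (n - i, m - j)) := by
  rw [rev, coeff_monomial_mul, dagger_coeff]
  simp

theorem rev_rev (n m : ℤ) (p : Laurent) : rev n m (rev n m p) = p := by
  ext ⟨i, j⟩
  simp [coeff_rev]

theorem rev_mem_box {n m : ℤ} {p : Laurent} (hp : p ∈ box (n + 1) (m + 1)) :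
    rev n m p ∈ box (n + 1) (m + 1) := by
  rw [mem_box] at hp ⊢
  intro i j h
  rw [coeff_rev] at h
  have := hp (n - i) (m - j) (by simpa using h)
  omega

theorem rev_add_add (n m k l : ℤ) (p : Laurent) :
    rev (n + k) (m + l) p = monomial k l * rev n m p := by
  rw [rev, rev, ← mul_assoc, monomial_mul, add_comm k, add_comm l]

theorem rev_sum {ι : Type*} (n m : ℤ) (s : Finset ι) (f : ι → Laurent) :
    rev n m (∑ i ∈ s, f i) = ∑ i ∈ s, rev n m (f i) := by
  simp only [rev, dagger_sum, Finset.mul_sum]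

theorem rev_smul (n m : ℤ) (c : ℂ) (p : Laurent) :
    rev n m (c • p) = starRingEnd ℂ c • rev n m p := by
  simp only [rev, dagger_smul, mul_smul_comm]

theorem dagger_rev (n m : ℤ) (p : Laurent) : dagger (rev n m p) = monomial (-n) (-m) * p := by
  rw [rev, dagger_mul, dagger_monomial, dagger_dagger]

theorem rev_mul_dagger_rev (n m : ℤ) (p q : Laurent) :
    rev n m p * dagger (rev n m q) = q * dagger p := by
  rw [dagger_rev, rev]
  calc monomial n m * dagger p * (monomial (-n) (-m) * q)
      = (monomial n m * monomial (-n) (-m)) * (q * dagger p) := by ring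
    _ = _ := by rw [monomial_mul, add_neg_cancel, add_neg_cancel, monomial_zero, one_mul]

/-- The coefficient of `z ^ i` in `p`, a Laurent polynomial in `w`. -/
def row (i : ℤ) : Laurent →ₗ[ℂ] Laurent where
  toFun p := .ofCoeff ((monomial (-i) 0 * p).coeff.filter fun a => a.1 = 0)
  map_add' p q := by
    rw [mul_add, AddMonoidAlgebra.coeff_add, Finsupp.filter_add]; rfl
  map_smul' c p := by
    rw [mul_smul_comm, AddMonoidAlgebra.coeff_smul, Finsupp.filter_smul]; rfl

theorem coeff_row (i : ℤ) (p : Laurent) (k l : ℤ) :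
    (row i p).coeff (k, l) = if k = 0 then p.coeff (i, l) else 0 := by
  simp only [row, LinearMap.coe_mk, AddHom.coe_mk, AddMonoidAlgebra.coeff_ofCoeff,
    Finsupp.filter_apply, coeff_monomial_mul]
  split_ifs with h
  · rw [h]; simp
  · rfl

theorem row_monomial_mul (i k l : ℤ) (p : Laurent) :
    row i (monomial k l * p) = monomial 0 l * row (i - k) p := by
  ext ⟨a, b⟩
  simp only [coeff_row, coeff_monomial_mul, sub_zero]

theorem row_eq_zero {a b i : ℤ} {p : Laurent} (hp : p ∈ box a b) (hi : i < 0 ∨ a ≤ i) :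
    row i p = 0 := by
  ext ⟨k, l⟩
  rw [coeff_row, AddMonoidAlgebra.coeff_zero, Finsupp.zero_apply]
  split_ifs
  · by_contra h
    have := mem_box.1 hp _ _ h
    omega
  · rfl

theorem sum_row {a b : ℤ} {p : Laurent} (hp : p ∈ box a b) :
    ∑ i ∈ Finset.Ico 0 a, monomial i 0 * row i p = p := by
  ext ⟨k, l⟩
  simp only [AddMonoidAlgebra.coeff_sum, Finsupp.finsetSum_apply, coeff_monomial_mul, coeff_row,
    sub_zero, sub_eq_zero, Finset.sum_ite_eq, Finset.mem_Ico]
  split_ifs with h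
  · rfl
  · by_contra h'
    have := mem_box.1 hp k l (Ne.symm h')
    omega

/-! ### Sesquilinear forms and orthonormal bases -/

/-- Sesquilinear maps, linear in the first argument. -/
abbrev Sesq (V W : Type*) [AddCommGroup V] [Module ℂ V] [AddCommGroup W] [Module ℂ W] : Type _ :=
  V →ₗ[ℂ] V →ₛₗ[starRingEnd ℂ] W

/-- `e` is an orthonormal basis of `U` with respect to `B`. -/
structure IsONB {V : Type*} [AddCommGroup V] [Module ℂ V] {ι : Type*} [Fintype ι]
    (B : Sesq V ℂ) (U : Submodule ℂ V) (e : ι → V) : Prop where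
  mem : ∀ i, e i ∈ U
  unit : ∀ i, B (e i) (e i) = 1
  orth : ∀ i j, i ≠ j → B (e i) (e j) = 0
  expand : ∀ x ∈ U, x = ∑ i, B x (e i) • e i

/-- The elements of `U` that are orthogonal to `W`. -/
def perp {V : Type*} [AddCommGroup V] [Module ℂ V] (B : Sesq V ℂ) (U W : Submodule ℂ V) :
    Submodule ℂ V where
  carrier := {x | x ∈ U ∧ ∀ y ∈ W, B x y = 0}
  add_mem' := fun ha hb => ⟨U.add_mem ha.1 hb.1, fun y hy => by
    rw [map_add, LinearMap.add_apply, ha.2 y hy, hb.2 y hy, add_zero]⟩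
  zero_mem' := ⟨U.zero_mem, fun y _ => by simp⟩
  smul_mem' := fun c x hx => ⟨U.smul_mem c hx.1, fun y hy => by
    rw [map_smul, LinearMap.smul_apply, hx.2 y hy, smul_zero]⟩

section

variable {V W : Type*} [AddCommGroup V] [Module ℂ V] [AddCommGroup W] [Module ℂ W]
  {B : Sesq V ℂ} {U : Submodule ℂ V}

theorem form_nonneg (hp : ∀ x ∈ U, x ≠ 0 → 0 < B x x) {x : V} (hx : x ∈ U) : 0 ≤ B x x := by
  rcases eq_or_ne x 0 with rfl | h
  · simp
  · exact (hp x hx h).le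

theorem eq_zero_of_form_self (hp : ∀ x ∈ U, x ≠ 0 → 0 < B x x) {x : V} (hx : x ∈ U)
    (h : B x x = 0) : x = 0 := by
  by_contra h'
  exact (hp x hx h').ne' h

/-- Sums of a sesquilinear map over an orthonormal basis do not depend on the basis. -/
theorem IsONB.sum_eq {ι κ : Type*} [Fintype ι] [Fintype κ] {e : ι → V} {f : κ → V}
    (hB : ∀ x y, B y x = starRingEnd ℂ (B x y)) (he : IsONB B U e) (hf : IsONB B U f)
    (R : Sesq V W) : ∑ i, R (e i) (e i) = ∑ k, R (f k) (f k) := by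
  have h1 : ∀ i, R (e i) (e i) = ∑ k, R (f k) (B (f k) (e i) • e i) := by
    intro i
    conv_lhs => rw [show R (e i) = R (∑ k, B (e i) (f k) • f k) by rw [← hf.expand _ (he.mem i)]]
    rw [map_sum, LinearMap.sum_apply]
    refine Finset.sum_congr rfl fun k _ => ?_
    rw [map_smul, LinearMap.smul_apply, map_smulₛₗ, ← hB]
  simp_rw [h1]
  rw [Finset.sum_comm]
  refine Finset.sum_congr rfl fun k _ => ?_
  rw [← map_sum, ← he.expand _ (hf.mem k)]

theorem IsONB.form_eq {ι : Type*} [Fintype ι] {e : ι → V} (he : IsONB B U e) {x : V} (hx : x ∈ U) :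
    B x x = ((∑ i, ‖B x (e i)‖ ^ 2 : ℝ) : ℂ) := by
  refine (congrArg (B x) (he.expand x hx)).trans ?_
  rw [map_sum, Complex.ofReal_sum]
  refine Finset.sum_congr rfl fun i _ => ?_
  rw [map_smulₛₗ, smul_eq_mul, mul_comm, Complex.mul_conj, Complex.normSq_eq_norm_sq]

theorem exists_isONB (hB : ∀ x y, B y x = starRingEnd ℂ (B x y))
    (hp : ∀ x ∈ U, x ≠ 0 → 0 < B x x) [FiniteDimensional ℂ U] :
    ∃ e : Fin (Module.finrank ℂ U) → V, IsONB B U e := by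
  let core : InnerProductSpace.Core ℂ U :=
    -- The form is linear in its first argument, the inner product in its second.
    { inner := fun x y => B y x
      conj_inner_symm := fun x y => (hB _ _).symm
      re_inner_nonneg := fun x => (Complex.le_def.1 (form_nonneg hp x.2)).1
      add_left := fun x y z => by simp
      smul_left := fun x y r => by simp
      definite := fun x hx => Subtype.ext (eq_zero_of_form_self hp x.2 hx) }
  let _ : NormedAddCommGroup U := core.toNormedAddCommGroup
  let _ : InnerProductSpace ℂ U := InnerProductSpace.ofCore core.toCore
  let b := stdOrthonormalBasis ℂ U
  have hin : ∀ x y : U, inner ℂ x y = B y x := fun x y => rfl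
  refine ⟨fun i => (b i : V), fun i => (b i).2, fun i => ?_, fun i j hij => ?_, fun x hx => ?_⟩
  · rw [← hin]; simp
  · rw [← hin]; exact b.orthonormal.2 hij.symm
  · have := congrArg (Subtype.val) (b.sum_repr' ⟨x, hx⟩)
    simp only [AddSubmonoidClass.coe_finsetSum, Submodule.coe_smul, hin] at this
    exact this.symm

theorem IsONB.form_left_eq_zero {ι : Type*} [Fintype ι] {e : ι → V} (he : IsONB B U e) {y : V}
    (h : ∀ i, B y (e i) = 0) {x : V} (hx : x ∈ U) : B y x = 0 := by
  rw [he.expand x hx, map_sum]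
  refine Finset.sum_eq_zero fun i _ => ?_
  rw [map_smulₛₗ, h, smul_zero]

theorem isONB_of_complete {ι : Type*} [Fintype ι] {e : ι → V} (hm : ∀ i, e i ∈ U)
    (h1 : ∀ i, B (e i) (e i) = 1) (h0 : ∀ i j, i ≠ j → B (e i) (e j) = 0)
    (hc : ∀ y ∈ U, (∀ i, B y (e i) = 0) → y = 0) : IsONB B U e := by
  refine ⟨hm, h1, h0, fun x hx => ?_⟩
  rw [← sub_eq_zero]
  refine hc _ (U.sub_mem hx (U.sum_mem fun i _ => U.smul_mem _ (hm i))) fun j => ?_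
  rw [map_sub, LinearMap.sub_apply, map_sum, LinearMap.sum_apply, Finset.sum_eq_single j]
  · simp [h1]
  · intro i _ hij
    rw [map_smul, LinearMap.smul_apply, h0 i j hij, smul_zero]
  · simp

theorem IsONB.sum_elim {ι κ : Type*} [Fintype ι] [Fintype κ] {e : ι → V} {f : κ → V}
    {U' : Submodule ℂ V} (hB : ∀ x y, B y x = starRingEnd ℂ (B x y)) (hU : U' ≤ U)
    (he : IsONB B U' e) (hf : IsONB B (perp B U U') f) : IsONB B U (Sum.elim e f) := by
  have hfe : ∀ i k, B (f k) (e i) = 0 := fun i k => (hf.mem k).2 _ (he.mem i)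
  refine ⟨?_, ?_, ?_, ?_⟩
  · rintro (i | k)
    · exact hU (he.mem i)
    · exact (hf.mem k).1
  · rintro (i | k)
    · exact he.unit i
    · exact hf.unit k
  · rintro (i | k) (j | l) h
    · exact he.orth i j fun h' => h (h' ▸ rfl)
    · simp only [Sum.elim_inl, Sum.elim_inr]
      rw [hB, hfe, map_zero]
    · exact hfe j k
    · exact hf.orth k l fun h' => h (h' ▸ rfl)
  · intro x hx
    rw [Fintype.sum_sum_type]
    simp only [Sum.elim_inl, Sum.elim_inr]
    set y := ∑ i, B x (e i) • e i with hy
    have hyU : y ∈ U' := U'.sum_mem fun i _ => U'.smul_mem _ (he.mem i)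
    have hxy : x - y ∈ perp B U U' := by
      refine ⟨U.sub_mem hx (hU hyU), fun z hz => he.form_left_eq_zero (fun j => ?_) hz⟩
      rw [map_sub, LinearMap.sub_apply, hy, map_sum, LinearMap.sum_apply, Finset.sum_eq_single j]
      · simp [he.unit]
      · intro i _ hij
        rw [map_smul, LinearMap.smul_apply, he.orth i j hij, smul_zero]
      · simp
    have h3 : ∀ k, B (x - y) (f k) = B x (f k) := by
      intro k
      rw [map_sub, LinearMap.sub_apply, hB (f k) y, (hf.mem k).2 y hyU, map_zero, sub_zero]
    have := hf.expand _ hxy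
    simp only [h3] at this
    rw [← this]
    abel

end

/-! ### The form attached to a moment functional -/

/-- `⟨p, q⟩ = Λ (p * q†)`. -/
def form (Λ : Laurent →ₗ[ℂ] ℂ) : Sesq Laurent ℂ :=
  LinearMap.mk₂'ₛₗ (RingHom.id ℂ) (starRingEnd ℂ) (fun p q => Λ (p * dagger q))
    (fun p p' q => by rw [add_mul, map_add])
    (fun c p q => by rw [smul_mul_assoc, map_smul, RingHom.id_apply])
    (fun p q q' => by rw [dagger_add, mul_add, map_add])
    (fun c p q => by rw [dagger_smul, mul_smul_comm, map_smul])

theorem form_apply (Λ : Laurent →ₗ[ℂ] ℂ) (p q : Laurent) : form Λ p q = Λ (p * dagger q) := rfl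

/-- The functional is compatible with complex conjugation. -/
def IsHerm (Λ : Laurent →ₗ[ℂ] ℂ) : Prop := ∀ p, Λ (dagger p) = starRingEnd ℂ (Λ p)

theorem IsHerm.form_symm {Λ : Laurent →ₗ[ℂ] ℂ} (h : IsHerm Λ) (p q : Laurent) :
    form Λ q p = starRingEnd ℂ (form Λ p q) := by
  rw [form_apply, form_apply, ← h, dagger_mul, dagger_dagger, mul_comm]

theorem form_monomial_mul (Λ : Laurent →ₗ[ℂ] ℂ) (i j : ℤ) (p q : Laurent) :
    form Λ (monomial i j * p) (monomial i j * q) = form Λ p q := by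
  rw [form_apply, form_apply, dagger_mul, dagger_monomial]
  congr 1
  calc monomial i j * p * (monomial (-i) (-j) * dagger q)
      = (monomial i j * monomial (-i) (-j)) * (p * dagger q) := by ring
    _ = _ := by rw [monomial_mul, add_neg_cancel, add_neg_cancel, monomial_zero, one_mul]

/-- The form sees only p q†, and reversing both arguments turns this into q p†. This antiunitarity
is where the Toeplitz structure of the moments enters. -/
theorem form_rev (Λ : Laurent →ₗ[ℂ] ℂ) (n m : ℤ) (p q : Laurent) :
    form Λ (rev n m p) (rev n m q) = form Λ q p := by
  rw [form_apply, rev_mul_dagger_rev, form_apply]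

/-- Positivity on polynomials with exponents in `[0, a) × [0, b)`. -/
def PosOn (Λ : Laurent →ₗ[ℂ] ℂ) (a b : ℤ) : Prop := ∀ p ∈ box a b, p ≠ 0 → 0 < form Λ p p

theorem PosOn.mono {Λ : Laurent →ₗ[ℂ] ℂ} {a b a' b' : ℤ} (h : PosOn Λ a' b') (ha : a ≤ a')
    (hb : b ≤ b') : PosOn Λ a b := fun p hp => h p (box_mono ha hb hp)

theorem IsONB.rev {Λ : Laurent →ₗ[ℂ] ℂ} (hΛ : IsHerm Λ) {n m : ℤ} {ι : Type*} [Fintype ι]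
    {e : ι → Laurent} (he : IsONB (form Λ) (box (n + 1) (m + 1)) e) :
    IsONB (form Λ) (box (n + 1) (m + 1)) fun i => rev n m (e i) := by
  refine ⟨fun i => rev_mem_box (he.mem i), fun i => ?_, fun i j hij => ?_, fun x hx => ?_⟩
  · rw [form_rev, he.unit]
  · rw [form_rev, he.orth j i hij.symm]
  · conv_lhs => rw [← rev_rev n m x, he.expand _ (rev_mem_box hx), rev_sum]
    refine Finset.sum_congr rfl fun i _ => ?_
    rw [rev_smul]
    congr 1
    rw [← hΛ.form_symm]
    conv_rhs => rw [← rev_rev n m x, form_rev]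

/-- `R` with both arguments multiplied by `z ^ i * w ^ j`. -/
def shift {W : Type*} [AddCommGroup W] [Module ℂ W] (i j : ℤ) (R : Sesq Laurent W) :
    Sesq Laurent W :=
  LinearMap.mk₂'ₛₗ (RingHom.id ℂ) (starRingEnd ℂ)
    (fun p q => R (monomial i j * p) (monomial i j * q))
    (fun p p' q => by rw [mul_add, map_add, LinearMap.add_apply])
    (fun c p q => by rw [mul_smul_comm, map_smul, LinearMap.smul_apply, RingHom.id_apply])
    (fun p q q' => by rw [mul_add, map_add])
    (fun c p q => by rw [mul_smul_comm, map_smulₛₗ])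

theorem shift_apply {W : Type*} [AddCommGroup W] [Module ℂ W] (i j : ℤ) (R : Sesq Laurent W)
    (p q : Laurent) : shift i j R p q = R (monomial i j * p) (monomial i j * q) := rfl

/-! ### Split orthogonality and the Christoffel–Darboux identity. -/

/-- The two spaces of increments are orthogonal to each other. -/
def SplitOrthogonal (Λ : Laurent →ₗ[ℂ] ℂ) (n m : ℤ) : Prop :=
  ∀ f ∈ perp (form Λ) (box (n + 1) m) (box n m), ∀ g ∈ perp (form Λ) (box n (m + 1)) (box n m),
    form Λ f g = 0

/-- For an orthonormal basis `e` of `box n m`, extended by `a` to one of `box n (m + 1)`. -/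
theorem sum_rev_perp {Λ : Laurent →ₗ[ℂ] ℂ} (hΛ : IsHerm Λ) {n m : ℤ} {ι κ W : Type*} [Fintype ι]
    [Fintype κ] [AddCommGroup W] [Module ℂ W] {e : ι → Laurent} {a : κ → Laurent}
    (he : IsONB (form Λ) (box n m) e)
    (ha : IsONB (form Λ) (perp (form Λ) (box n (m + 1)) (box n m)) a) (R : Sesq Laurent W) :
    ∑ k, R (rev (n - 1) m (a k)) (rev (n - 1) m (a k)) =
      ∑ i, R (e i) (e i) + ∑ k, R (a k) (a k) - ∑ i, shift 0 1 R (e i) (e i) := by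
  have hU : IsONB (form Λ) (box n (m + 1)) (Sum.elim e a) :=
    ha |> he.sum_elim hΛ.form_symm (box_mono le_rfl (by omega))
  have h1 : IsONB (form Λ) (box (n - 1 + 1) (m + 1)) (Sum.elim e a) := by rwa [sub_add_cancel]
  -- Reversal of degree (n-1, m) carries a basis of the larger box to another one. On the elements
  -- `e` it is w times the reversal of degree (n-1, m-1), which carries a basis of `box n m` to a
  -- basis; the factor w becomes a shift of `R`.
  have h2 := (h1.rev hΛ).sum_eq hΛ.form_symm h1 R
  have h3 : IsONB (form Λ) (box (n - 1 + 1) (m - 1 + 1)) e := by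
    rwa [sub_add_cancel, sub_add_cancel]
  have h4 := (h3.rev hΛ).sum_eq hΛ.form_symm h3 (shift 0 1 R)
  simp only [Fintype.sum_sum_type, Sum.elim_inl, Sum.elim_inr] at h2
  have h5 : ∀ i, rev (n - 1) m (e i) = monomial 0 1 * rev (n - 1) (m - 1) (e i) := by
    intro i
    rw [← rev_add_add]; simp
  simp only [h5, ← shift_apply] at h2
  rw [h4] at h2
  rw [← h2]
  abel

/-- The counterpart of `sum_rev_perp` with the roles of z and w interchanged. -/
theorem sum_rev_perp' {Λ : Laurent →ₗ[ℂ] ℂ} (hΛ : IsHerm Λ) {n m : ℤ} {ι κ W : Type*} [Fintype ι]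
    [Fintype κ] [AddCommGroup W] [Module ℂ W] {e : ι → Laurent} {a : κ → Laurent}
    (he : IsONB (form Λ) (box n m) e)
    (ha : IsONB (form Λ) (perp (form Λ) (box (n + 1) m) (box n m)) a) (R : Sesq Laurent W) :
    ∑ k, R (rev n (m - 1) (a k)) (rev n (m - 1) (a k)) =
      ∑ i, R (e i) (e i) + ∑ k, R (a k) (a k) - ∑ i, shift 1 0 R (e i) (e i) := by
  have hU : IsONB (form Λ) (box (n + 1) m) (Sum.elim e a) :=
    ha |> he.sum_elim hΛ.form_symm (box_mono (by omega) le_rfl)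
  have h1 : IsONB (form Λ) (box (n + 1) (m - 1 + 1)) (Sum.elim e a) := by rwa [sub_add_cancel]
  have h2 := (h1.rev hΛ).sum_eq hΛ.form_symm h1 R
  have h3 : IsONB (form Λ) (box (n - 1 + 1) (m - 1 + 1)) e := by
    rwa [sub_add_cancel, sub_add_cancel]
  have h4 := (h3.rev hΛ).sum_eq hΛ.form_symm h3 (shift 1 0 R)
  simp only [Fintype.sum_sum_type, Sum.elim_inl, Sum.elim_inr] at h2
  have h5 : ∀ i, rev n (m - 1) (e i) = monomial 1 0 * rev (n - 1) (m - 1) (e i) := by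
    intro i
    rw [← rev_add_add]; simp
  simp only [h5, ← shift_apply] at h2
  rw [h4] at h2
  rw [← h2]
  abel

/-- The top polynomial: unit, with every other monomial of the box orthogonal to it. -/
structure IsTop (Λ : Laurent →ₗ[ℂ] ℂ) (n m : ℤ) (φ : Laurent) : Prop where
  mem : φ ∈ box (n + 1) (m + 1)
  orth_left : ∀ p ∈ box n (m + 1), form Λ φ p = 0
  orth_right : ∀ p ∈ box (n + 1) m, form Λ φ p = 0
  unit : form Λ φ φ = 1

/-- Without the corner term, φ would be a sum of two polynomials to which it is orthogonal, and so
could not have norm one. -/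
theorem IsTop.coeff_ne_zero {Λ : Laurent →ₗ[ℂ] ℂ} {n m : ℤ} {φ : Laurent} (h : IsTop Λ n m φ) :
    φ.coeff (n, m) ≠ 0 := by
  intro h0
  obtain ⟨q, hq, r, hr, hqr⟩ := exists_add_of_coeff_corner h.mem h0
  have := h.unit
  rw [show form Λ φ φ = form Λ φ (q + r) by rw [← hqr], map_add, h.orth_left q hq,
    h.orth_right r hr] at this
  simp at this

/-- Split orthogonality supplies the one missing relation, between `c` and `a`. For completeness, a
polynomial orthogonal to all these elements is, after splitting off a multiple of φ, seen to be
orthogonal to itself. -/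
theorem isONB_box {Λ : Laurent →ₗ[ℂ] ℂ} (hΛ : IsHerm Λ) {n m : ℤ}
    (hp : PosOn Λ (n + 1) (m + 1)) (hs : SplitOrthogonal Λ n m) {φ : Laurent}
    (hφ : IsTop Λ n m φ) {ι κ κ' : Type*} [Fintype ι] [Fintype κ] [Fintype κ'] {e : ι → Laurent}
    {a : κ → Laurent} {c : κ' → Laurent} (he : IsONB (form Λ) (box n m) e)
    (ha : IsONB (form Λ) (perp (form Λ) (box n (m + 1)) (box n m)) a)
    (hc : IsONB (form Λ) (perp (form Λ) (box (n + 1) m) (box n m)) c) :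
    IsONB (form Λ) (box (n + 1) (m + 1))
      (Sum.elim (Sum.elim e a) (Sum.elim c fun _ : Unit => φ)) := by
  have hA : IsONB (form Λ) (box n (m + 1)) (Sum.elim e a) :=
    ha |> he.sum_elim hΛ.form_symm (box_mono le_rfl (by omega))
  have hC : IsONB (form Λ) (box (n + 1) m) (Sum.elim e c) :=
    hc |> he.sum_elim hΛ.form_symm (box_mono (by omega) le_rfl)
  refine hA.sum_elim hΛ.form_symm (box_mono (by omega) le_rfl) (isONB_of_complete ?_ ?_ ?_ ?_)
  · rintro (k | _)
    · refine ⟨box_mono le_rfl (by omega) (hc.mem k).1, fun y hy => hA.form_left_eq_zero ?_ hy⟩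
      rintro (i | l)
      · exact (hc.mem k).2 _ (he.mem i)
      · exact hs _ (hc.mem k) _ (ha.mem l)
    · exact ⟨hφ.mem, hφ.orth_left⟩
  · rintro (k | _)
    · exact hc.unit k
    · exact hφ.unit
  · rintro (k | _) (l | _) h
    · exact hc.orth k l fun h' => h (h' ▸ rfl)
    · simp only [Sum.elim_inl, Sum.elim_inr]
      rw [hΛ.form_symm φ, hφ.orth_right _ (hc.mem k).1, map_zero]
    · exact hφ.orth_right _ (hc.mem l).1
    · exact absurd rfl h
  · intro y hy h
    have hyC : ∀ x ∈ box (n + 1) m, form Λ y x = 0 := by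
      intro x hx
      refine hC.form_left_eq_zero ?_ hx
      rintro (i | k)
      · exact hy.2 _ (box_mono le_rfl (by omega) (he.mem i))
      · exact h (Sum.inl k)
    refine eq_zero_of_form_self hp hy.1 ?_
    -- Chosen to cancel the corner coefficient.
    set t := y.coeff (n, m) / φ.coeff (n, m) with ht
    have h0 : (y - t • φ).coeff (n, m) = 0 := by
      simp only [AddMonoidAlgebra.coeff_sub, AddMonoidAlgebra.coeff_smul, Finsupp.sub_apply,
        Finsupp.smul_apply, smul_eq_mul, ht]
      rw [div_mul_cancel₀ _ hφ.coeff_ne_zero, sub_self]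
    obtain ⟨q, hq, r, hr, hqr⟩ := exists_add_of_coeff_corner
      (Submodule.sub_mem _ hy.1 (Submodule.smul_mem _ t hφ.mem)) h0
    have hy' : y = q + r + t • φ := by rw [← hqr]; abel
    rw [show form Λ y y = form Λ y (q + r + t • φ) by rw [← hy'], map_add, map_add, map_smulₛₗ,
      hy.2 q hq, hyC r hr, show form Λ y φ = 0 from h (Sum.inr ())]
    simp

/-- The Christoffel–Darboux identity for a split-orthogonal functional. -/
theorem christoffel_darboux {Λ : Laurent →ₗ[ℂ] ℂ} (hΛ : IsHerm Λ) {n m : ℤ}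
    (hp : PosOn Λ (n + 1) (m + 1)) (hs : SplitOrthogonal Λ n m) {φ : Laurent}
    (hφ : IsTop Λ n m φ) {ι κ κ' W : Type*} [Fintype ι] [Fintype κ] [Fintype κ']
    [AddCommGroup W] [Module ℂ W] {e : ι → Laurent}
    {a : κ → Laurent} {c : κ' → Laurent} (he : IsONB (form Λ) (box n m) e)
    (ha : IsONB (form Λ) (perp (form Λ) (box n (m + 1)) (box n m)) a)
    (hc : IsONB (form Λ) (perp (form Λ) (box (n + 1) m) (box n m)) c) (R : Sesq Laurent W) :
    R (rev n m φ) (rev n m φ) - R φ φ =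
      ∑ i, (R (e i) (e i) - shift 1 0 R (e i) (e i) - shift 0 1 R (e i) (e i)
        + shift 1 1 R (e i) (e i)) +
      ∑ k, (R (a k) (a k) - shift 1 0 R (a k) (a k)) +
      ∑ k, (R (c k) (c k) - shift 0 1 R (c k) (c k)) := by
  -- Reversing the full basis does not change the sum of `R`. Each block is then reversed at its own
  -- degree, where its sum is known, and the excess factor z, w or zw turns into a shift of `R`.
  have h1 := isONB_box hΛ hp hs hφ he ha hc
  have h2 := (h1.rev hΛ).sum_eq hΛ.form_symm h1 R
  have h3 : IsONB (form Λ) (box (n - 1 + 1) (m - 1 + 1)) e := by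
    rwa [sub_add_cancel, sub_add_cancel]
  have h4 := (h3.rev hΛ).sum_eq hΛ.form_symm h3 (shift 1 1 R)
  have h5 := sum_rev_perp hΛ he ha (shift 1 0 R)
  have h6 := sum_rev_perp' hΛ he hc (shift 0 1 R)
  have e1 : ∀ p, rev n m p = monomial 1 0 * rev (n - 1) m p := fun p => by
    rw [← rev_add_add]; simp
  have e2 : ∀ p, rev n m p = monomial 0 1 * rev n (m - 1) p := fun p => by
    rw [← rev_add_add]; simp
  have e3 : ∀ p, rev n m p = monomial 1 1 * rev (n - 1) (m - 1) p := fun p => by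
    rw [← rev_add_add]; simp
  have e4 : shift 0 1 (shift 1 0 R) = shift 1 1 R := by
    ext p q; simp [shift_apply, ← mul_assoc, monomial_mul]
  have e5 : shift 1 0 (shift 0 1 R) = shift 1 1 R := by
    ext p q; simp [shift_apply, ← mul_assoc, monomial_mul]
  have f1 : ∀ i, R (rev n m (e i)) (rev n m (e i)) =
      shift 1 1 R (rev (n - 1) (m - 1) (e i)) (rev (n - 1) (m - 1) (e i)) := fun i => by
    rw [e3, shift_apply]
  have f2 : ∀ i, R (rev n m (a i)) (rev n m (a i)) =
      shift 1 0 R (rev (n - 1) m (a i)) (rev (n - 1) m (a i)) := fun i => by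
    rw [e1, shift_apply]
  have f3 : ∀ i, R (rev n m (c i)) (rev n m (c i)) =
      shift 0 1 R (rev n (m - 1) (c i)) (rev n (m - 1) (c i)) := fun i => by
    rw [e2, shift_apply]
  rw [e4] at h5
  rw [e5] at h6
  simp only [Fintype.sum_sum_type, Sum.elim_inl, Sum.elim_inr, f1, f2, f3, h4, h5, h6,
    Finset.univ_unique, Finset.sum_singleton] at h2
  simp only [Finset.sum_add_distrib, Finset.sum_sub_distrib]
  rw [← sub_eq_zero] at h2 ⊢
  rw [← h2]
  abel

/-! ### Evaluation and stability -/

/-- Evaluation at `(z, w)` as a linear map. -/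
def evalMap (z w : ℂ) : Laurent →ₗ[ℂ] ℂ where
  toFun p := eval p z w
  map_add' p q := Finsupp.sum_add_index' (by simp) (by intros; ring)
  map_smul' c p := by
    rw [eval, AddMonoidAlgebra.coeff_smul, Finsupp.sum_smul_index'] <;> intros <;>
      simp [eval, Finsupp.mul_sum, mul_assoc]

theorem eval_add (p q : Laurent) (z w : ℂ) : eval (p + q) z w = eval p z w + eval q z w :=
  map_add (evalMap z w) p q

theorem eval_smul (c : ℂ) (p : Laurent) (z w : ℂ) : eval (c • p) z w = c * eval p z w :=
  map_smul (evalMap z w) c p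

theorem eval_sum {ι : Type*} (s : Finset ι) (f : ι → Laurent) (z w : ℂ) :
    eval (∑ i ∈ s, f i) z w = ∑ i ∈ s, eval (f i) z w :=
  map_sum (evalMap z w) f s

theorem eval_monomial (i j : ℤ) (z w : ℂ) : eval (monomial i j) z w = z ^ i * w ^ j := by
  simp [eval, monomial]

theorem eval_one (z w : ℂ) : eval 1 z w = 1 := by
  rw [← monomial_zero, eval_monomial]; simp

theorem eval_mul {z w : ℂ} (hz : z ≠ 0) (hw : w ≠ 0) (p q : Laurent) :
    eval (p * q) z w = eval p z w * eval q z w := by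
  induction p using Laurent.induction with
  | add p p' h h' => rw [add_mul, eval_add, h, h', eval_add, add_mul]
  | mon c i j =>
    induction q using Laurent.induction with
    | add p p' h h' => rw [mul_add, eval_add, h, h', eval_add, mul_add]
    | mon d k l =>
      rw [smul_mul_smul_comm, monomial_mul, eval_smul, eval_smul, eval_smul, eval_monomial,
        eval_monomial, eval_monomial, zpow_add₀ hz, zpow_add₀ hw]
      ring

theorem eval_dagger (p : Laurent) (z w : ℂ) :
    eval (dagger p) z w =
      starRingEnd ℂ (eval p (starRingEnd ℂ z)⁻¹ (starRingEnd ℂ w)⁻¹) := by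
  induction p using Laurent.induction with
  | add p q hp hq => rw [dagger_add, eval_add, hp, hq, eval_add, map_add]
  | mon c i j =>
    rw [dagger_smul, dagger_monomial, eval_smul, eval_smul, eval_monomial, eval_monomial]
    simp

theorem eval_rev {z w : ℂ} (hz : z ≠ 0) (hw : w ≠ 0) (n m : ℤ) (p : Laurent) :
    eval (rev n m p) z w = z ^ n * w ^ m *
      starRingEnd ℂ (eval p (starRingEnd ℂ z)⁻¹ (starRingEnd ℂ w)⁻¹) := by
  rw [rev, eval_mul hz hw, eval_monomial, eval_dagger]

theorem eval_eq_sum_box {a b : ℤ} {p : Laurent} (hp : p ∈ box a b) (z w : ℂ) :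
    eval p z w = ∑ c ∈ Finset.Ico 0 a ×ˢ Finset.Ico 0 b, p.coeff c * (z ^ c.1 * w ^ c.2) := by
  conv_lhs => rw [eq_sum_box hp]
  rw [eval_sum]
  exact Finset.sum_congr rfl fun c _ => by rw [eval_smul, eval_monomial]

theorem zpow_add_of_nonneg (z : ℂ) {i k : ℤ} (hi : 0 ≤ i) (hk : 0 ≤ k) :
    z ^ (i + k) = z ^ i * z ^ k := by
  lift i to ℕ using hi
  lift k to ℕ using hk
  rw [← Nat.cast_add, zpow_natCast, zpow_natCast, zpow_natCast, pow_add]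

theorem eval_monomial_mul {a b i j : ℤ} {p : Laurent} (hp : p ∈ box a b) (hi : 0 ≤ i)
    (hj : 0 ≤ j) (z w : ℂ) : eval (monomial i j * p) z w = z ^ i * w ^ j * eval p z w := by
  rw [eval_eq_sum_box hp, Finset.mul_sum]
  conv_lhs => rw [eq_sum_box hp]
  rw [Finset.mul_sum, eval_sum]
  refine Finset.sum_congr rfl fun c hc => ?_
  simp only [Finset.mem_product, Finset.mem_Ico] at hc
  rw [mul_smul_comm, monomial_mul, eval_smul, eval_monomial, zpow_add_of_nonneg z hi hc.1.1,
    zpow_add_of_nonneg w hj hc.2.1]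
  ring

/-- `(p, q) ↦ p (z, w) * conj (q (z, w))`. -/
def evalSesq (z w : ℂ) : Sesq Laurent ℂ :=
  LinearMap.mk₂'ₛₗ (RingHom.id ℂ) (starRingEnd ℂ)
    (fun p q => eval p z w * starRingEnd ℂ (eval q z w))
    (fun p p' q => by rw [eval_add, add_mul])
    (fun c p q => by rw [eval_smul, RingHom.id_apply, smul_eq_mul, mul_assoc])
    (fun p q q' => by rw [eval_add, map_add, mul_add])
    (fun c p q => by rw [eval_smul, map_mul, smul_eq_mul]; ring)

theorem evalSesq_self (z w : ℂ) (p : Laurent) :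
    evalSesq z w p p = ((‖eval p z w‖ ^ 2 : ℝ) : ℂ) := by
  change eval p z w * starRingEnd ℂ (eval p z w) = _
  rw [Complex.mul_conj, Complex.normSq_eq_norm_sq]

theorem shift_evalSesq_self {a b i j : ℤ} {p : Laurent} (hp : p ∈ box a b) (hi : 0 ≤ i)
    (hj : 0 ≤ j) (z w : ℂ) : shift i j (evalSesq z w) p p =
      (((‖z‖ ^ i) ^ 2 * (‖w‖ ^ j) ^ 2 * ‖eval p z w‖ ^ 2 : ℝ) : ℂ) := by
  rw [shift_apply, evalSesq_self, eval_monomial_mul hp hi hj, norm_mul, norm_mul, norm_zpow,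
    norm_zpow, mul_pow, mul_pow]

/-- Expand the constant 1 in the basis, evaluate at (z, w), and apply Cauchy–Schwarz; the squared
coefficients add up to ⟨1, 1⟩. -/
theorem IsONB.one_le_sum {Λ : Laurent →ₗ[ℂ] ℂ} {U : Submodule ℂ Laurent}
    {ι : Type*} [Fintype ι] {e : ι → Laurent} (he : IsONB (form Λ) U e) (h1 : 1 ∈ U) (z w : ℂ) :
    1 ≤ (form Λ 1 1).re * ∑ i, ‖eval (e i) z w‖ ^ 2 := by
  have h := he.form_eq h1
  rw [h, Complex.ofReal_re]
  have h2 : (1 : ℂ) = ∑ i, form Λ 1 (e i) * eval (e i) z w := by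
    rw [← eval_one z w]
    conv_lhs => rw [he.expand 1 h1]
    rw [eval_sum]
    exact Finset.sum_congr rfl fun i _ => eval_smul _ _ _ _
  have h3 : (1 : ℝ) ≤ ∑ i, ‖form Λ 1 (e i)‖ * ‖eval (e i) z w‖ := by
    calc (1 : ℝ) = ‖(1 : ℂ)‖ := by simp
      _ = ‖∑ i, form Λ 1 (e i) * eval (e i) z w‖ := by rw [← h2]
      _ ≤ ∑ i, ‖form Λ 1 (e i) * eval (e i) z w‖ := norm_sum_le _ _
      _ = _ := by simp_rw [norm_mul]
  refine le_trans ?_ (Finset.sum_mul_sq_le_sq_mul_sq _ _ _)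
  nlinarith

/-- Evaluated at a point, the Christoffel–Darboux identity has terms (1-|z|²)(1-|w|²)|e|²,
(1-|z|²)|a|² and (1-|w|²)|c|², all nonnegative in the bidisk. Lowering the weight of one increment
block to the product weight leaves a kernel bounded below by `one_le_sum`. If n = m = 0 there is no
such block, whence `hnm`. -/
theorem exists_lower_bound {Λ : Laurent →ₗ[ℂ] ℂ} (hΛ : IsHerm Λ) {n m : ℤ}
    (hn : 0 ≤ n) (hm : 0 ≤ m) (hnm : 0 < n ∨ 0 < m)
    (hp : PosOn Λ (n + 1) (m + 1)) (hs : SplitOrthogonal Λ n m) {φ : Laurent}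
    (hφ : IsTop Λ n m φ) : ∃ c : ℝ, 0 < c ∧ ∀ z w : ℂ, ‖z‖ ≤ 1 → ‖w‖ ≤ 1 →
      c * ((1 - ‖z‖ ^ 2) * (1 - ‖w‖ ^ 2)) ≤
        ‖eval (rev n m φ) z w‖ ^ 2 - ‖eval φ z w‖ ^ 2 := by
  have hpA := hp.mono (a := n) (b := m + 1) (by omega) le_rfl
  have hpC := hp.mono (a := n + 1) (b := m) le_rfl (by omega)
  have hpE := hp.mono (a := n) (b := m) (by omega) (by omega)
  obtain ⟨e, he⟩ := exists_isONB hΛ.form_symm hpE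
  have fa : FiniteDimensional ℂ (perp (form Λ) (box n (m + 1)) (box n m)) :=
    Submodule.finiteDimensional_of_le fun x hx => hx.1
  have fc : FiniteDimensional ℂ (perp (form Λ) (box (n + 1) m) (box n m)) :=
    Submodule.finiteDimensional_of_le fun x hx => hx.1
  obtain ⟨a, ha⟩ := exists_isONB (U := perp (form Λ) (box n (m + 1)) (box n m)) hΛ.form_symm
    fun x hx => hpA x hx.1
  obtain ⟨c, hc⟩ := exists_isONB (U := perp (form Λ) (box (n + 1) m) (box n m)) hΛ.form_symm
    fun x hx => hpC x hx.1
  have hA := he.sum_elim hΛ.form_symm (box_mono le_rfl (by omega)) ha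
  have hC := he.sum_elim hΛ.form_symm (box_mono (by omega) le_rfl) hc
  have h10 : (1 : Laurent) ∈ box (n + 1) (m + 1) :=
    monomial_mem_box le_rfl (by omega) le_rfl (by omega)
  have hpos : 0 < (form Λ 1 1).re := (Complex.pos_iff.1 (hp 1 h10 one_ne_zero)).1
  refine ⟨(form Λ 1 1).re⁻¹, inv_pos.2 hpos, fun z w hz hw => ?_⟩
  have key := christoffel_darboux hΛ hp hs hφ he ha hc (evalSesq z w)
  simp only [evalSesq_self, shift_evalSesq_self (he.mem _) zero_le_one zero_le_one,
    shift_evalSesq_self (he.mem _) zero_le_one le_rfl,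
    shift_evalSesq_self (he.mem _) le_rfl zero_le_one,
    shift_evalSesq_self (ha.mem _).1 zero_le_one le_rfl,
    shift_evalSesq_self (hc.mem _).1 le_rfl zero_le_one] at key
  simp only [zpow_one, zpow_zero, one_pow, mul_one, one_mul] at key
  norm_cast at key
  have k1 : ∀ i, ‖eval (e i) z w‖ ^ 2 - ‖z‖ ^ 2 * ‖eval (e i) z w‖ ^ 2 -
      ‖w‖ ^ 2 * ‖eval (e i) z w‖ ^ 2 + ‖z‖ ^ 2 * ‖w‖ ^ 2 * ‖eval (e i) z w‖ ^ 2 =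
      ((1 - ‖z‖ ^ 2) * (1 - ‖w‖ ^ 2)) * ‖eval (e i) z w‖ ^ 2 := fun i => by ring
  have k2 : ∀ i, ‖eval (a i) z w‖ ^ 2 - ‖z‖ ^ 2 * ‖eval (a i) z w‖ ^ 2 =
      (1 - ‖z‖ ^ 2) * ‖eval (a i) z w‖ ^ 2 := fun i => by ring
  have k3 : ∀ i, ‖eval (c i) z w‖ ^ 2 - ‖w‖ ^ 2 * ‖eval (c i) z w‖ ^ 2 =
      (1 - ‖w‖ ^ 2) * ‖eval (c i) z w‖ ^ 2 := fun i => by ring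
  simp only [k1, k2, k3, ← Finset.mul_sum] at key
  rw [key]
  have hz' : 0 ≤ 1 - ‖z‖ ^ 2 := by nlinarith [norm_nonneg z]
  have hw' : 0 ≤ 1 - ‖w‖ ^ 2 := by nlinarith [norm_nonneg w]
  have hz1 : 1 - ‖z‖ ^ 2 ≤ 1 := by nlinarith [norm_nonneg z]
  have hw1 : 1 - ‖w‖ ^ 2 ≤ 1 := by nlinarith [norm_nonneg w]
  have sA : 0 ≤ ∑ i, ‖eval (a i) z w‖ ^ 2 := by positivity
  have sC : 0 ≤ ∑ i, ‖eval (c i) z w‖ ^ 2 := by positivity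
  have hzw := mul_nonneg hz' hw'
  rcases hnm with h | h
  · have := hA.one_le_sum (monomial_mem_box le_rfl h le_rfl (by omega)) z w
    rw [Fintype.sum_sum_type, ← inv_le_iff_one_le_mul₀' hpos] at this
    simp only [Sum.elim_inl, Sum.elim_inr] at this
    have h1 := mul_le_mul_of_nonneg_right this hzw
    have h2 : (1 - ‖z‖ ^ 2) * (1 - ‖w‖ ^ 2) * ∑ i, ‖eval (a i) z w‖ ^ 2 ≤
        (1 - ‖z‖ ^ 2) * ∑ i, ‖eval (a i) z w‖ ^ 2 :=
      mul_le_mul_of_nonneg_right (mul_le_of_le_one_right hz' hw1) sA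
    have h3 := mul_nonneg hw' sC
    nlinarith
  · have := hC.one_le_sum (monomial_mem_box le_rfl (by omega) le_rfl h) z w
    rw [Fintype.sum_sum_type, ← inv_le_iff_one_le_mul₀' hpos] at this
    simp only [Sum.elim_inl, Sum.elim_inr] at this
    have h1 := mul_le_mul_of_nonneg_right this hzw
    have h2 : (1 - ‖z‖ ^ 2) * (1 - ‖w‖ ^ 2) * ∑ i, ‖eval (c i) z w‖ ^ 2 ≤
        (1 - ‖w‖ ^ 2) * ∑ i, ‖eval (c i) z w‖ ^ 2 :=
      mul_le_mul_of_nonneg_right (mul_le_of_le_one_left hw' hz1) sC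
    have h3 := mul_nonneg hz' sA
    nlinarith

/-! ### Excluding zeros in the closed bidisk. -/

theorem differentiableAt_eval {a b : ℤ} {p : Laurent} (hp : p ∈ box a b) {u v : ℂ → ℂ} {s : ℂ}
    (hu : DifferentiableAt ℂ u s) (hv : DifferentiableAt ℂ v s) :
    DifferentiableAt ℂ (fun t => eval p (u t) (v t)) s := by
  simp_rw [eval_eq_sum_box hp]
  refine DifferentiableAt.fun_sum fun c hc => ?_
  simp only [Finset.mem_product, Finset.mem_Ico] at hc
  exact (differentiableAt_const _).mul
    ((hu.zpow (Or.inr hc.1.1)).mul (hv.zpow (Or.inr hc.2.1)))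

theorem tendsto_dslope_ofReal {f : ℂ → ℂ} (hf : DifferentiableAt ℂ f 1) {u : ℝ → ℝ}
    (hu : ContinuousAt u 1) (h1 : u 1 = 1) :
    Filter.Tendsto (fun r : ℝ => ‖dslope f 1 (u r : ℂ)‖ ^ 2) (nhdsWithin 1 (Set.Iio 1))
      (nhds (‖dslope f 1 1‖ ^ 2)) := by
  have h2 : ContinuousAt (fun r : ℝ => (u r : ℂ)) 1 := Complex.continuous_ofReal.continuousAt.comp hu
  have h3 : ContinuousAt (dslope f 1) ((fun r : ℝ => (u r : ℂ)) 1) := by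
    simp only [h1, Complex.ofReal_one]
    exact continuousAt_dslope_same.2 hf
  have h4 : ContinuousAt (fun r : ℝ => ‖dslope f 1 (u r : ℂ)‖ ^ 2) 1 :=
    (h3.comp_of_eq h2 rfl).norm.pow 2
  have h5 := h4.tendsto
  simp only [h1, Complex.ofReal_one] at h5
  exact h5.mono_left nhdsWithin_le_nhds

/-- A lower bound that vanishes only linearly at a boundary point excludes a zero there. -/
theorem false_of_linear_lower_bound {f : ℂ → ℂ} (hf : DifferentiableAt ℂ f 1) (h0 : f 1 = 0)
    {c : ℝ} (hc : 0 < c)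
    (h : ∀ r : ℝ, 0 < r → r < 1 → c * (1 - r ^ 2) ≤ ‖f r‖ ^ 2) : False := by
  have h1 := tendsto_dslope_ofReal hf continuousAt_id rfl
  have h2 : Filter.Tendsto (fun r : ℝ => (1 - r) * ‖dslope f 1 (r : ℂ)‖ ^ 2)
      (nhdsWithin 1 (Set.Iio 1)) (nhds ((1 - 1) * ‖dslope f 1 1‖ ^ 2)) := by
    refine Filter.Tendsto.mul ?_ h1
    exact ((continuous_const.sub continuous_id).tendsto 1).mono_left nhdsWithin_le_nhds
  rw [sub_self, zero_mul] at h2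
  have h3 : c ≤ 0 := by
    refine ge_of_tendsto h2 ?_
    filter_upwards [Ioo_mem_nhdsLT (zero_lt_one' ℝ)] with r hr
    have h4 := h r hr.1 hr.2
    have h5 : f r = (r - 1) * dslope f 1 r := by
      have := sub_smul_dslope f 1 (r : ℂ)
      rw [h0, sub_zero, smul_eq_mul] at this
      exact this.symm
    have h6 : ‖(r - 1 : ℂ)‖ = 1 - r := by
      rw [← Complex.ofReal_one, ← Complex.ofReal_sub, Complex.norm_real, Real.norm_eq_abs,
        abs_of_neg (by linarith [hr.2])]
      ring
    rw [h5, norm_mul, h6] at h4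
    have h7 : 0 < 1 - r := by linarith [hr.2]
    have h8 : c * (1 + r) ≤ (1 - r) * ‖dslope f 1 (r : ℂ)‖ ^ 2 := by
      refine le_of_mul_le_mul_left ?_ h7
      nlinarith
    nlinarith [hr.1]
  linarith

/-- At an interior zero the bound is violated outright. With exactly one coordinate on the circle,
the bound decays linearly along the radius while |p|² decays quadratically. On the torus both decay
quadratically, but reversal exchanges the radii r and 1/r, so the leading terms of |p|² and |rev p|²
cancel at r = 1, and the constant `c` would have to be nonpositive. -/
theorem eval_ne_zero_of_lower_bound {n m : ℤ} {p : Laurent} (hp : p ∈ box (n + 1) (m + 1))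
    {c : ℝ} (hc : 0 < c) (h : ∀ z w : ℂ, ‖z‖ ≤ 1 → ‖w‖ ≤ 1 →
      c * ((1 - ‖z‖ ^ 2) * (1 - ‖w‖ ^ 2)) ≤ ‖eval p z w‖ ^ 2 - ‖eval (rev n m p) z w‖ ^ 2)
    {z w : ℂ} (hz : ‖z‖ ≤ 1) (hw : ‖w‖ ≤ 1) : eval p z w ≠ 0 := by
  intro h0
  have hnr : ∀ (r : ℝ) (u : ℂ), 0 < r → ‖u‖ = 1 → ‖(r : ℂ) * u‖ = r := fun r u hr hu => by
    rw [norm_mul, Complex.norm_real, Real.norm_eq_abs, abs_of_pos hr, hu, mul_one]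
  have hd : ∀ u : ℂ, DifferentiableAt ℂ (fun s : ℂ => s * u) 1 := fun u =>
    differentiableAt_id.mul_const u
  rcases hz.lt_or_eq with hz' | hz' <;> rcases hw.lt_or_eq with hw' | hw'
  · have := h z w hz hw
    rw [h0] at this
    have h1 : 0 < 1 - ‖z‖ ^ 2 := by nlinarith [norm_nonneg z]
    have h2 : 0 < 1 - ‖w‖ ^ 2 := by nlinarith [norm_nonneg w]
    have := mul_pos hc (mul_pos h1 h2)
    have := sq_nonneg ‖eval (rev n m p) z w‖
    simp only [norm_zero] at *
    linarith
  · have h1 : 0 < 1 - ‖z‖ ^ 2 := by nlinarith [norm_nonneg z]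
    refine false_of_linear_lower_bound (f := fun s => eval p z (s * w)) (c := c * (1 - ‖z‖ ^ 2))
      (differentiableAt_eval hp (differentiableAt_const z) (hd w)) (by simpa using h0)
      (mul_pos hc h1) fun r hr0 hr1 => ?_
    have := h z (r * w) hz (by rw [hnr r w hr0 hw']; exact hr1.le)
    rw [hnr r w hr0 hw'] at this
    have := sq_nonneg ‖eval (rev n m p) z (r * w)‖
    linarith
  · have h1 : 0 < 1 - ‖w‖ ^ 2 := by nlinarith [norm_nonneg w]
    refine false_of_linear_lower_bound (f := fun s => eval p (s * z) w) (c := c * (1 - ‖w‖ ^ 2))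
      (differentiableAt_eval hp (hd z) (differentiableAt_const w)) (by simpa using h0)
      (mul_pos hc h1) fun r hr0 hr1 => ?_
    have := h (r * z) w (by rw [hnr r z hr0 hz']; exact hr1.le) hw
    rw [hnr r z hr0 hz'] at this
    have := sq_nonneg ‖eval (rev n m p) (r * z) w‖
    linarith
  · set f : ℂ → ℂ := fun s => eval p (s * z) (s * w) with hf
    have hfd : DifferentiableAt ℂ f 1 := differentiableAt_eval hp (hd z) (hd w)
    have hf0 : f 1 = 0 := by simpa [hf] using h0
    have hfs : ∀ s : ℂ, f s = (s - 1) * dslope f 1 s := fun s => by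
      have := sub_smul_dslope f 1 s
      rw [hf0, sub_zero, smul_eq_mul] at this
      exact this.symm
    have t1 := tendsto_dslope_ofReal hfd continuousAt_id rfl
    have t2 := tendsto_dslope_ofReal hfd (continuousAt_inv₀ (one_ne_zero' ℝ)) inv_one
    -- The square of r^(n+m) from the reversal, times the square of the r⁻¹ in 1/r - 1 = (1 - r)/r.
    have t3 : Filter.Tendsto (fun r : ℝ => r ^ (2 * (n + m) - 2)) (nhdsWithin 1 (Set.Iio 1))
        (nhds 1) := by
      have : ContinuousAt (fun r : ℝ => r ^ (2 * (n + m) - 2)) 1 :=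
        continuousAt_zpow₀ _ _ (Or.inl one_ne_zero)
      have := this.tendsto
      simp only [one_zpow] at this
      exact this.mono_left nhdsWithin_le_nhds
    have t4 := t1.sub (t3.mul t2)
    rw [one_mul, sub_self] at t4
    have h3 : c ≤ 0 := by
      refine ge_of_tendsto t4 ?_
      filter_upwards [Ioo_mem_nhdsLT (zero_lt_one' ℝ)] with r hr
      have hr0 := hr.1
      have hrc : (r : ℂ) ≠ 0 := Complex.ofReal_ne_zero.2 hr0.ne'
      have hz0 : z ≠ 0 := fun h => by simp [h] at hz'
      have hw0 : w ≠ 0 := fun h => by simp [h] at hw'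
      have h4 := h (r * z) (r * w) (by rw [hnr r z hr0 hz']; exact hr.2.le)
        (by rw [hnr r w hr0 hw']; exact hr.2.le)
      rw [eval_rev (mul_ne_zero hrc hz0) (mul_ne_zero hrc hw0)] at h4
      have hinv : ∀ u : ℂ, ‖u‖ = 1 → (starRingEnd ℂ (r * u))⁻¹ = ((r⁻¹ : ℝ) : ℂ) * u := by
        intro u hu
        rw [map_mul, Complex.conj_ofReal, mul_inv, Complex.ofReal_inv]
        congr 1
        have := Complex.mul_conj u
        rw [Complex.normSq_eq_norm_sq, hu] at this
        exact inv_eq_of_mul_eq_one_right (by simpa [mul_comm] using this)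
      rw [hinv z hz', hinv w hw', hnr r z hr0 hz', hnr r w hr0 hw', norm_mul, norm_mul, norm_zpow,
        norm_zpow, hnr r z hr0 hz', hnr r w hr0 hw', RCLike.norm_conj] at h4
      change _ ≤ ‖f r‖ ^ 2 - (_ * ‖f (r⁻¹ : ℝ)‖) ^ 2 at h4
      rw [hfs, hfs ((r⁻¹ : ℝ) : ℂ), norm_mul, norm_mul] at h4
      have h6 : ‖(r - 1 : ℂ)‖ = 1 - r := by
        rw [← Complex.ofReal_one, ← Complex.ofReal_sub, Complex.norm_real, Real.norm_eq_abs,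
          abs_of_neg (by linarith [hr.2])]
        ring
      have h7 : ‖(((r⁻¹ : ℝ) : ℂ) - 1 : ℂ)‖ = (1 - r) * r⁻¹ := by
        rw [← Complex.ofReal_one, ← Complex.ofReal_sub, Complex.norm_real, Real.norm_eq_abs,
          abs_of_nonneg (by linarith [(one_lt_inv₀ hr0).2 hr.2]), sub_mul,
          mul_inv_cancel₀ hr0.ne', one_mul]
      rw [h6, h7] at h4
      have h8 : r ^ (2 * (n + m) - 2) = (r ^ n * r ^ m * r⁻¹) ^ 2 := by
        rw [← zpow_add₀ hr0.ne', ← zpow_sub_one₀ hr0.ne', ← zpow_natCast, ← zpow_mul]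
        congr 1
        push_cast
        ring
      simp only [id]
      rw [h8]
      have h9 : 0 < (1 - r) ^ 2 := by
        have : 0 < 1 - r := by linarith [hr.2]
        positivity
      refine le_of_mul_le_mul_left ?_ h9
      have h10 : (1 - r) ^ 2 * c ≤ c * ((1 - r ^ 2) * (1 - r ^ 2)) := by
        have : 0 ≤ c * (1 - r) ^ 2 * ((1 + r) ^ 2 - 1) := by
          apply mul_nonneg
          · positivity
          · nlinarith
        nlinarith
      calc _ ≤ _ := h10
        _ ≤ _ := h4
        _ = _ := by ring
    linarith

theorem eval_rev_top_ne_zero {Λ : Laurent →ₗ[ℂ] ℂ} (hΛ : IsHerm Λ) {n m : ℤ}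
    (hn : 0 ≤ n) (hm : 0 ≤ m)
    (hp : PosOn Λ (n + 1) (m + 1)) (hs : SplitOrthogonal Λ n m) {φ : Laurent}
    (hφ : IsTop Λ n m φ) {z w : ℂ} (hz : ‖z‖ ≤ 1) (hw : ‖w‖ ≤ 1) :
    eval (rev n m φ) z w ≠ 0 := by
  by_cases hnm : 0 < n ∨ 0 < m
  · obtain ⟨c, hc, h⟩ := exists_lower_bound hΛ hn hm hnm hp hs hφ
    refine eval_ne_zero_of_lower_bound (rev_mem_box hφ.mem) hc (fun z w hz hw => ?_) hz hw
    rw [rev_rev]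
    exact h z w hz hw
  -- In degree (0, 0) the reversal is a nonzero constant.
  · obtain ⟨rfl, rfl⟩ : n = 0 ∧ m = 0 := by omega
    have h1 := hφ.coeff_ne_zero
    rw [eval_eq_sum_box (rev_mem_box hφ.mem), show Finset.Ico (0 : ℤ) (0 + 1) = {0} from rfl]
    simpa [coeff_rev] using h1

/-! ### Interchanging the variables -/

/-- Interchange of `z` and `w`. -/
def swap : Laurent ≃ₐ[ℂ] Laurent := AddMonoidAlgebra.domCongr ℂ ℂ (AddEquiv.prodComm (M := ℤ) (N := ℤ))

theorem coeff_swap (p : Laurent) (i j : ℤ) : (swap p).coeff (i, j) = p.coeff (j, i) := by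
  simp [swap]

theorem swap_swap (p : Laurent) : swap (swap p) = p := by
  ext ⟨i, j⟩; rw [coeff_swap, coeff_swap]

theorem swap_monomial (i j : ℤ) : swap (monomial i j) = monomial j i := by
  ext ⟨k, l⟩
  rw [coeff_swap, coeff_monomial, coeff_monomial]
  simp only [Prod.mk.injEq, and_comm]

theorem swap_dagger (p : Laurent) : swap (dagger p) = dagger (swap p) := by
  ext ⟨k, l⟩
  rw [coeff_swap, dagger_coeff, dagger_coeff, Prod.neg_mk, Prod.neg_mk, coeff_swap]

theorem swap_rev (n m : ℤ) (p : Laurent) : swap (rev n m p) = rev m n (swap p) := by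
  rw [rev, rev, map_mul, swap_monomial, swap_dagger]

theorem swap_mem_box {a b : ℤ} {p : Laurent} : swap p ∈ box b a ↔ p ∈ box a b := by
  simp only [mem_box, coeff_swap]
  constructor <;> intro h i j hij <;> have := h j i hij <;> omega

theorem eval_swap (p : Laurent) (z w : ℂ) : eval (swap p) z w = eval p w z := by
  induction p using Laurent.induction with
  | add p q hp hq => rw [map_add, eval_add, hp, hq, eval_add]
  | mon c i j =>
    rw [map_smul, swap_monomial, eval_smul, eval_smul, eval_monomial, eval_monomial, mul_comm (z ^ j)]

/-! ### Averages over the circle -/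

/-- The point `exp (i t)` of the unit circle. -/
def unitExp (t : ℝ) : ℂ := Complex.exp (Complex.I * t)

theorem norm_unitExp (t : ℝ) : ‖unitExp t‖ = 1 := by
  rw [unitExp, mul_comm, Complex.norm_exp_ofReal_mul_I]

theorem unitExp_ne_zero (t : ℝ) : unitExp t ≠ 0 := Complex.exp_ne_zero _

theorem continuous_unitExp : Continuous unitExp := by
  unfold unitExp; fun_prop

theorem conj_inv_of_norm_eq_one {z : ℂ} (hz : ‖z‖ = 1) : (starRingEnd ℂ z)⁻¹ = z := by
  have := Complex.mul_conj z
  rw [Complex.normSq_eq_norm_sq, hz] at this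
  exact inv_eq_of_mul_eq_one_right (by simpa [mul_comm] using this)

theorem ne_zero_of_norm_eq_one {z : ℂ} (hz : ‖z‖ = 1) : z ≠ 0 := fun h => by simp [h] at hz

theorem eval_dagger_of_norm_eq_one (p : Laurent) {z w : ℂ} (hz : ‖z‖ = 1) (hw : ‖w‖ = 1) :
    eval (dagger p) z w = starRingEnd ℂ (eval p z w) := by
  rw [eval_dagger, conj_inv_of_norm_eq_one hz, conj_inv_of_norm_eq_one hw]

theorem norm_eval_rev (n m : ℤ) (p : Laurent) {z w : ℂ} (hz : ‖z‖ = 1) (hw : ‖w‖ = 1) :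
    ‖eval (rev n m p) z w‖ = ‖eval p z w‖ := by
  rw [eval_rev (ne_zero_of_norm_eq_one hz) (ne_zero_of_norm_eq_one hw),
    conj_inv_of_norm_eq_one hz, conj_inv_of_norm_eq_one hw]
  simp [hz, hw]

/-- The mean of a function over `[0, 2π]`. -/
def avg (f : ℝ → ℂ) : ℂ := (2 * (Real.pi : ℂ))⁻¹ * ∫ t in Set.Icc 0 (2 * Real.pi), f t

theorem avg_eq_intervalIntegral (f : ℝ → ℂ) :
    avg f = (2 * (Real.pi : ℂ))⁻¹ * ∫ t in (0 : ℝ)..2 * Real.pi, f t := by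
  rw [avg, intervalIntegral.integral_of_le Real.two_pi_pos.le,
    MeasureTheory.integral_Icc_eq_integral_Ioc]

theorem avg_const (c : ℂ) : avg (fun _ => c) = c := by
  rw [avg_eq_intervalIntegral, intervalIntegral.integral_const]
  have : (Real.pi : ℂ) ≠ 0 := Complex.ofReal_ne_zero.2 Real.pi_ne_zero
  simp only [sub_zero, Complex.real_smul]
  push_cast
  field_simp

theorem avg_mul_const (f : ℝ → ℂ) (c : ℂ) : avg (fun t => c * f t) = c * avg f := by
  rw [avg, avg, MeasureTheory.integral_const_mul]; ring

theorem avg_conj (f : ℝ → ℂ) : avg (fun t => starRingEnd ℂ (f t)) = starRingEnd ℂ (avg f) := by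
  rw [avg, avg, integral_conj, map_mul, map_inv₀, map_mul, Complex.conj_ofReal, map_ofNat]

theorem avg_add {f g : ℝ → ℂ} (hf : Continuous f) (hg : Continuous g) :
    avg (fun t => f t + g t) = avg f + avg g := by
  rw [avg, avg, avg, MeasureTheory.integral_add, mul_add]
  · exact hf.continuousOn.integrableOn_compact isCompact_Icc
  · exact hg.continuousOn.integrableOn_compact isCompact_Icc

/-- Cauchy's theorem for z^(k-1) g(z); the remaining power of z comes from dz = iz dt. -/
theorem avg_unitExp_mul_of_differentiable {g : ℂ → ℂ} (hg : DifferentiableOn ℂ g (Metric.closedBall 0 1))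
    {k : ℤ} (hk : 1 ≤ k) : avg (fun t => unitExp t ^ k * g (unitExp t)) = 0 := by
  obtain ⟨k, rfl⟩ : ∃ l : ℕ, k = l + 1 := ⟨(k - 1).toNat, by omega⟩
  have h1 : (∮ z in C(0, 1), z ^ k * g z) = 0 := by
    apply DiffContOnCl.circleIntegral_eq_zero zero_le_one
    apply DifferentiableOn.diffContOnCl
    rw [closure_ball _ one_ne_zero]
    exact (differentiableOn_id.pow k).mul hg
  rw [circleIntegral] at h1
  have h2 : ∀ θ : ℝ, deriv (circleMap 0 1) θ • (circleMap 0 1 θ ^ k * g (circleMap 0 1 θ)) =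
      Complex.I * (unitExp θ ^ ((k : ℤ) + 1) * g (unitExp θ)) := by
    intro θ
    have h3 : circleMap 0 1 θ = unitExp θ := by
      simp [circleMap, unitExp, mul_comm]
    rw [deriv_circleMap, h3, smul_eq_mul]
    have h4 : unitExp θ ^ ((k : ℤ) + 1) = unitExp θ ^ k * unitExp θ := by
      rw [← zpow_natCast, zpow_add_one₀ (unitExp_ne_zero θ)]
    rw [h4]
    ring
  simp_rw [h2] at h1
  rw [intervalIntegral.integral_const_mul] at h1
  rw [avg_eq_intervalIntegral, (mul_eq_zero.1 h1).resolve_left Complex.I_ne_zero, mul_zero]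

theorem avg_unitExp_zpow (k : ℤ) : avg (fun t => unitExp t ^ k) = if k = 0 then 1 else 0 := by
  have h1 : ∀ k : ℤ, 1 ≤ k → avg (fun t => unitExp t ^ k) = 0 := fun k hk => by
    simpa using avg_unitExp_mul_of_differentiable (g := fun _ => 1)
      (differentiableOn_const 1) hk
  split_ifs with h
  · subst h; simpa using avg_const 1
  · rcases lt_or_gt_of_ne h with h | h
    · have h2 := h1 (-k) (by omega)
      have h3 : ∀ t, unitExp t ^ k = starRingEnd ℂ (unitExp t ^ (-k)) := fun t => by
        rw [map_zpow₀, zpow_neg, ← inv_zpow, conj_inv_of_norm_eq_one (norm_unitExp t)]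
      simp_rw [h3]
      rw [avg_conj, h2, map_zero]
    · exact h1 k h

/-! ### Bernstein–Szegő functionals -/

/-- `q` has no zero on the torus `|z| = |w| = 1`. -/
def NonvanishingOnTorus (q : Laurent) : Prop := ∀ z w : ℂ, ‖z‖ = 1 → ‖w‖ = 1 → eval q z w ≠ 0

/-- `q` has no zero in the closed bidisk. -/
def NonvanishingOnBidisk (q : Laurent) : Prop := ∀ z w : ℂ, ‖z‖ ≤ 1 → ‖w‖ ≤ 1 → eval q z w ≠ 0

theorem NonvanishingOnBidisk.of_rev {n m : ℤ} {q : Laurent}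
    (h : NonvanishingOnBidisk (rev n m q)) : NonvanishingOnTorus q := by
  intro z w hz hw
  rw [← norm_ne_zero_iff, ← norm_eval_rev n m q hz hw, norm_ne_zero_iff]
  exact h z w hz.le hw.le

theorem continuous_eval {X : Type*} [TopologicalSpace X] (p : Laurent) {u v : X → ℂ}
    (hu : Continuous u) (hv : Continuous v) (hu0 : ∀ x, u x ≠ 0) (hv0 : ∀ x, v x ≠ 0) :
    Continuous fun x => eval p (u x) (v x) := by
  induction p using Laurent.induction with
  | add p q hp hq => simp_rw [eval_add]; exact hp.add hq
  | mon c i j =>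
    simp_rw [eval_smul, eval_monomial]
    exact continuous_const.mul
      ((hu.zpow₀ i fun x => Or.inl (hu0 x)).mul (hv.zpow₀ j fun x => Or.inl (hv0 x)))

/-- The density `p / |q| ^ 2`. -/
def density (q p : Laurent) (z w : ℂ) : ℂ := eval p z w / ((‖eval q z w‖ ^ 2 : ℝ) : ℂ)

theorem continuous_density {X : Type*} [TopologicalSpace X] {q : Laurent}
    (hq : NonvanishingOnTorus q) (p : Laurent) {u v : X → ℂ}
    (hu : Continuous u) (hv : Continuous v) (hu1 : ∀ x, ‖u x‖ = 1) (hv1 : ∀ x, ‖v x‖ = 1) :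
    Continuous fun x => density q p (u x) (v x) := by
  have h0 := fun p => continuous_eval p hu hv (fun x => ne_zero_of_norm_eq_one (hu1 x))
    (fun x => ne_zero_of_norm_eq_one (hv1 x))
  refine (h0 p).div (Complex.continuous_ofReal.comp ((h0 q).norm.pow 2)) fun x => ?_
  have := norm_ne_zero_iff.2 (hq (u x) (v x) (hu1 x) (hv1 x))
  exact Complex.ofReal_ne_zero.2 (pow_ne_zero 2 this)

/-- The mean over `|z| = 1` of `p / |q| ^ 2`, for fixed `w` with `|w| = 1`. -/
def slice {q : Laurent} (hq : NonvanishingOnTorus q) {w : ℂ} (hw : ‖w‖ = 1) : Laurent →ₗ[ℂ] ℂ where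
  toFun p := avg fun t => density q p (unitExp t) w
  map_add' p p' := by
    simp only [density, eval_add, add_div]
    exact avg_add
      (continuous_density hq p continuous_unitExp continuous_const norm_unitExp fun _ => hw)
      (continuous_density hq p' continuous_unitExp continuous_const norm_unitExp fun _ => hw)
  map_smul' c p := by
    simp only [density, eval_smul, mul_div_assoc]
    exact avg_mul_const _ _

/-! ### One-variable orthogonality on the circles w = const. -/

section slice

variable {q : Laurent} (hq : NonvanishingOnTorus q) {w : ℂ} (hw : ‖w‖ = 1)

theorem slice_apply (p : Laurent) : slice hq hw p = avg fun t => density q p (unitExp t) w := rfl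

theorem slice_mul_of_const {c : Laurent} {s : ℂ} (hc : ∀ z, ‖z‖ = 1 → eval c z w = s) (p : Laurent) :
    slice hq hw (c * p) = s * slice hq hw p := by
  rw [slice_apply, slice_apply, ← avg_mul_const]
  congr 1
  funext t
  rw [density, density, eval_mul (unitExp_ne_zero t) (ne_zero_of_norm_eq_one hw),
    hc _ (norm_unitExp t), mul_div_assoc]

theorem slice_dagger (p : Laurent) : slice hq hw (dagger p) = starRingEnd ℂ (slice hq hw p) := by
  rw [slice_apply, slice_apply, ← avg_conj]
  congr 1
  funext t
  rw [density, density, eval_dagger_of_norm_eq_one p (norm_unitExp t) hw, map_div₀,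
    Complex.conj_ofReal]

theorem density_self_mul {z w : ℂ} (hq : NonvanishingOnTorus q) (hz : ‖z‖ = 1) (hw : ‖w‖ = 1)
    (p : Laurent) : density q (q * dagger q * p) z w = eval p z w := by
  have hz0 := ne_zero_of_norm_eq_one hz
  have hw0 := ne_zero_of_norm_eq_one hw
  rw [density, eval_mul hz0 hw0, eval_mul hz0 hw0, eval_dagger_of_norm_eq_one q hz hw,
    Complex.mul_conj, Complex.normSq_eq_norm_sq, mul_div_cancel_left₀]
  exact Complex.ofReal_ne_zero.2 (pow_ne_zero 2 (norm_ne_zero_iff.2 (hq z w hz hw)))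

theorem slice_self_mul_monomial (k l : ℤ) :
    slice hq hw (q * dagger q * monomial k l) = if k = 0 then w ^ l else 0 := by
  rw [slice_apply]
  simp_rw [density_self_mul hq (norm_unitExp _) hw, eval_monomial]
  simp_rw [mul_comm _ (w ^ l)]
  rw [avg_mul_const, avg_unitExp_zpow]
  simp

/-- On the torus |q| = |rev q|, so the conjugate of rev q divided by |q|² is 1/rev q, which is
analytic in |z| ≤ 1 because rev q has no zeros there. -/
theorem slice_monomial_mul_dagger_rev {n m : ℤ} (hqb : q ∈ box (n + 1) (m + 1))
    (hr : NonvanishingOnBidisk (rev n m q)) {k : ℤ} (hk : 1 ≤ k) (l : ℤ) :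
    slice hq hw (monomial k l * dagger (rev n m q)) = 0 := by
  have hd : DifferentiableOn ℂ (fun z => (eval (rev n m q) z w)⁻¹) (Metric.closedBall 0 1) := by
    intro z hz
    rw [mem_closedBall_zero_iff] at hz
    exact ((differentiableAt_eval (rev_mem_box hqb) differentiableAt_id
      (differentiableAt_const w)).inv (hr z w hz hw.le)).differentiableWithinAt
  have h1 := avg_unitExp_mul_of_differentiable hd hk
  have h2 : ∀ t, density q (monomial k l * dagger (rev n m q)) (unitExp t) w =
      w ^ l * (unitExp t ^ k * (eval (rev n m q) (unitExp t) w)⁻¹) := by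
    intro t
    have hz := norm_unitExp t
    rw [density, eval_mul (unitExp_ne_zero t) (ne_zero_of_norm_eq_one hw), eval_monomial,
      eval_dagger_of_norm_eq_one _ hz hw, ← norm_eval_rev n m q hz hw,
      ← Complex.normSq_eq_norm_sq, Complex.inv_def, Complex.ofReal_inv]
    ring
  rw [slice_apply]
  simp_rw [h2]
  rw [avg_mul_const, h1, mul_zero]

/-- The conjugate of `slice_monomial_mul_dagger_rev`, since q† is rev q up to a monomial. -/
theorem slice_monomial_mul_dagger {n m : ℤ} (hqb : q ∈ box (n + 1) (m + 1))
    (hr : NonvanishingOnBidisk (rev n m q)) {k : ℤ} (hk : k < n) (l : ℤ) :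
    slice hq hw (monomial k l * dagger q) = 0 := by
  have h := slice_monomial_mul_dagger_rev hq hw hqb hr (show 1 ≤ n - k by omega) (m - l)
  have h2 : monomial k l * dagger q = dagger (monomial (n - k) (m - l) * dagger (rev n m q)) := by
    rw [dagger_mul, dagger_dagger, dagger_monomial, rev, ← mul_assoc, monomial_mul]
    congr 2 <;> ring
  rw [h2, slice_dagger, h, map_zero]

end slice

/-- The square `[0, 2π] × [0, 2π]`. -/
abbrev square : Set (ℝ × ℝ) := Set.Icc (0 : ℝ) (2 * Real.pi) ×ˢ Set.Icc (0 : ℝ) (2 * Real.pi)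

theorem integrableOn_square {E : Type*} [NormedAddCommGroup E] {f : ℝ × ℝ → E}
    (hf : Continuous f) : MeasureTheory.IntegrableOn f square :=
  hf.continuousOn.integrableOn_compact (isCompact_Icc.prod isCompact_Icc)

theorem continuous_density_unitExp {q : Laurent} (hq : NonvanishingOnTorus q) (p : Laurent) :
    Continuous fun t : ℝ × ℝ => density q p (unitExp t.1) (unitExp t.2) :=
  continuous_density hq p (continuous_unitExp.comp continuous_fst)
    (continuous_unitExp.comp continuous_snd) (fun _ => norm_unitExp _) fun _ => norm_unitExp _

/-- The moment functional of the density `1 / |q| ^ 2` on the torus. -/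
def szego {q : Laurent} (hq : NonvanishingOnTorus q) : Laurent →ₗ[ℂ] ℂ where
  toFun p := (1 / (2 * (Real.pi : ℂ)) ^ 2) *
    ∫ t in square, density q p (unitExp t.1) (unitExp t.2)
  map_add' p p' := by
    rw [← mul_add, ← MeasureTheory.integral_add
      (integrableOn_square (continuous_density_unitExp hq p))
      (integrableOn_square (continuous_density_unitExp hq p'))]
    simp only [density, eval_add, add_div]
  map_smul' c p := by
    simp only [density, eval_smul, mul_div_assoc, MeasureTheory.integral_const_mul,
      RingHom.id_apply, smul_eq_mul]
    ring

/-! ### Symmetry, orthogonality and positivity on the torus. -/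

section szego

variable {q : Laurent} (hq : NonvanishingOnTorus q)

theorem szego_apply (p : Laurent) : szego hq p = (1 / (2 * (Real.pi : ℂ)) ^ 2) *
    ∫ t in square, density q p (unitExp t.1) (unitExp t.2) := rfl

theorem NonvanishingOnTorus.swap (hq : NonvanishingOnTorus q) : NonvanishingOnTorus (swap q) :=
  fun z w hz hw => by rw [eval_swap]; exact hq w z hw hz

theorem szego_swap (p : Laurent) : szego hq.swap (swap p) = szego hq p := by
  rw [szego_apply, szego_apply]
  congr 1
  rw [MeasureTheory.Measure.volume_eq_prod, ← MeasureTheory.setIntegral_prod_swap]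
  simp only [density, eval_swap, Prod.fst_swap, Prod.snd_swap]

theorem szego_eq_avg_slice (p : Laurent) :
    szego hq p = avg fun s => slice hq (norm_unitExp s) p := by
  -- Fubini's theorem makes the second coordinate the inner one; interchanging the variables first
  -- puts z there.
  rw [← szego_swap, szego_apply, MeasureTheory.Measure.volume_eq_prod,
    MeasureTheory.setIntegral_prod _ (integrableOn_square (continuous_density_unitExp hq.swap _))]
  simp only [avg, slice_apply, density, eval_swap]
  rw [MeasureTheory.integral_const_mul]
  ring

theorem szego_isHerm : IsHerm (szego hq) := by
  intro p
  rw [szego_eq_avg_slice, szego_eq_avg_slice, ← avg_conj]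
  simp only [slice_dagger]

/-- The factor |q|² cancels the weight and leaves the plain mean over the torus. Pairing with a
monomial times q q† therefore reads off coefficients. -/
theorem szego_self_mul (p : Laurent) : szego hq (q * dagger q * p) = p.coeff (0, 0) := by
  induction p using Laurent.induction with
  | add p p' h h' => rw [mul_add, map_add, h, h']; rfl
  | mon c i j =>
    rw [mul_smul_comm, map_smul, szego_eq_avg_slice]
    simp only [slice_self_mul_monomial, AddMonoidAlgebra.coeff_smul, Finsupp.smul_apply,
      coeff_monomial, Prod.mk.injEq]
    congr 1
    by_cases hi : i = 0
    · simp only [hi, if_true, true_and, avg_unitExp_zpow]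
    · simp only [hi, if_false, false_and, avg_const]

theorem szego_monomial_mul_dagger_rev {n m : ℤ} (hqb : q ∈ box (n + 1) (m + 1))
    (hr : NonvanishingOnBidisk (rev n m q)) {k l : ℤ} (hk : 1 ≤ k ∨ 1 ≤ l) :
    szego hq (monomial k l * dagger (rev n m q)) = 0 := by
  rcases hk with hk | hl
  · rw [szego_eq_avg_slice]
    simp only [slice_monomial_mul_dagger_rev hq _ hqb hr hk, avg_const]
  · rw [← szego_swap, map_mul, swap_monomial, swap_dagger, swap_rev, szego_eq_avg_slice]
    have hr' : NonvanishingOnBidisk (rev m n (swap q)) := fun z w hz hw => by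
      rw [← swap_rev, eval_swap]; exact hr w z hw hz
    simp only [slice_monomial_mul_dagger_rev hq.swap _ (swap_mem_box.2 hqb) hr' hl, avg_const]

theorem form_szego_self (p : Laurent) : form (szego hq) p p =
    ((1 / (2 * Real.pi) ^ 2 * ∫ t in square,
      (‖eval p (unitExp t.1) (unitExp t.2)‖ / ‖eval q (unitExp t.1) (unitExp t.2)‖) ^ 2 : ℝ) : ℂ) := by
  rw [form_apply, szego_apply, Complex.ofReal_mul, ← integral_complex_ofReal]
  push_cast
  congr 2
  funext t
  rw [density, eval_mul (unitExp_ne_zero _) (unitExp_ne_zero _),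
    eval_dagger_of_norm_eq_one p (norm_unitExp _) (norm_unitExp _), Complex.mul_conj,
    Complex.normSq_eq_norm_sq, div_pow]
  push_cast
  rfl

theorem form_szego_nonneg (p : Laurent) : 0 ≤ form (szego hq) p p := by
  rw [form_szego_self, Complex.zero_le_real]
  refine mul_nonneg (by positivity) (MeasureTheory.integral_nonneg fun t => by positivity)

theorem form_szego_mul_le {r : Laurent} : ∃ C : ℝ, 0 < C ∧ ∀ p,
    (form (szego hq) (r * p) (r * p)).re ≤ C * (form (szego hq) p p).re := by
  have hc : ∀ p, Continuous fun t : ℝ × ℝ => ‖eval p (unitExp t.1) (unitExp t.2)‖ := fun p =>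
    (continuous_eval p (continuous_unitExp.comp continuous_fst)
      (continuous_unitExp.comp continuous_snd) (fun _ => unitExp_ne_zero _)
      fun _ => unitExp_ne_zero _).norm
  obtain ⟨C, hC⟩ := (isCompact_Icc.prod isCompact_Icc : IsCompact square).bddAbove_image
    (hc r).continuousOn
  have hCn : 0 ≤ C := by
    have : (0, 0) ∈ square := by
      simp [Real.pi_pos.le]
    exact (norm_nonneg _).trans (hC ⟨_, this, rfl⟩)
  -- `C` bounds the multiplier on the torus; the added 1 only makes the constant positive.
  refine ⟨C ^ 2 + 1, by positivity, fun p => ?_⟩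
  have hci : ∀ p, MeasureTheory.IntegrableOn (fun t : ℝ × ℝ =>
      (‖eval p (unitExp t.1) (unitExp t.2)‖ / ‖eval q (unitExp t.1) (unitExp t.2)‖) ^ 2) square :=
    fun p => integrableOn_square (((hc p).div (hc q) fun t =>
      norm_ne_zero_iff.2 (hq _ _ (norm_unitExp _) (norm_unitExp _))).pow 2)
  rw [form_szego_self, form_szego_self, Complex.ofReal_re, Complex.ofReal_re, mul_left_comm]
  refine mul_le_mul_of_nonneg_left ?_ (by positivity)
  rw [← MeasureTheory.integral_const_mul]
  refine MeasureTheory.setIntegral_mono_on (hci _) ((hci _).const_mul _)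
    (measurableSet_Icc.prod measurableSet_Icc) fun t ht => ?_
  rw [eval_mul (unitExp_ne_zero _) (unitExp_ne_zero _), norm_mul, mul_div_assoc, mul_pow]
  refine mul_le_mul_of_nonneg_right ?_ (by positivity)
  have := hC ⟨t, ht, rfl⟩
  nlinarith [norm_nonneg (eval r (unitExp t.1) (unitExp t.2))]

theorem form_szego_le_mul : ∃ C : ℝ, 0 < C ∧ ∀ p,
    (form (szego hq) p p).re ≤ C * (form (szego hq) (q * p) (q * p)).re := by
  have hc : ∀ p, Continuous fun t : ℝ × ℝ => ‖eval p (unitExp t.1) (unitExp t.2)‖ := fun p =>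
    (continuous_eval p (continuous_unitExp.comp continuous_fst)
      (continuous_unitExp.comp continuous_snd) (fun _ => unitExp_ne_zero _)
      fun _ => unitExp_ne_zero _).norm
  have hq0 : ∀ t : ℝ × ℝ, ‖eval q (unitExp t.1) (unitExp t.2)‖ ≠ 0 := fun t =>
      norm_ne_zero_iff.2 (hq _ _ (norm_unitExp _) (norm_unitExp _))
  obtain ⟨C, hC⟩ := (isCompact_Icc.prod isCompact_Icc : IsCompact square).bddAbove_image
    ((hc q).inv₀ hq0).continuousOn
  refine ⟨C ^ 2 + 1, by positivity, fun p => ?_⟩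
  have hci : ∀ p, MeasureTheory.IntegrableOn (fun t : ℝ × ℝ =>
      (‖eval p (unitExp t.1) (unitExp t.2)‖ / ‖eval q (unitExp t.1) (unitExp t.2)‖) ^ 2) square :=
    fun p => integrableOn_square (((hc p).div (hc q) hq0).pow 2)
  rw [form_szego_self, form_szego_self, Complex.ofReal_re, Complex.ofReal_re, mul_left_comm]
  refine mul_le_mul_of_nonneg_left ?_ (by positivity)
  rw [← MeasureTheory.integral_const_mul]
  refine MeasureTheory.setIntegral_mono_on (hci _) ((hci _).const_mul _)
    (measurableSet_Icc.prod measurableSet_Icc) fun t ht => ?_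
  have h1 : ‖eval q (unitExp t.1) (unitExp t.2)‖⁻¹ ≤ C := hC ⟨t, ht, rfl⟩
  have h2 := hq0 t
  rw [eval_mul (unitExp_ne_zero _) (unitExp_ne_zero _), norm_mul, mul_div_cancel_left₀ _ h2,
    div_eq_inv_mul, mul_pow]
  refine mul_le_mul_of_nonneg_right ?_ (by positivity)
  have : 0 ≤ ‖eval q (unitExp t.1) (unitExp t.2)‖⁻¹ := by positivity
  nlinarith

theorem form_szego_mul_mul (p r : Laurent) :
    form (szego hq) (q * p) (q * r) = (p * dagger r).coeff (0, 0) := by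
  rw [form_apply, dagger_mul, ← szego_self_mul hq]
  congr 1
  ring

theorem coeff_mul_dagger_self {p : Laurent} (hp : p ≠ 0) : 0 < ((p * dagger p).coeff (0, 0)).re := by
  have h : (p * dagger p).coeff (0, 0) =
      ∑ a ∈ p.coeff.support, p.coeff a * starRingEnd ℂ (p.coeff a) := by
    conv_lhs => rw [eq_sum_monomial p subset_rfl, Finset.sum_mul]
    rw [← eq_sum_monomial p subset_rfl]
    simp only [AddMonoidAlgebra.coeff_sum, Finsupp.finsetSum_apply]
    refine Finset.sum_congr rfl fun a _ => ?_
    rw [smul_mul_assoc, AddMonoidAlgebra.coeff_smul, Finsupp.smul_apply, coeff_monomial_mul,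
      dagger_coeff, smul_eq_mul]
    simp
  rw [h, Complex.re_sum]
  have hne : p.coeff.support.Nonempty := by
    rw [Finsupp.support_nonempty_iff]
    simpa using hp
  refine Finset.sum_pos (fun a ha => ?_) hne
  rw [Complex.mul_conj, Complex.ofReal_re]
  exact Complex.normSq_pos.2 (Finsupp.mem_support_iff.1 ha)

/-- If p had norm zero, so would q p, because q is bounded on the torus; but the weighted norm of q
p is the sum of the squared moduli of the coefficients of p. -/
theorem form_szego_pos {p : Laurent} (hp : p ≠ 0) : 0 < form (szego hq) p p := by
  refine (form_szego_nonneg hq p).lt_of_ne' fun h => ?_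
  obtain ⟨C, _, hC⟩ := form_szego_mul_le hq (r := q)
  have h1 := hC p
  rw [h, form_szego_mul_mul] at h1
  have := coeff_mul_dagger_self hp
  simp at h1
  linarith

end szego

/-! ### The Hilbert space of a positive functional -/

/-- The completion is needed because `szego_splitOrthogonal` projects onto an infinite-dimensional
space of polynomials. -/
theorem exists_hilbert {V : Type} [AddCommGroup V] [Module ℂ V] (B : Sesq V ℂ)
    (hB : ∀ x y, B y x = starRingEnd ℂ (B x y)) (hp : ∀ x, x ≠ 0 → 0 < B x x) :
    ∃ (H : Type) (_ : NormedAddCommGroup H) (_ : InnerProductSpace ℂ H) (_ : CompleteSpace H)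
      (ι : V →ₗ[ℂ] H), ∀ x y, inner ℂ (ι y) (ι x) = B x y := by
  let core : InnerProductSpace.Core ℂ V :=
    { inner := fun x y => B y x
      conj_inner_symm := fun x y => (hB _ _).symm
      re_inner_nonneg := fun x => by
        rcases eq_or_ne x 0 with rfl | h
        · simp
        · exact (Complex.le_def.1 (hp x h).le).1
      add_left := fun x y z => by simp
      smul_left := fun x y r => by simp
      definite := fun x hx => by
        by_contra h
        exact (hp x h).ne' hx }
  let _ : NormedAddCommGroup V := core.toNormedAddCommGroup
  let _ : InnerProductSpace ℂ V := InnerProductSpace.ofCore core.toCore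
  refine ⟨UniformSpace.Completion V, inferInstance, inferInstance, inferInstance,
    (UniformSpace.Completion.toComplₗᵢ (𝕜 := ℂ) (E := V)).toLinearMap, fun x y => ?_⟩
  exact UniformSpace.Completion.inner_coe y x

/-! ### Supports -/

theorem monomial_mem_supported {s : Set (ℤ × ℤ)} {i j : ℤ} (h : (i, j) ∈ s) :
    monomial i j ∈ AddMonoidAlgebra.supported ℂ ℂ s := by
  rw [AddMonoidAlgebra.mem_supported']
  intro a ha
  rw [coeff_monomial, if_neg]
  rintro rfl
  exact ha h

theorem monomial_mul_mem_supported {s t : Set (ℤ × ℤ)} {i j : ℤ} {p : Laurent}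
    (hp : p ∈ AddMonoidAlgebra.supported ℂ ℂ s) (h : ∀ k l, (k, l) ∈ s → (i + k, j + l) ∈ t) :
    monomial i j * p ∈ AddMonoidAlgebra.supported ℂ ℂ t := by
  rw [AddMonoidAlgebra.mem_supported'] at hp ⊢
  rintro ⟨k, l⟩ ha
  rw [coeff_monomial_mul]
  refine hp _ fun h' => ha ?_
  have := h _ _ h'
  rwa [add_sub_cancel, add_sub_cancel] at this

theorem row_eq_sum {a b : ℤ} {p : Laurent} (hp : p ∈ box a b) (k : ℤ) :
    row k p = ∑ l ∈ Finset.Ico 0 b, p.coeff (k, l) • monomial 0 l := by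
  ext ⟨i, j⟩
  simp only [coeff_row, AddMonoidAlgebra.coeff_sum, AddMonoidAlgebra.coeff_smul,
    Finsupp.finsetSum_apply, Finsupp.smul_apply, coeff_monomial, Prod.mk.injEq, smul_eq_mul,
    mul_ite, mul_one, mul_zero]
  by_cases hi : i = 0
  · simp only [hi, true_and, if_true, Finset.sum_ite_eq', Finset.mem_Ico]
    split_ifs with hj
    · rfl
    · by_contra h
      have := mem_box.1 hp _ _ h
      omega
  · simp [hi, Ne.symm hi]

theorem dagger_row_eq_sum {a b : ℤ} {p : Laurent} (hp : p ∈ box a b) (k : ℤ) :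
    dagger (row k p) = ∑ l ∈ Finset.Ico 0 b, starRingEnd ℂ (p.coeff (k, l)) • monomial 0 (-l) := by
  rw [row_eq_sum hp, dagger_sum]
  refine Finset.sum_congr rfl fun l _ => ?_
  rw [dagger_smul, dagger_monomial, neg_zero]

theorem mul_dagger_row {a b : ℤ} {p : Laurent} (hp : p ∈ box a b) (i j k : ℤ) (r : Laurent) :
    monomial i j * (r * dagger (row k p)) =
      ∑ l ∈ Finset.Ico 0 b, starRingEnd ℂ (p.coeff (k, l)) • (monomial i (j - l) * r) := by
  rw [dagger_row_eq_sum hp, Finset.mul_sum, Finset.mul_sum]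
  refine Finset.sum_congr rfl fun l _ => ?_
  rw [mul_smul_comm, mul_smul_comm, mul_left_comm, monomial_mul, add_zero, ← sub_eq_add_neg,
    mul_comm r]

theorem sum_Ico_add_sum_Ico {V : Type*} [AddCommMonoid V] (f : ℤ → V) {a b c : ℤ} (hab : a ≤ b)
    (hbc : b ≤ c) :
    ∑ k ∈ Finset.Ico a b, f k + ∑ k ∈ Finset.Ico b c, f k = ∑ k ∈ Finset.Ico a c, f k := by
  rw [← Finset.sum_union (Finset.Ico_disjoint_Ico_consecutive a b c),
    Finset.Ico_union_Ico_eq_Ico hab hbc]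

theorem sum_mul_dagger_row {a b : ℤ} {p : Laurent} (hp : p ∈ box a b) (i j : ℤ) :
    ∑ k ∈ Finset.Ico 0 a, monomial (i - k) j * (p * dagger (row k p)) =
      monomial i j * (p * dagger p) := by
  conv_rhs => rw [show dagger p = dagger (∑ k ∈ Finset.Ico 0 a, monomial k 0 * row k p) by
    rw [sum_row hp]]
  rw [dagger_sum, Finset.mul_sum, Finset.mul_sum]
  refine Finset.sum_congr rfl fun k _ => ?_
  rw [dagger_mul, dagger_monomial, neg_zero, mul_left_comm p, ← mul_assoc (monomial i j),
    monomial_mul, add_zero, sub_eq_add_neg]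

/-! ### Split orthogonality of Bernstein–Szegő functionals -/

/-- Against the weight, the conjugate of rev q acts as 1/rev q, which is analytic in each variable,
so one positive exponent left over in either variable suffices. -/
theorem form_szego_rev {q : Laurent} (hq : NonvanishingOnTorus q) {n m : ℤ}
    (hqb : q ∈ box (n + 1) (m + 1)) (hr : NonvanishingOnBidisk (rev n m q))
    {i j k l : ℤ} (h : i < k ∨ j < l) :
    form (szego hq) (monomial k l) (monomial i j * rev n m q) = 0 := by
  rw [form_apply, dagger_mul, dagger_monomial, ← mul_assoc, monomial_mul]
  exact szego_monomial_mul_dagger_rev hq hqb hr (by omega)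

theorem form_szego_self_mul {q : Laurent} (hq : NonvanishingOnTorus q) {n m : ℤ}
    (hqb : q ∈ box (n + 1) (m + 1)) (hr : NonvanishingOnBidisk (rev n m q))
    {i j k l : ℤ} (h : k < n + i ∨ l < m + j) :
    form (szego hq) (monomial k l) (monomial i j * q) = 0 := by
  have h2 : monomial i j * q = dagger (monomial (-n - i) (-m - j) * rev n m q) := by
    rw [dagger_mul, dagger_monomial, rev, dagger_mul, dagger_dagger, dagger_monomial, ← mul_assoc,
      monomial_mul]
    congr 2 <;> ring
  have h3 : form (szego hq) (monomial k l) (monomial i j * q) =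
      starRingEnd ℂ (form (szego hq) (monomial (-k) (-l))
        (monomial (-n - i) (-m - j) * rev n m q)) := by
    rw [form_apply, form_apply, ← szego_isHerm, h2, dagger_dagger, dagger_mul, dagger_dagger,
      dagger_monomial, neg_neg, neg_neg]
  have h4 : form (szego hq) (monomial (-k) (-l)) (monomial (-n - i) (-m - j) * rev n m q) = 0 :=
    form_szego_rev hq hqb hr (by omega)
  rw [h3, h4, map_zero]

/-- The part of the kernel polynomial built from `q` alone. -/
def kernelPoly (n m : ℤ) (q : Laurent) (i : ℤ) : Laurent :=
  ∑ k ∈ Finset.Ico 0 (i + 1), (monomial (i - k) 0 * (rev n m q * dagger (row k (rev n m q))) -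
    monomial (i - k) 0 * (q * dagger (row k q)))

/-- On polynomials of degree at most `n` in `z`, the form with this polynomial extracts the
coefficient at `z ^ i`. -/
def coeffPoly (n m : ℤ) (q : Laurent) (i : ℤ) : Laurent :=
  kernelPoly n m q i + q * dagger (row i q)

/-- The added q (row i q)† cancels the k = i term of the sum in q, which is why the two ranges of
summation differ by one. -/
theorem coeffPoly_eq {n m : ℤ} {q : Laurent} {i : ℤ} (hi : 0 ≤ i) (j : ℤ) :
    monomial 0 j * coeffPoly n m q i =
      ∑ k ∈ Finset.Ico 0 (i + 1), monomial (i - k) j * (rev n m q * dagger (row k (rev n m q))) -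
      ∑ k ∈ Finset.Ico 0 i, monomial (i - k) j * (q * dagger (row k q)) := by
  rw [coeffPoly, kernelPoly, Finset.sum_sub_distrib,
    ← Finset.insert_Ico_right_eq_Ico_add_one hi,
    Finset.sum_insert Finset.right_notMem_Ico, Finset.sum_insert Finset.right_notMem_Ico,
    sub_self, monomial_zero, one_mul, one_mul]
  rw [Finset.sum_insert Finset.right_notMem_Ico, sub_self]
  have h : ∀ r k, monomial (i - k) j * r = monomial 0 j * (monomial (i - k) 0 * r) := fun r k => by
    rw [← mul_assoc, monomial_mul, zero_add, add_zero]
  simp_rw [h _, ← Finset.mul_sum]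
  ring

/-- The sum over k ≤ i shows that no negative power of z occurs. Extended to all k ≤ n the sum is
z^i (rev q (rev q)† - q q†) = 0, so it is also minus the sum over k > i, in which every power of z
is below n. The powers of w are nonnegative because a row has degree at most m and j ≥ m. -/
theorem monomial_mul_kernelPoly_mem {n m : ℤ} {q : Laurent} (hqb : q ∈ box (n + 1) (m + 1))
    {i j : ℤ} (hi : 0 ≤ i) (hin : i ≤ n) (hj : m ≤ j) :
    monomial 0 j * kernelPoly n m q i ∈
      AddMonoidAlgebra.supported ℂ ℂ {a : ℤ × ℤ | (0 ≤ a.1 ∧ a.1 < n) ∧ 0 ≤ a.2} := by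
  have hrb := rev_mem_box hqb
  have key : ∀ (k : ℤ) (r p : Laurent) (t : Set (ℤ × ℤ)), r ∈ box (n + 1) (m + 1) →
      p ∈ box (n + 1) (m + 1) →
      (∀ a l : ℤ, 0 ≤ a → a < n + 1 → 0 ≤ l → (i - k + a, l) ∈ t) →
      monomial 0 j * (monomial (i - k) 0 * (r * dagger (row k p))) ∈
        AddMonoidAlgebra.supported ℂ ℂ t := by
    intro k r p t hr hp ht
    rw [← mul_assoc, monomial_mul, zero_add, add_zero, mul_dagger_row hp]
    refine Submodule.sum_mem _ fun l hl => Submodule.smul_mem _ _ ?_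
    rw [Finset.mem_Ico] at hl
    refine monomial_mul_mem_supported hr fun a b hab => ?_
    simp only [Set.mem_prod, Set.mem_Ico] at hab
    exact ht _ _ hab.1.1 hab.1.2 (by omega)
  have h1 : monomial 0 j * kernelPoly n m q i ∈
      AddMonoidAlgebra.supported ℂ ℂ {a : ℤ × ℤ | 0 ≤ a.1 ∧ 0 ≤ a.2} := by
    rw [kernelPoly, Finset.mul_sum]
    refine Submodule.sum_mem _ fun k hk => ?_
    rw [Finset.mem_Ico] at hk
    rw [mul_sub]
    refine Submodule.sub_mem _ (key _ _ _ _ hrb hrb ?_) (key _ _ _ _ hqb hqb ?_) <;>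
    · intro a l h1 h2 h3
      simp only [Set.mem_ofPred_eq]
      omega
  have h2 : monomial 0 j * kernelPoly n m q i ∈
      AddMonoidAlgebra.supported ℂ ℂ {a : ℤ × ℤ | a.1 < n} := by
    have h3 : kernelPoly n m q i = -∑ k ∈ Finset.Ico (i + 1) (n + 1),
        (monomial (i - k) 0 * (rev n m q * dagger (row k (rev n m q))) -
          monomial (i - k) 0 * (q * dagger (row k q))) := by
      rw [eq_neg_iff_add_eq_zero, kernelPoly,
        sum_Ico_add_sum_Ico _ (show 0 ≤ i + 1 by omega) (by omega), Finset.sum_sub_distrib,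
        sum_mul_dagger_row hrb, sum_mul_dagger_row hqb, rev_mul_dagger_rev, sub_self]
    rw [h3, mul_neg, Finset.mul_sum]
    refine Submodule.neg_mem _ (Submodule.sum_mem _ fun k hk => ?_)
    rw [Finset.mem_Ico] at hk
    rw [mul_sub]
    refine Submodule.sub_mem _ (key _ _ _ _ hrb hrb ?_) (key _ _ _ _ hqb hqb ?_) <;>
    · intro a l h1 h2 h3
      simp only [Set.mem_ofPred_eq]
      omega
  rw [AddMonoidAlgebra.mem_supported] at *
  exact fun a ha => ⟨⟨(h1 ha).1, h2 ha⟩, (h1 ha).2⟩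

/-- The two polynomials differ by multiples of z^(i-s) rev q with s > i and of z^(i-s) q with s < i.
For 0 ≤ k ≤ n both kinds are orthogonal to z^k w^l by their z-exponents alone. -/
theorem form_szego_coeffPoly {q : Laurent} (hq : NonvanishingOnTorus q) {n m : ℤ}
    (hqb : q ∈ box (n + 1) (m + 1)) (hr : NonvanishingOnBidisk (rev n m q)) {i j k l : ℤ}
    (hi : 0 ≤ i) (hin : i ≤ n) (hk : 0 ≤ k) (hkn : k ≤ n) :
    form (szego hq) (monomial k l) (monomial 0 j * coeffPoly n m q i) =
      form (szego hq) (monomial k l) (monomial i j * (q * dagger q)) := by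
  have hrb := rev_mem_box hqb
  have h1 : monomial 0 j * coeffPoly n m q i = monomial i j * (q * dagger q) -
      ∑ k ∈ Finset.Ico (i + 1) (n + 1),
        monomial (i - k) j * (rev n m q * dagger (row k (rev n m q))) -
      ∑ k ∈ Finset.Ico 0 i, monomial (i - k) j * (q * dagger (row k q)) := by
    rw [coeffPoly_eq hi, ← rev_mul_dagger_rev n m q q, ← sum_mul_dagger_row hrb,
      ← sum_Ico_add_sum_Ico _ (show 0 ≤ i + 1 by omega) (show i + 1 ≤ n + 1 by omega)]
    ring
  have h2 : form (szego hq) (monomial k l) (∑ k ∈ Finset.Ico (i + 1) (n + 1),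
      monomial (i - k) j * (rev n m q * dagger (row k (rev n m q)))) = 0 := by
    rw [map_sum]
    refine Finset.sum_eq_zero fun s hs => ?_
    rw [Finset.mem_Ico] at hs
    rw [mul_dagger_row hrb, map_sum]
    refine Finset.sum_eq_zero fun t _ => ?_
    rw [map_smulₛₗ, form_szego_rev hq hqb hr (Or.inl (by omega)), smul_zero]
  have h3 : form (szego hq) (monomial k l) (∑ k ∈ Finset.Ico 0 i,
      monomial (i - k) j * (q * dagger (row k q))) = 0 := by
    rw [map_sum]
    refine Finset.sum_eq_zero fun s hs => ?_
    rw [Finset.mem_Ico] at hs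
    rw [mul_dagger_row hqb, map_sum]
    refine Finset.sum_eq_zero fun t _ => ?_
    rw [map_smulₛₗ, form_szego_self_mul hq hqb hr (Or.inl (by omega)), smul_zero]
  rw [h1, map_sub, map_sub, h2, h3, sub_zero, sub_zero]

theorem form_szego_monomial_self {q : Laurent} (hq : NonvanishingOnTorus q) (i j : ℤ)
    (p : Laurent) :
    form (szego hq) p (monomial i j * (q * dagger q)) = p.coeff (i, j) := by
  rw [form_apply, dagger_mul, dagger_mul, dagger_dagger, dagger_monomial,
    show p * (monomial (-i) (-j) * (dagger q * q)) = q * dagger q * (monomial (-i) (-j) * p) by ring,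
    szego_self_mul, coeff_monomial_mul]
  simp

/-- An element of the closure of the polynomials of degree less than `a` in `z` all of whose
coefficients vanish is zero. -/
theorem eq_zero_of_coeff_eq_zero {q : Laurent} (hq : NonvanishingOnTorus q)
    {H : Type} [NormedAddCommGroup H] [InnerProductSpace ℂ H] {ι : Laurent →ₗ[ℂ] H}
    (hι : ∀ x y, inner ℂ (ι y) (ι x) = form (szego hq) x y) {s : Set (ℤ × ℤ)} {b : H}
    (hb : b ∈ ((AddMonoidAlgebra.supported ℂ ℂ s).map ι).topologicalClosure)
    (h : ∀ i j, (i, j) ∈ s → inner ℂ (ι (monomial i j * (q * dagger q))) b = 0) : b = 0 := by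
  obtain ⟨C, hC0, hC⟩ := form_szego_le_mul hq
  obtain ⟨D, hD0, hD⟩ := form_szego_mul_le hq (r := q * dagger q)
  have hnorm : ∀ p, ‖ι p‖ ^ 2 = (form (szego hq) p p).re := fun p => by
    rw [← hι, ← inner_self_eq_norm_sq (𝕜 := ℂ)]; rfl
  have hb0 : ∀ p ∈ AddMonoidAlgebra.supported ℂ ℂ s, inner ℂ (ι (q * dagger q * p)) b = 0 := by
    intro p hp
    rw [eq_sum_monomial p subset_rfl, Finset.mul_sum, map_sum, sum_inner]
    refine Finset.sum_eq_zero fun a ha => ?_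
    rw [mul_smul_comm, map_smul, inner_smul_left, mul_comm _ (monomial _ _), h _ _ (hp ha),
      mul_zero]
  have key : ∀ p ∈ AddMonoidAlgebra.supported ℂ ℂ s,
      ‖b‖ ≤ (1 + C * √D) * ‖ι p - b‖ := by
    intro p hp
    -- The norm of p is controlled by that of q p, whose square is the inner product of |q|² p with
    -- p. As |q|² p is orthogonal to `b`, here p may be replaced by p - b; so a good approximation p
    -- of `b` is itself small.
    have h1 : ‖ι p‖ ^ 2 ≤ C * (‖ι (q * dagger q * p)‖ * ‖ι p - b‖) := by
      rw [hnorm]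
      refine (hC p).trans (mul_le_mul_of_nonneg_left ?_ hC0.le)
      have h2 : form (szego hq) (q * p) (q * p) = inner ℂ (ι (q * dagger q * p)) (ι p - b) := by
        rw [inner_sub_right, hb0 p hp, sub_zero, hι, form_apply, form_apply, dagger_mul, dagger_mul,
          dagger_mul, dagger_dagger]
        congr 1
        ring
      rw [h2]
      exact (Complex.re_le_norm _).trans (norm_inner_le_norm _ _)
    have h3 : ‖ι (q * dagger q * p)‖ ≤ √D * ‖ι p‖ := by
      refine le_of_sq_le_sq ?_ (by positivity)
      rw [mul_pow, Real.sq_sqrt hD0.le, hnorm, hnorm]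
      exact hD p
    have h4 : ‖ι p‖ ≤ C * √D * ‖ι p - b‖ := by
      rcases (norm_nonneg (ι p)).eq_or_lt with h0 | h0
      · rw [← h0]; positivity
      · refine le_of_mul_le_mul_left ?_ h0
        calc ‖ι p‖ * ‖ι p‖ = ‖ι p‖ ^ 2 := by ring
          _ ≤ _ := h1
          _ ≤ C * (√D * ‖ι p‖ * ‖ι p - b‖) := by gcongr
          _ = _ := by ring
    have h5 : ‖b‖ ≤ ‖ι p‖ + ‖ι p - b‖ := by
      have := norm_sub_le (ι p) (ι p - b)
      rwa [sub_sub_cancel] at this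
    linarith
  rw [← norm_eq_zero]
  refine le_antisymm (le_of_forall_pos_le_add fun ε hε => ?_) (norm_nonneg _)
  rw [zero_add]
  have hpos : 0 < 1 + C * √D := by positivity
  have hb' : b ∈ closure (((AddMonoidAlgebra.supported ℂ ℂ s).map ι : Submodule ℂ H) : Set H) := hb
  obtain ⟨_, ⟨p, hp, rfl⟩, hpb⟩ := Metric.mem_closure_iff.1 hb' (ε / (1 + C * √D)) (by positivity)
  rw [dist_comm, dist_eq_norm, lt_div_iff₀' hpos] at hpb
  exact (key p hp).trans hpb.le

theorem inner_eq_of_mem_closure {H : Type} [NormedAddCommGroup H] [InnerProductSpace ℂ H]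
    {U : Submodule ℂ H} {u v : H} (h : ∀ x ∈ U, inner ℂ u x = inner ℂ v x) {x : H}
    (hx : x ∈ U.topologicalClosure) : inner ℂ u x = inner ℂ v x := by
  have hc : IsClosed {x : H | inner ℂ u x = inner ℂ v x} :=
    isClosed_eq (continuous_const.inner continuous_id) (continuous_const.inner continuous_id)
  exact closure_minimal (fun x hx => h x hx) hc hx

/-- Project f onto the closed span K of the z^i w^j with 0 ≤ i < n, j ≥ 0. The remainder h has no
coefficients at w^j with j ≥ m: there the coefficient is the inner product with w^j `coeffPoly`,
whose kernel part lies in K and whose other part is a combination of w^l q with l ≥ 0, orthogonal to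
K by z-degree and to f by w-degree. So h and the projection are polynomials, the projection lies in
the small box, and there it is orthogonal to itself. Hence f is orthogonal to K, which contains g.
-/
theorem szego_splitOrthogonal {q : Laurent} (hq : NonvanishingOnTorus q) {n m : ℤ}
    (hqb : q ∈ box (n + 1) (m + 1)) (hr : NonvanishingOnBidisk (rev n m q)) :
    SplitOrthogonal (szego hq) n m := by
  intro f hf g hg
  obtain ⟨H, _, _, _, ι, hι⟩ := exists_hilbert (form (szego hq)) (szego_isHerm hq).form_symm
    fun x => form_szego_pos hq
  set S : ℤ → Set (ℤ × ℤ) := fun a => {c | (0 ≤ c.1 ∧ c.1 < a) ∧ 0 ≤ c.2} with hS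
  set M := AddMonoidAlgebra.supported ℂ ℂ (S n)
  set N := AddMonoidAlgebra.supported ℂ ℂ (S (n + 1))
  set K := (M.map ι).topologicalClosure
  have hKN : K ≤ (N.map ι).topologicalClosure := by
    refine Submodule.topologicalClosure_mono (Submodule.map_mono ?_)
    refine AddMonoidAlgebra.supported_mono fun c hc => ?_
    simp only [hS, Set.mem_ofPred_eq] at hc ⊢
    omega
  have hboxN : ∀ p ∈ box (n + 1) m, p ∈ N := fun p hp => by
    refine box_le (fun i j h1 h2 h3 h4 => monomial_mem_supported ?_) hp
    exact ⟨⟨h1, h2⟩, h3⟩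
  have hboxM : ∀ b, ∀ p ∈ box n b, p ∈ M := fun b p hp => by
    refine box_le (fun i j h1 h2 h3 h4 => monomial_mem_supported ?_) hp
    exact ⟨⟨h1, h2⟩, h3⟩
  have : IsClosed (K : Set H) := Submodule.isClosed_topologicalClosure _
  have : CompleteSpace K := this.completeSpace_coe
  set P : H := K.starProjection (ι f) with hP
  have hPK : P ∈ K := Submodule.starProjection_apply_mem _ _
  set h : H := ι f - P with hh
  have hhM : ∀ x ∈ M, inner ℂ (ι x) h = 0 := fun x hx =>
    Submodule.sub_starProjection_mem_orthogonal (K := K) (ι f) (ι x)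
      (Submodule.le_topologicalClosure _ ⟨x, hx, rfl⟩)
  have hhN : h ∈ (N.map ι).topologicalClosure :=
    Submodule.sub_mem _ (Submodule.le_topologicalClosure _ ⟨f, hboxN f hf.1, rfl⟩) (hKN hPK)
  -- `h` is orthogonal to the multiples `w ^ j * q`
  have hhq : ∀ j, 0 ≤ j → inner ℂ (ι (monomial 0 j * q)) h = 0 := by
    intro j hj
    have h1 : inner ℂ (ι (monomial 0 j * q)) P = inner ℂ (0 : H) P := by
      refine inner_eq_of_mem_closure (fun x hx => ?_) hPK
      obtain ⟨x, hx, rfl⟩ := hx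
      rw [hι, inner_zero_left, eq_sum_monomial x subset_rfl, map_sum, LinearMap.sum_apply]
      refine Finset.sum_eq_zero fun c hc => ?_
      have := (hx hc).1.2
      rw [map_smul, LinearMap.smul_apply, form_szego_self_mul hq hqb hr (Or.inl (by omega)),
        smul_zero]
    rw [hh, inner_sub_right, h1, inner_zero_left, sub_zero, hι, eq_sum_box hf.1, map_sum,
      LinearMap.sum_apply]
    refine Finset.sum_eq_zero fun c hc => ?_
    simp only [Finset.mem_product, Finset.mem_Ico] at hc
    rw [map_smul, LinearMap.smul_apply, form_szego_self_mul hq hqb hr (Or.inr (by omega)),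
      smul_zero]
  -- the high coefficients of `h` vanish
  have hcoeff : ∀ i j, 0 ≤ i → i ≤ n → m ≤ j →
      inner ℂ (ι (monomial i j * (q * dagger q))) h = 0 := by
    intro i j hi hin hj
    have h1 : inner ℂ (ι (monomial i j * (q * dagger q))) h =
        inner ℂ (ι (monomial 0 j * coeffPoly n m q i)) h := by
      refine inner_eq_of_mem_closure (fun x hx => ?_) hhN
      obtain ⟨x, hx, rfl⟩ := hx
      rw [hι, hι, eq_sum_monomial x subset_rfl, map_sum, LinearMap.sum_apply, LinearMap.sum_apply]
      refine Finset.sum_congr rfl fun c hc => ?_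
      have h2 := (hx hc).1
      rw [map_smul, LinearMap.smul_apply, LinearMap.smul_apply,
        form_szego_coeffPoly hq hqb hr hi hin h2.1 (by omega)]
    rw [h1, coeffPoly, mul_add, map_add, inner_add_left,
      hhM _ (monomial_mul_kernelPoly_mem hqb hi hin hj), zero_add, mul_dagger_row hqb, map_sum,
      sum_inner]
    refine Finset.sum_eq_zero fun l hl => ?_
    rw [Finset.mem_Ico] at hl
    rw [map_smul, inner_smul_left, hhq _ (by omega), mul_zero]
  -- The polynomial formed from the coefficients of `h` that may be nonzero.
  set y : Laurent := ∑ c ∈ Finset.Ico 0 (n + 1) ×ˢ Finset.Ico 0 m,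
    (inner ℂ (ι (monomial c.1 c.2 * (q * dagger q))) h : ℂ) • monomial c.1 c.2 with hy
  have hyb : y ∈ box (n + 1) m := by
    refine Submodule.sum_mem _ fun c hc => Submodule.smul_mem _ _ ?_
    simp only [Finset.mem_product, Finset.mem_Ico] at hc
    exact monomial_mem_box hc.1.1 hc.1.2 hc.2.1 hc.2.2
  have hhy : h = ι y := by
    rw [← sub_eq_zero]
    refine eq_zero_of_coeff_eq_zero hq hι (s := S (n + 1)) (Submodule.sub_mem _ hhN
      (Submodule.le_topologicalClosure _ ⟨y, hboxN y hyb, rfl⟩)) fun i j hij => ?_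
    rw [inner_sub_right, hι, form_szego_monomial_self, sub_eq_zero, hy]
    simp only [AddMonoidAlgebra.coeff_sum, AddMonoidAlgebra.coeff_smul, Finsupp.finsetSum_apply,
      Finsupp.smul_apply, coeff_monomial, Prod.mk.eta, smul_eq_mul, mul_ite, mul_one, mul_zero,
      Finset.sum_ite_eq', Finset.mem_product, Finset.mem_Ico]
    split_ifs with hc
    · rfl
    · simp only [hS, Set.mem_ofPred_eq] at hij
      exact hcoeff i j hij.1.1 (by omega) (by omega)
  -- hence the projection of `f` is a polynomial, and so zero
  have hPx : P = ι (f - y) := by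
    rw [map_sub, ← hhy, hh, sub_sub_cancel]
  have hxb : f - y ∈ box n m := by
    rw [mem_box]
    intro i j hij
    have h1 := mem_box.1 (Submodule.sub_mem _ hf.1 hyb) i j hij
    refine ⟨⟨h1.1.1, lt_of_le_of_ne (by omega) ?_⟩, h1.2⟩
    rintro rfl
    apply hij
    rw [← form_szego_monomial_self hq, ← hι, ← hPx, ← inner_zero_left (𝕜 := ℂ) P]
    refine inner_eq_of_mem_closure (fun x hx => ?_) hPK
    obtain ⟨x, hx, rfl⟩ := hx
    rw [hι, form_szego_monomial_self, inner_zero_left]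
    refine AddMonoidAlgebra.mem_supported'.1 hx _ fun h' => ?_
    simp only [hS, Set.mem_ofPred_eq] at h'
    omega
  have hx0 : f - y = 0 := by
    by_contra h0
    refine (form_szego_pos hq h0).ne' ?_
    have h1 := hf.2 _ hxb
    have h2 := hhM _ (hboxM m _ hxb)
    rw [hhy, hι] at h2
    rw [LinearMap.map_sub₂, h1, h2, sub_zero]
  have h3 := hhM g (hboxM (m + 1) g hg.1)
  rwa [hhy, ← sub_eq_zero.1 hx0, hι] at h3

/-! ### Matching of a split-orthogonal functional with its Bernstein–Szegő functional -/

/-- `(p, q) ↦ p * (row i q)†`. -/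
def rowSesq (i : ℤ) : Sesq Laurent Laurent :=
  LinearMap.mk₂'ₛₗ (RingHom.id ℂ) (starRingEnd ℂ) (fun p q => p * dagger (row i q))
    (fun p p' q => by rw [add_mul])
    (fun c p q => by rw [smul_mul_assoc, RingHom.id_apply])
    (fun p q q' => by rw [map_add, dagger_add, mul_add])
    (fun c p q => by rw [map_smul, dagger_smul, mul_smul_comm])

theorem rowSesq_apply (i : ℤ) (p q : Laurent) : rowSesq i p q = p * dagger (row i q) := rfl

theorem shift_rowSesq (i k l : ℤ) (p q : Laurent) :
    shift k l (rowSesq i) p q = monomial k 0 * rowSesq (i - k) p q := by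
  rw [shift_apply, rowSesq_apply, rowSesq_apply, row_monomial_mul, dagger_mul, dagger_monomial]
  calc monomial k l * p * (monomial (-0) (-l) * dagger (row (i - k) q))
      = (monomial k l * monomial (-0) (-l)) * (p * dagger (row (i - k) q)) := by ring
    _ = _ := by rw [monomial_mul, neg_zero, add_zero, add_neg_cancel]

theorem kernelPoly_succ (n m : ℤ) (q : Laurent) {i : ℤ} (hi : 0 ≤ i) :
    kernelPoly n m q i = monomial 1 0 * kernelPoly n m q (i - 1) +
      (rowSesq i (rev n m q) (rev n m q) - rowSesq i q q) := by
  rw [kernelPoly, kernelPoly, ← Finset.insert_Ico_right_eq_Ico_add_one hi,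
    Finset.sum_insert Finset.right_notMem_Ico, sub_self, monomial_zero, one_mul, one_mul,
    sub_add_cancel, Finset.mul_sum, add_comm, rowSesq_apply, rowSesq_apply]
  congr 1
  refine Finset.sum_congr rfl fun k _ => ?_
  have h : ∀ r, monomial 1 0 * (monomial (i - 1 - k) 0 * r) = monomial (i - k) 0 * r := fun r => by
    rw [← mul_assoc, monomial_mul, add_zero, show 1 + (i - 1 - k) = i - k by ring]
  rw [mul_sub, h, h]

/-- Apply the Christoffel–Darboux identity to `rowSesq`. Its shift in w is the form itself, and its
shift in z is z times the form for the previous row, so the contributions of the small box and of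
the z-increments cancel. What is left is the recursion `kernelPoly_succ`, started at i = -1, where
both sides vanish. -/
theorem sum_rowSesq_eq_kernelPoly {Λ : Laurent →ₗ[ℂ] ℂ} (hΛ : IsHerm Λ) {n m : ℤ}
    (hp : PosOn Λ (n + 1) (m + 1)) (hs : SplitOrthogonal Λ n m) {φ : Laurent}
    (hφ : IsTop Λ n m φ) {κ : Type*} [Fintype κ] {a : κ → Laurent}
    (ha : IsONB (form Λ) (perp (form Λ) (box n (m + 1)) (box n m)) a) {i : ℤ} (hi : -1 ≤ i) :
    ∑ s, rowSesq i (a s) (a s) = kernelPoly n m φ i := by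
  obtain ⟨e, he⟩ := exists_isONB hΛ.form_symm (hp.mono (a := n) (b := m) (by omega) (by omega))
  have fc : FiniteDimensional ℂ (perp (form Λ) (box (n + 1) m) (box n m)) :=
    Submodule.finiteDimensional_of_le fun x hx => hx.1
  obtain ⟨c, hc⟩ := exists_isONB (U := perp (form Λ) (box (n + 1) m) (box n m)) hΛ.form_symm
    fun x hx => hp x (box_mono le_rfl (by omega) hx.1)
  induction i, hi using Int.leInduction with
  | base =>
    rw [kernelPoly]
    simp only [rowSesq_apply, row_eq_zero (ha.mem _).1 (Or.inl neg_one_lt_zero), dagger_zero,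
      mul_zero, Finset.sum_const_zero]
    simp
  | succ i hi ih =>
    rw [kernelPoly_succ _ _ _ (by omega), add_sub_cancel_right, ← ih,
      christoffel_darboux hΛ hp hs hφ he ha hc (rowSesq (i + 1))]
    simp only [shift_rowSesq, monomial_zero, one_mul, sub_zero, Finset.sum_sub_distrib,
      add_sub_cancel_right, Finset.sum_add_distrib, Finset.mul_sum]
    abel

/-! ### The w-increments are orthonormal on every circle w = const. -/

section slice

variable {q : Laurent} (hq : NonvanishingOnTorus q) {w : ℂ} (hw : ‖w‖ = 1)

theorem form_slice_rev {n m : ℤ} (hqb : q ∈ box (n + 1) (m + 1))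
    (hr : NonvanishingOnBidisk (rev n m q)) {k i : ℤ} (h : i < k) (l j : ℤ) :
    form (slice hq hw) (monomial k l) (monomial i j * rev n m q) = 0 := by
  rw [form_apply, dagger_mul, dagger_monomial, ← mul_assoc, monomial_mul]
  exact slice_monomial_mul_dagger_rev hq hw hqb hr (by omega) _

theorem form_slice_self_mul {n m : ℤ} (hqb : q ∈ box (n + 1) (m + 1))
    (hr : NonvanishingOnBidisk (rev n m q)) {k i : ℤ} (h : k < n + i) (l j : ℤ) :
    form (slice hq hw) (monomial k l) (monomial i j * q) = 0 := by
  rw [form_apply, dagger_mul, dagger_monomial, ← mul_assoc, monomial_mul]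
  exact slice_monomial_mul_dagger hq hw hqb hr (by omega) _

/-- Modulo multiples of z^(i-s) rev q with s > i and of z^(i-s) q with s ≤ i, orthogonal to z^k for
0 ≤ k < n, the kernel is z^i q q†, which reads off the coefficient of z^i. -/
theorem form_slice_kernelPoly {n m : ℤ} (hqb : q ∈ box (n + 1) (m + 1))
    (hr : NonvanishingOnBidisk (rev n m q)) {k i : ℤ} (hk : 0 ≤ k) (hkn : k < n) (hi : 0 ≤ i)
    (hin : i < n) :
    form (slice hq hw) (monomial k 0) (kernelPoly n m q i) = if k = i then 1 else 0 := by
  have hrb := rev_mem_box hqb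
  have h1 : kernelPoly n m q i = monomial i 0 * (q * dagger q) -
      ∑ k ∈ Finset.Ico (i + 1) (n + 1),
        monomial (i - k) 0 * (rev n m q * dagger (row k (rev n m q))) -
      ∑ k ∈ Finset.Ico 0 (i + 1), monomial (i - k) 0 * (q * dagger (row k q)) := by
    rw [kernelPoly, ← rev_mul_dagger_rev n m q q, ← sum_mul_dagger_row hrb,
      ← sum_Ico_add_sum_Ico _ (show 0 ≤ i + 1 by omega) (show i + 1 ≤ n + 1 by omega),
      Finset.sum_sub_distrib]
    ring
  have h2 : form (slice hq hw) (monomial k 0) (∑ k ∈ Finset.Ico (i + 1) (n + 1),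
      monomial (i - k) 0 * (rev n m q * dagger (row k (rev n m q)))) = 0 := by
    rw [map_sum]
    refine Finset.sum_eq_zero fun s hs => ?_
    rw [Finset.mem_Ico] at hs
    rw [mul_dagger_row hrb, map_sum]
    refine Finset.sum_eq_zero fun t _ => ?_
    rw [map_smulₛₗ, form_slice_rev hq hw hqb hr (by omega), smul_zero]
  have h3 : form (slice hq hw) (monomial k 0) (∑ k ∈ Finset.Ico 0 (i + 1),
      monomial (i - k) 0 * (q * dagger (row k q))) = 0 := by
    rw [map_sum]
    refine Finset.sum_eq_zero fun s hs => ?_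
    rw [Finset.mem_Ico] at hs
    rw [mul_dagger_row hqb, map_sum]
    refine Finset.sum_eq_zero fun t _ => ?_
    rw [map_smulₛₗ, form_slice_self_mul hq hw hqb hr (by omega), smul_zero]
  rw [h1, map_sub, map_sub, h2, h3, sub_zero, sub_zero, form_apply, dagger_mul, dagger_mul,
    dagger_dagger, dagger_monomial, ← mul_assoc, monomial_mul, mul_comm, mul_comm (dagger q),
    slice_self_mul_monomial]
  simp [← sub_eq_add_neg, sub_eq_zero]

theorem eval_row {a b : ℤ} {p : Laurent} (hp : p ∈ box a b) (k : ℤ) (z w : ℂ) :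
    eval (row k p) z w = eval (row k p) 1 w := by
  rw [row_eq_sum hp, eval_sum, eval_sum]
  simp only [eval_smul, eval_monomial, zpow_zero]

/-- With `b` the inner products of z^i with a_s and `A` the coefficients of a_s in z at the given w,
the kernel identity says b A = 1. Rank and the bound k ≤ n make the matrices square, so A b = 1, and
this is orthonormality of the a_s. -/
theorem form_slice_perp_basis {Λ : Laurent →ₗ[ℂ] ℂ} (hΛ : IsHerm Λ) {n m : ℕ}
    (hp : PosOn Λ (n + 1) (m + 1)) (hs : SplitOrthogonal Λ n m)
    (hφ : IsTop Λ n m q) (hr : NonvanishingOnBidisk (rev n m q)) {k : ℕ} (hk : k ≤ n)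
    {a : Fin k → Laurent}
    (ha : IsONB (form Λ) (perp (form Λ) (box n (m + 1)) (box n m)) a) (r s : Fin k) :
    form (slice hq hw) (a r) (a s) = if r = s then 1 else 0 := by
  let b : Matrix (Fin n) (Fin k) ℂ := Matrix.of fun i s =>
    form (slice hq hw) (monomial (i : ℕ) 0) (a s)
  -- A row does not depend on z, so any value may stand in place of 1.
  let A : Matrix (Fin k) (Fin n) ℂ := Matrix.of fun s i => eval (row (i : ℕ) (a s)) 1 w
  have hbA : b * A = 1 := by
    ext i j
    rw [Matrix.mul_apply, Matrix.one_apply]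
    have h1 := form_slice_kernelPoly hq hw hφ.mem hr (k := (i : ℕ)) (i := (j : ℕ)) (by omega)
      (by omega) (by omega) (by omega)
    rw [← sum_rowSesq_eq_kernelPoly hΛ hp hs hφ ha (by omega), map_sum] at h1
    have h2 : (if ((i : ℕ) : ℤ) = ((j : ℕ) : ℤ) then (1 : ℂ) else 0) = if i = j then 1 else 0 :=
      if_congr (by rw [Nat.cast_inj, Fin.val_inj]) rfl rfl
    rw [h2] at h1
    rw [← h1]
    refine Finset.sum_congr rfl fun s _ => ?_
    rw [form_apply, rowSesq_apply, dagger_mul, dagger_dagger, ← mul_assoc,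
      mul_comm _ (row _ _), slice_mul_of_const hq hw fun z _ => eval_row (ha.mem s).1 _ z w]
    exact mul_comm _ _
  have hkn : k = n := by
    refine le_antisymm hk ?_
    have h1 := Matrix.rank_mul_le_left b A
    rw [hbA, Matrix.rank_one, Fintype.card_fin] at h1
    exact h1.trans (Matrix.rank_le_width b)
  subst hkn
  have hAb : A * b = 1 := mul_eq_one_comm.1 hbA
  have h3 := congrFun (congrFun hAb r) s
  rw [Matrix.mul_apply, Matrix.one_apply] at h3
  rw [← h3]
  conv_lhs => rw [← sum_row (ha.mem r).1, map_sum, LinearMap.sum_apply]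
  rw [Finset.sum_fin_eq_sum_range]
  rw [Finset.sum_bij (i := fun (i : ℤ) _ => i.toNat) (t := Finset.range k)]
  · intro i hi
    rw [Finset.mem_Ico] at hi
    rw [Finset.mem_range]
    omega
  · intro i hi j hj h
    rw [Finset.mem_Ico] at hi hj
    omega
  · intro j hj
    rw [Finset.mem_range] at hj
    exact ⟨j, by rw [Finset.mem_Ico]; omega, by simp⟩
  · intro i hi
    rw [Finset.mem_Ico] at hi
    have h4 : i.toNat < k := by omega
    rw [dif_pos h4]
    have h5 : ((i.toNat : ℕ) : ℤ) = i := by omega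
    simp only [A, b, Matrix.of_apply, h5]
    rw [form_apply, form_apply, mul_comm (monomial i 0), mul_assoc,
      slice_mul_of_const hq hw fun z _ => eval_row (ha.mem r).1 _ z w]

end slice

theorem form_szego_perp_basis {q : Laurent} (hq : NonvanishingOnTorus q) {Λ : Laurent →ₗ[ℂ] ℂ}
    (hΛ : IsHerm Λ) {n m : ℕ}
    (hp : PosOn Λ (n + 1) (m + 1)) (hs : SplitOrthogonal Λ n m)
    (hφ : IsTop Λ n m q) (hr : NonvanishingOnBidisk (rev n m q)) {k : ℕ} (hk : k ≤ n)
    {a : Fin k → Laurent}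
    (ha : IsONB (form Λ) (perp (form Λ) (box n (m + 1)) (box n m)) a) (r s : Fin k) (l : ℤ) :
    form (szego hq) (a r) (monomial 0 l * a s) = if r = s ∧ l = 0 then 1 else 0 := by
  rw [form_apply, szego_eq_avg_slice]
  have h1 : ∀ t, slice hq (norm_unitExp t) (a r * dagger (monomial 0 l * a s)) =
      (if r = s then 1 else 0) * unitExp t ^ (-l) := by
    intro t
    rw [dagger_mul, dagger_monomial, mul_left_comm,
      slice_mul_of_const hq _ (s := unitExp t ^ (-l)) fun z _ => by rw [eval_monomial]; simp,
      ← form_apply, form_slice_perp_basis hq _ hΛ hp hs hφ hr hk ha, mul_comm]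
  simp_rw [h1]
  rw [avg_mul_const, avg_unitExp_zpow]
  by_cases hrs : r = s <;> simp [hrs]

/-- An increment is determined by its n coefficients at w^m: if they vanish it lies in `box n m`, to
which it is orthogonal. -/
theorem finrank_perp_le {Λ : Laurent →ₗ[ℂ] ℂ} {n m : ℕ} (hp : PosOn Λ (n + 1) (m + 1)) :
    Module.finrank ℂ (perp (form Λ) (box n (m + 1)) (box n m)) ≤ n := by
  let f : Laurent →ₗ[ℂ] (Fin n → ℂ) :=
    { toFun := fun p i => p.coeff ((i : ℕ), m)
      map_add' := fun p q => rfl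
      map_smul' := fun c p => rfl }
  have hf : Function.Injective (f.comp (perp (form Λ) (box n (m + 1)) (box n m)).subtype) := by
    rw [← LinearMap.ker_eq_bot, LinearMap.ker_eq_bot']
    intro x hx
    have hxb : (x : Laurent) ∈ box n m := by
      rw [mem_box]
      intro i j hij
      have h1 := mem_box.1 x.2.1 i j hij
      refine ⟨h1.1, h1.2.1, lt_of_le_of_ne (by omega) ?_⟩
      rintro rfl
      apply hij
      have h2 : (x : Laurent).coeff ((i.toNat : ℤ), (m : ℤ)) = 0 :=
        congrFun hx ⟨i.toNat, by omega⟩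
      have h3 : ((i.toNat : ℕ) : ℤ) = i := by omega
      rwa [h3] at h2
    exact Subtype.ext (eq_zero_of_form_self (fun y hy => hp y (box_mono (by omega) (by omega) hy))
      hxb (x.2.2 _ hxb))
  simpa using LinearMap.finrank_le_finrank_of_injective hf

/-- The w^k a form an orthonormal sequence, so Bessel's inequality applies. -/
theorem tendsto_form_szego_monomial {q : Laurent} (hq : NonvanishingOnTorus q) {a : Laurent}
    (ha : ∀ l : ℤ, form (szego hq) a (monomial 0 l * a) = if l = 0 then 1 else 0) (x : Laurent) :
    Filter.Tendsto (fun k : ℕ => ‖form (szego hq) x (monomial 0 k * a)‖) Filter.atTop (nhds 0) := by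
  obtain ⟨H, _, _, _, ι, hι⟩ := exists_hilbert (form (szego hq)) (szego_isHerm hq).form_symm
    fun x => form_szego_pos hq
  have hv : Orthonormal ℂ fun k : ℕ => ι (monomial 0 k * a) := by
    rw [orthonormal_iff_ite]
    intro i j
    rw [hι, show monomial 0 (i : ℤ) * a = monomial 0 j * (monomial 0 (i - j) * a) by
      rw [← mul_assoc, monomial_mul, zero_add, add_sub_cancel], form_monomial_mul, ha]
    exact if_congr (by rw [sub_eq_zero, Nat.cast_inj]) rfl rfl
  have h1 := (hv.inner_products_summable (x := ι x)).tendsto_atTop_zero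
  simp only [hι] at h1
  have h2 := h1.sqrt
  simp only [Real.sqrt_sq (norm_nonneg _), Real.sqrt_zero] at h2
  exact h2

/-- Multiply x by w and discard its components along the a_s. For μ these are orthogonal to w^(k+1)
a_r, so ⟨x, a_r⟩ becomes ⟨y, w^k a_r⟩ after k rounds, while y stays in `box n m` with Λ-norm at most
that of x. On this finite-dimensional space the products with w^k a_r tend to zero. -/
theorem form_szego_perp_basis_eq_zero {q : Laurent} (hq : NonvanishingOnTorus q)
    {Λ : Laurent →ₗ[ℂ] ℂ} (hΛ : IsHerm Λ) {n m : ℕ} {ι κ : Type*} [Fintype ι] [Fintype κ] [DecidableEq κ]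
    {e : ι → Laurent} {a : κ → Laurent} (he : IsONB (form Λ) (box n m) e)
    (ha : IsONB (form Λ) (perp (form Λ) (box n (m + 1)) (box n m)) a)
    (hμ : ∀ r s (l : ℤ),
      form (szego hq) (a r) (monomial 0 l * a s) = if r = s ∧ l = 0 then 1 else 0) (r : κ)
    {x : Laurent} (hx : x ∈ box n m) : form (szego hq) x (a r) = 0 := by
  have hA := he.sum_elim hΛ.form_symm (box_mono le_rfl (by omega)) ha
  set M := (form Λ x x).re
  have key : ∀ k : ℕ, ∃ y ∈ box n m, (form Λ y y).re ≤ M ∧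
      form (szego hq) x (a r) = form (szego hq) y (monomial 0 k * a r) := by
    intro k
    induction k with
    | zero => exact ⟨x, hx, le_rfl, by simp [monomial_zero]⟩
    | succ k ih =>
      obtain ⟨y, hy, hyM, hxy⟩ := ih
      have hwy : monomial 0 1 * y ∈ box n (m + 1) :=
        monomial_mul_mem_box hy le_rfl zero_le_one (by omega) le_rfl
      obtain ⟨y', hy'b, c, hexp⟩ : ∃ y' ∈ box n m, ∃ c : κ → ℂ,
          monomial 0 1 * y = y' + ∑ s, c s • a s := by
        refine ⟨_, Submodule.sum_mem _ fun i _ => Submodule.smul_mem _ _ (he.mem i), _,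
          (hA.expand _ hwy).trans (Fintype.sum_sum_type _)⟩
      have hz : ∀ (B : Sesq Laurent ℂ) (v : Laurent), (∀ s, B (a s) v = 0) →
          B (monomial 0 1 * y) v = B y' v := by
        intro B v hv
        rw [hexp, LinearMap.map_add₂, map_sum, LinearMap.sum_apply, Finset.sum_eq_zero, add_zero]
        intro s _
        rw [map_smul, LinearMap.smul_apply, hv, smul_zero]
      refine ⟨y', hy'b, ?_, ?_⟩
      · have h1 := hA.form_eq hwy
        rw [form_monomial_mul, Fintype.sum_sum_type] at h1
        rw [h1, Complex.ofReal_re] at hyM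
        rw [he.form_eq hy'b, Complex.ofReal_re]
        simp only [← hz (form Λ) _ fun s => (ha.mem s).2 _ (he.mem _)]
        refine le_trans (le_add_of_nonneg_right ?_) hyM
        positivity
      · rw [hxy, ← form_monomial_mul _ 0 1, ← mul_assoc, monomial_mul, zero_add, add_comm,
          ← Nat.cast_succ]
        exact hz _ _ fun s => by rw [hμ, if_neg (by omega)]
  have hlim : Filter.Tendsto (fun k : ℕ => ∑ i, √M *
      ‖form (szego hq) (e i) (monomial 0 k * a r)‖) Filter.atTop (nhds 0) := by
    rw [show (0 : ℝ) = ∑ i : ι, √M * 0 by simp]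
    refine tendsto_finsetSum _ fun i _ => Filter.Tendsto.const_mul _ ?_
    exact tendsto_form_szego_monomial hq (fun l => by rw [hμ]; simp) _
  rw [← norm_le_zero_iff]
  refine ge_of_tendsto hlim (Filter.Eventually.of_forall fun k => ?_)
  obtain ⟨y, hy, hyM, hxy⟩ := key k
  rw [he.form_eq hy, Complex.ofReal_re] at hyM
  rw [hxy]
  conv_lhs => rw [he.expand y hy, map_sum, LinearMap.sum_apply]
  refine (norm_sum_le _ _).trans (Finset.sum_le_sum fun i _ => ?_)
  rw [map_smul, LinearMap.smul_apply, norm_smul]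
  refine mul_le_mul_of_nonneg_right ?_ (norm_nonneg _)
  refine Real.le_sqrt_of_sq_le (le_trans ?_ hyM)
  exact Finset.single_le_sum (f := fun i => ‖form Λ y (e i)‖ ^ 2) (fun i _ => by positivity)
    (Finset.mem_univ i)

/-! ### A form is determined by the sums over its orthonormal bases -/

/-- Take R(p, q) = B(p, y) B'(x, q): summed over the basis of B it gives B'(x, y), over that of B'
it gives B(x, y). -/
theorem IsONB.form_eq_of_sum_eq {V : Type*} [AddCommGroup V] [Module ℂ V] {B B' : Sesq V ℂ}
    {U : Submodule ℂ V} {ι κ : Type*} [Fintype ι] [Fintype κ] {e : ι → V} {f : κ → V}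
    (hB : ∀ x y, B y x = starRingEnd ℂ (B x y)) (he : IsONB B U e) (hf : IsONB B' U f)
    (h : ∀ R : Sesq V ℂ, ∑ i, R (e i) (e i) = ∑ k, R (f k) (f k)) {x y : V} (hx : x ∈ U)
    (hy : y ∈ U) : B x y = B' x y := by
  let R : Sesq V ℂ := LinearMap.mk₂'ₛₗ (RingHom.id ℂ) (starRingEnd ℂ)
    (fun p q => B p y * B' x q)
    (fun p p' q => by rw [LinearMap.map_add₂, add_mul])
    (fun c p q => by
      rw [map_smul, LinearMap.smul_apply, RingHom.id_apply, smul_eq_mul, smul_eq_mul, mul_assoc])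
    (fun p q q' => by rw [map_add, mul_add])
    (fun c p q => by rw [map_smulₛₗ, smul_eq_mul, smul_eq_mul, mul_left_comm])
  have hR := h R
  have h1 : ∑ i, R (e i) (e i) = B' x y := by
    conv_rhs => rw [he.expand y hy]
    rw [map_sum]
    refine Finset.sum_congr rfl fun i _ => ?_
    rw [map_smulₛₗ, ← hB, smul_eq_mul]
    rfl
  have h2 : ∑ k, R (f k) (f k) = B x y := by
    conv_rhs => rw [hf.expand x hx]
    rw [map_sum, LinearMap.sum_apply]
    refine Finset.sum_congr rfl fun i _ => ?_
    rw [map_smul, LinearMap.smul_apply, smul_eq_mul, mul_comm]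
    rfl
  rw [← h1, ← h2, hR]

/-- `(p, q) ↦ p_a * conj (q_b)`. -/
def coeffSesq (a b : ℤ × ℤ) : Sesq Laurent ℂ :=
  LinearMap.mk₂'ₛₗ (RingHom.id ℂ) (starRingEnd ℂ)
    (fun p q => p.coeff a * starRingEnd ℂ (q.coeff b))
    (fun p p' q => by rw [AddMonoidAlgebra.coeff_add, Finsupp.add_apply, add_mul])
    (fun c p q => by
      rw [AddMonoidAlgebra.coeff_smul, Finsupp.smul_apply, RingHom.id_apply, smul_mul_assoc])
    (fun p q q' => by rw [AddMonoidAlgebra.coeff_add, Finsupp.add_apply, map_add, mul_add])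
    (fun c p q => by
      rw [AddMonoidAlgebra.coeff_smul, Finsupp.smul_apply, smul_eq_mul, map_mul, smul_eq_mul,
        mul_left_comm])

theorem coeffSesq_apply (a b : ℤ × ℤ) (p q : Laurent) :
    coeffSesq a b p q = p.coeff a * starRingEnd ℂ (q.coeff b) := rfl

theorem shift_coeffSesq (i j k l : ℤ) :
    shift 0 1 (coeffSesq (i, j) (k, l)) = coeffSesq (i, j - 1) (k, l - 1) := by
  refine LinearMap.ext fun p => LinearMap.ext fun q => ?_
  rw [shift_apply, coeffSesq_apply, coeffSesq_apply, coeff_monomial_mul, coeff_monomial_mul,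
    sub_zero, sub_zero]

theorem sesq_eq_sum_coeffSesq {a b : ℤ} (R : Sesq Laurent ℂ) {p : Laurent} (hp : p ∈ box a b) :
    R p p = ∑ c ∈ Finset.Ico 0 a ×ˢ Finset.Ico 0 b, ∑ d ∈ Finset.Ico 0 a ×ˢ Finset.Ico 0 b,
      coeffSesq c d p p * R (monomial c.1 c.2) (monomial d.1 d.2) := by
  refine (congrArg₂ (fun x y => R x y) (eq_sum_box hp) (eq_sum_box hp)).trans ?_
  rw [LinearMap.map_sum₂]
  refine Finset.sum_congr rfl fun c _ => ?_
  rw [map_sum]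
  refine Finset.sum_congr rfl fun d _ => ?_
  rw [map_smulₛₗ, map_smul, LinearMap.smul_apply, coeffSesq_apply, smul_eq_mul, smul_eq_mul]
  ring

/-- The sums of products of coefficients determine those of every R. The shift lowers both
w-exponents by one, so they agree by induction on the first, starting from negative exponents, where
they vanish. -/
theorem sum_eq_of_sub_shift {a b : ℤ} {ι κ : Type*} [Fintype ι] [Fintype κ] {e : ι → Laurent}
    {f : κ → Laurent} (he : ∀ i, e i ∈ box a b) (hf : ∀ i, f i ∈ box a b)
    (h : ∀ R : Sesq Laurent ℂ, ∑ i, R (e i) (e i) - ∑ i, shift 0 1 R (e i) (e i) =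
      ∑ i, R (f i) (f i) - ∑ i, shift 0 1 R (f i) (f i)) (R : Sesq Laurent ℂ) :
    ∑ i, R (e i) (e i) = ∑ i, R (f i) (f i) := by
  have hz : ∀ p ∈ box a b, ∀ i j k l : ℤ, j < 0 → coeffSesq (i, j) (k, l) p p = 0 := by
    intro p hp i j k l hj
    have : p.coeff (i, j) = 0 := by
      by_contra h'
      have := mem_box.1 hp i j h'
      omega
    rw [coeffSesq_apply, this, zero_mul]
  have hc : ∀ (N : ℕ) (i j k l : ℤ), j < N → ∑ s, coeffSesq (i, j) (k, l) (e s) (e s) =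
      ∑ s, coeffSesq (i, j) (k, l) (f s) (f s) := by
    intro N
    induction N with
    | zero =>
      intro i j k l hj
      rw [Finset.sum_eq_zero fun s _ => hz _ (he s) i j k l (by exact_mod_cast hj),
        Finset.sum_eq_zero fun s _ => hz _ (hf s) i j k l (by exact_mod_cast hj)]
    | succ N ih =>
      intro i j k l hj
      have h1 := h (coeffSesq (i, j) (k, l))
      rw [shift_coeffSesq, ih i (j - 1) k (l - 1) (by push_cast at hj; omega)] at h1
      exact sub_left_injective h1
  simp_rw [sesq_eq_sum_coeffSesq R (he _), sesq_eq_sum_coeffSesq R (hf _)]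
  rw [Finset.sum_comm, Finset.sum_comm (s := Finset.univ (α := κ))]
  refine Finset.sum_congr rfl fun c _ => ?_
  rw [Finset.sum_comm, Finset.sum_comm (s := Finset.univ (α := κ))]
  refine Finset.sum_congr rfl fun d _ => ?_
  rw [← Finset.sum_mul, ← Finset.sum_mul, hc (c.2.toNat + 1) c.1 c.2 d.1 d.2 (by omega)]

/-- The a_s are an orthonormal basis of the w-increments for both functionals, so `sum_rev_perp`
leaves the same value of Σ R(e, e) minus its shift for bases of the small box. By
`sum_eq_of_sub_shift` these sums agree, and they determine the form. -/
theorem form_eq_form_szego {q : Laurent} (hq : NonvanishingOnTorus q) {Λ : Laurent →ₗ[ℂ] ℂ}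
    (hΛ : IsHerm Λ) {n m : ℕ}
    (hp : PosOn Λ (n + 1) (m + 1)) (hs : SplitOrthogonal Λ n m)
    (hφ : IsTop Λ n m q) (hr : NonvanishingOnBidisk (rev n m q)) {x y : Laurent}
    (hx : x ∈ box n (m + 1)) (hy : y ∈ box n (m + 1)) :
    form Λ x y = form (szego hq) x y := by
  have hpE := hp.mono (a := n) (b := m) (by omega) (by omega)
  obtain ⟨e, he⟩ := exists_isONB hΛ.form_symm hpE
  have fa : FiniteDimensional ℂ (perp (form Λ) (box n (m + 1)) (box n m)) :=
    Submodule.finiteDimensional_of_le fun x hx => hx.1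
  obtain ⟨a, ha⟩ := exists_isONB (U := perp (form Λ) (box n (m + 1)) (box n m)) hΛ.form_symm
    fun x hx => hp x (box_mono (by omega) le_rfl hx.1)
  have hsym := (szego_isHerm hq).form_symm
  obtain ⟨f, hf⟩ := exists_isONB (U := box n m) hsym fun x _ => form_szego_pos hq
  have hμ := form_szego_perp_basis hq hΛ hp hs hφ hr (finrank_perp_le hp) ha
  have h0 := fun r x hx => form_szego_perp_basis_eq_zero hq hΛ he ha hμ r (x := x) hx
  have hμ' : ∀ r s, form (szego hq) (a r) (a s) = if r = s then 1 else 0 := fun r s => by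
    have := hμ r s 0
    simpa [monomial_zero] using this
  have hA := he.sum_elim hΛ.form_symm (box_mono le_rfl (by omega)) ha
  have ha' : IsONB (form (szego hq)) (perp (form (szego hq)) (box n (m + 1)) (box n m)) a := by
    refine isONB_of_complete (fun r => ⟨(ha.mem r).1, fun x hx => ?_⟩) (fun r => ?_)
      (fun r s hrs => ?_) fun z hz h => ?_
    · rw [hsym x, h0 r x hx, map_zero]
    · rw [hμ', if_pos rfl]
    · rw [hμ', if_neg hrs]
    · by_contra hne
      refine (form_szego_pos hq hne).ne' ?_
      refine (congrArg (form (szego hq) z) (hA.expand z hz.1)).trans ?_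
      rw [map_sum]
      refine Finset.sum_eq_zero fun i _ => ?_
      rw [map_smulₛₗ]
      rcases i with i | r
      · rw [Sum.elim_inl, hz.2 _ (he.mem i), smul_zero]
      · rw [Sum.elim_inr, h r, smul_zero]
  have hA' := hf.sum_elim hsym (box_mono le_rfl (by omega)) ha'
  refine hA.form_eq_of_sum_eq hΛ.form_symm hA' (fun R => ?_) hx hy
  rw [Fintype.sum_sum_type, Fintype.sum_sum_type]
  simp only [Sum.elim_inl, Sum.elim_inr]
  congr 1
  refine sum_eq_of_sub_shift he.mem hf.mem (fun R => ?_) R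
  have h1 := sum_rev_perp hΛ he ha R
  have h2 := sum_rev_perp (szego_isHerm hq) hf ha' R
  rw [h1] at h2
  rw [← sub_eq_zero] at h2 ⊢
  rw [← h2]
  abel

/-! ### The moments of a split-orthogonal functional -/

theorem exists_sub_mem_perp {Λ : Laurent →ₗ[ℂ] ℂ} (hΛ : IsHerm Λ) {a b : ℤ} (hp : PosOn Λ a b)
    {U : Submodule ℂ Laurent} (hU : box a b ≤ U) {x : Laurent} (hx : x ∈ U) :
    ∃ y ∈ box a b, x - y ∈ perp (form Λ) U (box a b) := by
  obtain ⟨e, he⟩ := exists_isONB hΛ.form_symm hp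
  have hy : ∑ i, form Λ x (e i) • e i ∈ box a b :=
    Submodule.sum_mem _ fun i _ => Submodule.smul_mem _ _ (he.mem i)
  refine ⟨_, hy, U.sub_mem hx (hU hy), fun z hz => he.form_left_eq_zero (fun j => ?_) hz⟩
  rw [map_sub, LinearMap.sub_apply, map_sum, LinearMap.sum_apply, Finset.sum_eq_single j]
  · rw [map_smul, LinearMap.smul_apply, he.unit, smul_eq_mul, mul_one, sub_self]
  · intro i _ hij
    rw [map_smul, LinearMap.smul_apply, he.orth i j hij, smul_zero]
  · exact fun h => absurd (Finset.mem_univ j) h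

/-- The only products not given by `h1`, `h2` or orthogonality to φ are the mixed ones. Subtracting
projections to the small box turns their arguments into increments, the same for both functionals,
where split orthogonality gives zero. -/
theorem IsTop.form_eq {Λ Λ' : Laurent →ₗ[ℂ] ℂ} (hΛ : IsHerm Λ) (hΛ' : IsHerm Λ') {n m : ℤ}
    (hp : PosOn Λ (n + 1) (m + 1)) (hs : SplitOrthogonal Λ n m) (hs' : SplitOrthogonal Λ' n m)
    {φ : Laurent} (hφ : IsTop Λ n m φ) (hφ' : IsTop Λ' n m φ)
    (h1 : ∀ x ∈ box n (m + 1), ∀ y ∈ box n (m + 1), form Λ x y = form Λ' x y)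
    (h2 : ∀ x ∈ box (n + 1) m, ∀ y ∈ box (n + 1) m, form Λ x y = form Λ' x y)
    {x y : Laurent} (hx : x ∈ box (n + 1) (m + 1)) (hy : y ∈ box (n + 1) (m + 1)) :
    form Λ x y = form Λ' x y := by
  have e1 : box n m ≤ box n (m + 1) := box_mono le_rfl (by omega)
  have e2 : box n m ≤ box (n + 1) m := box_mono (by omega) le_rfl
  have h3 : ∀ x ∈ box (n + 1) m, ∀ y ∈ box n (m + 1), form Λ x y = form Λ' x y := by
    intro x hx y hy
    have hpE := hp.mono (a := n) (b := m) (by omega) (by omega)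
    obtain ⟨x0, hx0, hx1⟩ := exists_sub_mem_perp hΛ hpE e2 hx
    obtain ⟨y0, hy0, hy1⟩ := exists_sub_mem_perp hΛ hpE e1 hy
    have k1 := hs _ hx1 _ hy1
    have k2 := hs' (x - x0) ⟨hx1.1, fun z hz => by
      rw [← h2 _ hx1.1 _ (e2 hz)]; exact hx1.2 z hz⟩ (y - y0) ⟨hy1.1, fun z hz => by
      rw [← h1 _ hy1.1 _ (e1 hz)]; exact hy1.2 z hz⟩
    have k3 := h1 x0 (e1 hx0) y hy
    have k4 := h2 x hx y0 (e2 hy0)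
    have k5 := h1 x0 (e1 hx0) y0 (e1 hy0)
    rw [map_sub, map_sub, LinearMap.sub_apply, LinearMap.sub_apply] at k1 k2
    linear_combination k1 - k2 + k3 + k4 - k5
  have h4 : ∀ x ∈ box n (m + 1), ∀ y ∈ box (n + 1) m, form Λ x y = form Λ' x y := by
    intro x hx y hy
    rw [hΛ.form_symm y, hΛ'.form_symm y, h3 y hy x hx]
  have hdec : ∀ x ∈ box (n + 1) (m + 1), ∃ u ∈ box n (m + 1), ∃ v ∈ box (n + 1) m, ∃ t : ℂ,
      x = u + v + t • φ := by
    intro x hx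
    have h0 : (x - (x.coeff (n, m) / φ.coeff (n, m)) • φ).coeff (n, m) = 0 := by
      simp only [AddMonoidAlgebra.coeff_sub, AddMonoidAlgebra.coeff_smul, Finsupp.sub_apply,
        Finsupp.smul_apply, smul_eq_mul]
      rw [div_mul_cancel₀ _ hφ.coeff_ne_zero, sub_self]
    obtain ⟨u, hu, v, hv, huv⟩ := exists_add_of_coeff_corner
      (Submodule.sub_mem _ hx (Submodule.smul_mem _ _ hφ.mem)) h0
    exact ⟨u, hu, v, hv, _, sub_eq_iff_eq_add.1 huv⟩
  obtain ⟨u, hu, v, hv, t, rfl⟩ := hdec x hx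
  obtain ⟨u', hu', v', hv', t', rfl⟩ := hdec y hy
  simp only [map_add, LinearMap.add_apply, map_smul, map_smulₛₗ, LinearMap.smul_apply,
    hφ.orth_left _ hu', hφ'.orth_left _ hu', hφ.orth_right _ hv', hφ'.orth_right _ hv', hφ.unit,
    hφ'.unit, hΛ.form_symm φ, hΛ'.form_symm φ, hφ.orth_left _ hu, hφ'.orth_left _ hu,
    hφ.orth_right _ hv, hφ'.orth_right _ hv, h1 _ hu _ hu', h2 _ hv _ hv', h3 _ hv _ hu',
    h4 _ hu _ hv']

theorem isTop_szego {q : Laurent} (hq : NonvanishingOnTorus q) {n m : ℤ}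
    (hqb : q ∈ box (n + 1) (m + 1)) (hr : NonvanishingOnBidisk (rev n m q)) :
    IsTop (szego hq) n m q := by
  have h : ∀ a b, (a ≤ n ∨ b ≤ m) → ∀ p ∈ box a b, form (szego hq) q p = 0 := by
    intro a b hab p hp
    rw [(szego_isHerm hq).form_symm p, eq_sum_box hp, map_sum, LinearMap.sum_apply,
      Finset.sum_eq_zero, map_zero]
    intro c hc
    simp only [Finset.mem_product, Finset.mem_Ico] at hc
    have h1 := form_szego_self_mul hq hqb hr (i := 0) (j := 0) (k := c.1) (l := c.2) (by omega)
    rw [monomial_zero, one_mul] at h1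
    rw [map_smul, LinearMap.smul_apply, h1, smul_zero]
  refine ⟨hqb, h _ _ (Or.inl le_rfl), h _ _ (Or.inr le_rfl), ?_⟩
  have h1 := form_szego_mul_mul hq 1 1
  rw [mul_one, dagger_one, mul_one, ← monomial_zero, coeff_monomial, if_pos rfl] at h1
  exact h1

section swap

variable {Λ : Laurent →ₗ[ℂ] ℂ}

theorem form_comp_swap (p q : Laurent) :
    form (Λ.comp swap.toLinearMap) p q = form Λ (swap p) (swap q) := by
  rw [form_apply, form_apply, ← swap_dagger, ← map_mul]; rfl

theorem IsHerm.comp_swap (h : IsHerm Λ) : IsHerm (Λ.comp swap.toLinearMap) := fun p => by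
  have := h (swap p)
  rw [← swap_dagger] at this
  exact this

theorem PosOn.comp_swap {a b : ℤ} (h : PosOn Λ a b) : PosOn (Λ.comp swap.toLinearMap) b a := by
  intro p hp hp0
  rw [form_comp_swap]
  exact h _ (swap_mem_box.2 hp) ((map_ne_zero_iff _ swap.injective).2 hp0)

theorem swap_mem_perp {a b c d : ℤ} {p : Laurent}
    (hp : p ∈ perp (form (Λ.comp swap.toLinearMap)) (box a b) (box c d)) :
    swap p ∈ perp (form Λ) (box b a) (box d c) := by
  refine ⟨swap_mem_box.2 hp.1, fun y hy => ?_⟩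
  have := hp.2 (swap y) (swap_mem_box.2 hy)
  rwa [form_comp_swap, swap_swap] at this

theorem SplitOrthogonal.comp_swap (hΛ : IsHerm Λ) {n m : ℤ} (h : SplitOrthogonal Λ n m) :
    SplitOrthogonal (Λ.comp swap.toLinearMap) m n := by
  intro f hf g hg
  rw [form_comp_swap, hΛ.form_symm (swap g), h _ (swap_mem_perp hg) _ (swap_mem_perp hf), map_zero]

theorem IsTop.comp_swap {n m : ℤ} {φ : Laurent} (h : IsTop Λ n m φ) :
    IsTop (Λ.comp swap.toLinearMap) m n (swap φ) := by
  refine ⟨swap_mem_box.2 h.mem, fun p hp => ?_, fun p hp => ?_, ?_⟩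
  · rw [form_comp_swap, swap_swap]
    exact h.orth_right _ (swap_mem_box.2 hp)
  · rw [form_comp_swap, swap_swap]
    exact h.orth_left _ (swap_mem_box.2 hp)
  · rw [form_comp_swap, swap_swap, h.unit]

end swap

theorem NonvanishingOnBidisk.rev_swap {q : Laurent} {n m : ℤ}
    (h : NonvanishingOnBidisk (rev n m q)) : NonvanishingOnBidisk (rev m n (swap q)) := by
  intro z w hz hw
  rw [← swap_rev, eval_swap]
  exact h w z hw hz

theorem form_eq_form_szego_of_top {q : Laurent} (hq : NonvanishingOnTorus q)
    {Λ : Laurent →ₗ[ℂ] ℂ} (hΛ : IsHerm Λ) {n m : ℕ}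
    (hp : PosOn Λ (n + 1) (m + 1)) (hs : SplitOrthogonal Λ n m)
    (hφ : IsTop Λ n m q) (hr : NonvanishingOnBidisk (rev n m q)) {x y : Laurent}
    (hx : x ∈ box (n + 1) (m + 1)) (hy : y ∈ box (n + 1) (m + 1)) :
    form Λ x y = form (szego hq) x y := by
  refine IsTop.form_eq hΛ (szego_isHerm hq) hp hs
    (szego_splitOrthogonal hq hφ.mem hr) hφ (isTop_szego hq hφ.mem hr)
    (fun x hx y hy => form_eq_form_szego hq hΛ hp hs hφ hr hx hy) (fun x hx y hy => ?_) hx hy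
  have h := form_eq_form_szego hq.swap hΛ.comp_swap hp.comp_swap (hs.comp_swap hΛ) hφ.comp_swap
    hr.rev_swap (swap_mem_box.2 hx) (swap_mem_box.2 hy)
  rw [form_comp_swap, swap_swap, swap_swap] at h
  rw [h, form_apply, form_apply, ← swap_dagger, ← map_mul, szego_swap]

theorem exists_monomial_mul_dagger {n m : ℕ} {k l : ℤ} (hk : |k| ≤ n) (hl : |l| ≤ m) :
    ∃ x ∈ box (n + 1) (m + 1), ∃ y ∈ box (n + 1) (m + 1), monomial k l = x * dagger y := by
  rw [abs_le] at hk hl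
  -- Positive and negative parts of the exponents turn a moment into an inner product of two
  -- monomials.
  refine ⟨monomial (max k 0) (max l 0), monomial_mem_box ?_ ?_ ?_ ?_,
    monomial (max (-k) 0) (max (-l) 0), monomial_mem_box ?_ ?_ ?_ ?_, ?_⟩
  any_goals omega
  rw [dagger_monomial, monomial_mul]
  congr 1 <;> omega

/-! ### Dependence on the moments of the box only. -/

theorem form_congr {Λ Λ' : Laurent →ₗ[ℂ] ℂ} {n m : ℕ}
    (h : ∀ k l : ℤ, |k| ≤ n → |l| ≤ m → Λ (monomial k l) = Λ' (monomial k l)) {x y : Laurent}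
    (hx : x ∈ box (n + 1) (m + 1)) (hy : y ∈ box (n + 1) (m + 1)) : form Λ x y = form Λ' x y := by
  rw [← polySpace_eq_box] at hx hy
  have h1 := mul_dagger_mem hx hy
  rw [laurentSpace, AddMonoidAlgebra.mem_supported'] at h1
  rw [form_apply, form_apply, eq_sum_monomial (x * dagger y) subset_rfl, map_sum, map_sum]
  refine Finset.sum_congr rfl fun a ha => ?_
  have h2 : a ∈ Set.Icc (-n : ℤ) n ×ˢ Set.Icc (-m : ℤ) m := by
    by_contra h'
    exact Finsupp.mem_support_iff.1 ha (h1 a h')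
  rw [map_smul, map_smul, h _ _ (abs_le.2 h2.1) (abs_le.2 h2.2)]

theorem SplitOrthogonal.congr {Λ Λ' : Laurent →ₗ[ℂ] ℂ} {n m : ℤ} (hs : SplitOrthogonal Λ n m)
    (h : ∀ x ∈ box (n + 1) (m + 1), ∀ y ∈ box (n + 1) (m + 1), form Λ x y = form Λ' x y) :
    SplitOrthogonal Λ' n m := by
  intro f hf g hg
  have e1 : box n (m + 1) ≤ box (n + 1) (m + 1) := box_mono (by omega) le_rfl
  have e2 : box (n + 1) m ≤ box (n + 1) (m + 1) := box_mono le_rfl (by omega)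
  have e3 : box n m ≤ box (n + 1) (m + 1) := box_mono (by omega) (by omega)
  rw [← h _ (e2 hf.1) _ (e1 hg.1)]
  refine hs f ⟨hf.1, fun z hz => ?_⟩ g ⟨hg.1, fun z hz => ?_⟩
  · rw [h _ (e2 hf.1) _ (e3 hz)]; exact hf.2 z hz
  · rw [h _ (e1 hg.1) _ (e3 hz)]; exact hg.2 z hz

/-! ### Extension of a functional by zero -/

/-- The part of a Laurent polynomial with exponents in `[-n, n] × [-m, m]`. -/
def truncate (n m : ℕ) : Laurent →ₗ[ℂ] laurentSpace n m := by
  classical exact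
  { toFun := fun p => ⟨.ofCoeff (p.coeff.filter (· ∈ Set.Icc (-n : ℤ) n ×ˢ Set.Icc (-m : ℤ) m)), by
      rw [laurentSpace, AddMonoidAlgebra.mem_supported']
      intro a ha
      rw [AddMonoidAlgebra.coeff_ofCoeff, Finsupp.filter_apply, if_neg ha]⟩
    map_add' := fun _ _ => Subtype.ext (congrArg AddMonoidAlgebra.ofCoeff Finsupp.filter_add)
    map_smul' := fun _ _ => Subtype.ext (congrArg AddMonoidAlgebra.ofCoeff Finsupp.filter_smul) }

theorem coeff_truncate_of_mem {n m : ℕ} (p : Laurent) {a : ℤ × ℤ}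
    (ha : a ∈ Set.Icc (-n : ℤ) n ×ˢ Set.Icc (-m : ℤ) m) :
    (truncate n m p : Laurent).coeff a = p.coeff a :=
  Finsupp.filter_apply_pos (· ∈ Set.Icc (-n : ℤ) n ×ˢ Set.Icc (-m : ℤ) m) _ ha

theorem truncate_eq {n m : ℕ} {p : Laurent} (hp : p ∈ laurentSpace n m) :
    truncate n m p = ⟨p, hp⟩ := by
  ext a
  by_cases h : a ∈ Set.Icc (-n : ℤ) n ×ˢ Set.Icc (-m : ℤ) m
  · exact coeff_truncate_of_mem p h
  · exact (AddMonoidAlgebra.mem_supported'.1 (truncate n m p).2 a h).trans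
      (AddMonoidAlgebra.mem_supported'.1 hp a h).symm

theorem truncate_monomial_eq_zero {n m : ℕ} {i j : ℤ} (h : ¬ (|i| ≤ n ∧ |j| ≤ m)) :
    truncate n m (monomial i j) = 0 := by
  ext a
  by_cases h1 : a ∈ Set.Icc (-n : ℤ) n ×ˢ Set.Icc (-m : ℤ) m
  · rw [coeff_truncate_of_mem _ h1, coeff_monomial, if_neg]
    · rfl
    · rintro rfl
      exact h ⟨abs_le.2 h1.1, abs_le.2 h1.2⟩
  · exact AddMonoidAlgebra.mem_supported'.1 (truncate n m (monomial i j)).2 a h1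

section extend

variable {n m : ℕ} {L : laurentSpace n m →ₗ[ℂ] ℂ}

/-- The extension of `L` by zero on the remaining monomials. -/
def extend (L : laurentSpace n m →ₗ[ℂ] ℂ) : Laurent →ₗ[ℂ] ℂ := L.comp (truncate n m)

theorem extend_eq {p : Laurent} (hp : p ∈ laurentSpace n m) : extend L p = L ⟨p, hp⟩ := by
  rw [extend, LinearMap.comp_apply, truncate_eq hp]

theorem form_extend (p q : polySpace n m) : form (extend L) p q = pairing L p q := by
  rw [form_apply, extend_eq (mul_dagger_mem p.2 q.2)]; rfl

theorem isHerm_extend (hL : PositiveDefinite L) : IsHerm (extend L) := by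
  intro p
  induction p using Laurent.induction with
  | add p q hp hq => rw [dagger_add, map_add, map_add, map_add, hp, hq]
  | mon c i j =>
    rw [dagger_smul, map_smul, map_smul, dagger_monomial, smul_eq_mul, smul_eq_mul, map_mul]
    congr 1
    by_cases h : |i| ≤ n ∧ |j| ≤ m
    · rw [extend_eq (monomial_mem_laurentSpace h.1 h.2), ← hL.hermitian i j h.1 h.2, extend_eq]
    · rw [extend, LinearMap.comp_apply, LinearMap.comp_apply, truncate_monomial_eq_zero h,
        truncate_monomial_eq_zero (by rwa [abs_neg, abs_neg]), map_zero, map_zero]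

theorem posOn_extend (hL : PositiveDefinite L) : PosOn (extend L) (n + 1) (m + 1) := by
  intro p hp hp0
  rw [← polySpace_eq_box] at hp
  have := hL.pos ⟨p, hp⟩ fun h => hp0 (congrArg Subtype.val h)
  rwa [← form_extend] at this

/-! ### Orthogonality of the orthonormal polynomials -/

theorem IsOrthonormalAt.mem_of_coeff_ne_zero {S : Set (Box n m)} {a : Box n m} {φ : polySpace n m}
    (h : IsOrthonormalAt L S a φ) {i j : ℤ} (hij : (φ : Laurent).coeff (i, j) ≠ 0) :
    ∃ b : Box n m, i = (b.1 : ℕ) ∧ j = (b.2 : ℕ) ∧ (b = a ∨ b ∈ S) := by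
  have h1 : (φ : Laurent) ∈ box (n + 1) (m + 1) := by rw [← polySpace_eq_box]; exact φ.2
  have h2 := mem_box.1 h1 i j hij
  have hi : ((i.toNat : ℕ) : ℤ) = i := by omega
  have hj : ((j.toNat : ℕ) : ℤ) = j := by omega
  refine ⟨(⟨i.toNat, by omega⟩, ⟨j.toNat, by omega⟩), hi.symm, hj.symm, h.terms _ ?_⟩
  rw [boxCoeff, Box.toInt]
  simpa only [hi, hj] using hij

theorem IsOrthonormalAt.form_eq_zero {S : Set (Box n m)} {a : Box n m} {φ : polySpace n m}
    (h : IsOrthonormalAt L S a φ) {u v : ℤ} (hu : u ≤ n + 1) (hv : v ≤ m + 1)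
    (hS : ∀ b : Box n m, ((b.1 : ℕ) : ℤ) < u → ((b.2 : ℕ) : ℤ) < v → b ∈ S) {p : Laurent}
    (hp : p ∈ box u v) : form (extend L) φ p = 0 := by
  have hp' : p ∈ polySpace n m := by
    rw [polySpace_eq_box]; exact box_mono hu hv hp
  have h1 := form_extend (L := L) φ ⟨p, hp'⟩
  refine h1.trans (inner_eq_zero_of_terms h.orthogonal fun b hb => ?_)
  have h2 := mem_box.1 hp _ _ hb
  exact hS b h2.1.2 h2.2.2

theorem lexPoly_spec (hL : PositiveDefinite L) (n' m' l : ℕ) (hn : n' ≤ n) (hm : m' ≤ m)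
    (hl : l ≤ m') : IsOrthonormalAt L (lexBelow n' m' l)
      (⟨n', Nat.lt_succ_of_le hn⟩, ⟨l, Nat.lt_succ_of_le (hl.trans hm)⟩)
      (lexPoly hL n' m' l hn hm hl) :=
  (existsUnique_isOrthonormalAt hL (lexBelow n' m' l) _ (by simp [lexBelow])).choose_spec.1

theorem revlexPoly_spec (hL : PositiveDefinite L) (n' m' l : ℕ) (hn : n' ≤ n) (hm : m' ≤ m)
    (hl : l ≤ n') : IsOrthonormalAt L (revlexBelow n' m' l)
      (⟨l, Nat.lt_succ_of_le (hl.trans hn)⟩, ⟨m', Nat.lt_succ_of_le hm⟩)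
      (revlexPoly hL n' m' l hn hm hl) :=
  (existsUnique_isOrthonormalAt hL (revlexBelow n' m' l) _ (by simp [revlexBelow])).choose_spec.1

theorem isTop_lexPoly (hL : PositiveDefinite L) :
    IsTop (extend L) n m (lexPoly hL n m m le_rfl le_rfl le_rfl) := by
  have h := lexPoly_spec hL n m m le_rfl le_rfl le_rfl
  refine ⟨by rw [← polySpace_eq_box]; exact (lexPoly hL n m m _ _ _).2,
    fun p hp => h.form_eq_zero (by omega) le_rfl ?_ hp,
    fun p hp => h.form_eq_zero le_rfl (by omega) ?_ hp, ?_⟩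
  · intro b h1 h2
    simp only [lexBelow, Set.mem_ofPred_eq]
    omega
  · intro b h1 h2
    simp only [lexBelow, Set.mem_ofPred_eq]
    omega
  · rw [form_extend, h.unit]

theorem lexPoly_mem_perp (hL : PositiveDefinite L) {l : ℕ} (hl : l ≤ m - 1) (hm : 0 < m) :
    (lexPoly hL n (m - 1) l le_rfl (Nat.sub_le m 1) hl : Laurent) ∈
      perp (form (extend L)) (box (n + 1) m) (box n m) := by
  have h := lexPoly_spec hL n (m - 1) l le_rfl (Nat.sub_le m 1) hl
  refine ⟨?_, fun p hp => h.form_eq_zero (by omega) (by omega) ?_ hp⟩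
  · rw [mem_box]
    intro i j hij
    obtain ⟨b, rfl, rfl, rfl | hb⟩ := h.mem_of_coeff_ne_zero hij
    · simp only; omega
    · simp only [lexBelow, Set.mem_ofPred_eq] at hb
      omega
  · intro b h1 h2
    simp only [lexBelow, Set.mem_ofPred_eq]
    omega

theorem revlexPoly_mem_perp (hL : PositiveDefinite L) {l : ℕ} (hl : l ≤ n - 1) (hn : 0 < n) :
    (revlexPoly hL (n - 1) m l (Nat.sub_le n 1) le_rfl hl : Laurent) ∈
      perp (form (extend L)) (box n (m + 1)) (box n m) := by
  have h := revlexPoly_spec hL (n - 1) m l (Nat.sub_le n 1) le_rfl hl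
  refine ⟨?_, fun p hp => h.form_eq_zero (by omega) (by omega) ?_ hp⟩
  · rw [mem_box]
    intro i j hij
    obtain ⟨b, rfl, rfl, rfl | hb⟩ := h.mem_of_coeff_ne_zero hij
    · simp only; omega
    · simp only [revlexBelow, Set.mem_ofPred_eq] at hb
      omega
  · intro b h1 h2
    simp only [revlexBelow, Set.mem_ofPred_eq]
    omega

/-- A functional vanishes on `box (n + 1) m` if it does so on `box n m` and on polynomials with
leading terms `z ^ n * w ^ l`, `l < m`. -/
theorem eq_zero_of_triangular {N M : ℕ} (F : Laurent →ₗ[ℂ] ℂ) (h0 : ∀ p ∈ box N M, F p = 0)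
    (h : ∀ l : ℕ, l < M → ∃ φ ∈ box (N + 1) M, φ.coeff ((N : ℤ), (l : ℤ)) ≠ 0 ∧
      (∀ j : ℤ, l < j → φ.coeff ((N : ℤ), j) = 0) ∧ F φ = 0) {p : Laurent}
    (hp : p ∈ box (N + 1) M) : F p = 0 := by
  have key : ∀ k : ℕ, k ≤ M → ∀ p ∈ box (N + 1) M, (∀ j : ℤ, k ≤ j → p.coeff ((N : ℤ), j) = 0) →
      F p = 0 := by
    intro k
    induction k with
    | zero =>
      intro _ p hp hk
      refine h0 p (mem_box.2 fun i j hij => ?_)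
      have h1 := mem_box.1 hp i j hij
      refine ⟨⟨h1.1.1, lt_of_le_of_ne (by omega) ?_⟩, h1.2⟩
      rintro rfl
      exact hij (hk j (by exact_mod_cast h1.2.1))
    | succ k ih =>
      intro hkM p hp hk
      obtain ⟨φ, hφ, hφ0, hφj, hF⟩ := h k hkM
      have h1 := ih (by omega) (p - (p.coeff ((N : ℤ), (k : ℤ)) / φ.coeff ((N : ℤ), (k : ℤ))) • φ)
        (Submodule.sub_mem _ hp (Submodule.smul_mem _ _ hφ)) fun j hj => by
          simp only [AddMonoidAlgebra.coeff_sub, AddMonoidAlgebra.coeff_smul, Finsupp.sub_apply,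
            Finsupp.smul_apply, smul_eq_mul]
          rcases hj.eq_or_lt with rfl | hj
          · rw [div_mul_cancel₀ _ hφ0, sub_self]
          · rw [hk j (by push_cast; omega), hφj j hj, mul_zero, sub_zero]
      rwa [map_sub, map_smul, hF, smul_zero, sub_zero] at h1
  refine key M le_rfl p hp fun j hj => ?_
  by_contra h'
  have := mem_box.1 hp _ _ h'
  omega

/-- The polynomials in `matK` are increments, which gives one direction. For the other, their
leading terms run through the missing monomials triangularly, so together with the small box they
span the larger boxes; `eq_zero_of_triangular` is applied once in each variable. -/
theorem matK_eq_zero_iff (hL : PositiveDefinite L) :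
    matK hL = 0 ↔ SplitOrthogonal (extend L) n m := by
  have hH := isHerm_extend hL
  constructor
  · intro hK f hf g hg
    rw [hH.form_symm g]
    have hf' : ∀ p ∈ box n m, (form (extend L)).flip f p = 0 := fun p hp => by
      rw [LinearMap.flip_apply, hH.form_symm f, hf.2 p hp, map_zero]
    have h2 := eq_zero_of_triangular (N := m) (M := n)
      (((form (extend L)).flip f).comp swap.toLinearMap)
      (fun p hp => hf' (swap p) (swap_mem_box.2 hp)) (fun s hs => ?_) (swap_mem_box.2 hg.1)
    · have h3 : form (extend L) (swap (swap g)) f = 0 := h2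
      rw [swap_swap] at h3
      rw [h3, map_zero]
    -- The columns of the matrix run through the degrees in decreasing order.
    obtain ⟨s, rfl⟩ : ∃ t : Fin n, s = n - 1 - t := ⟨⟨n - 1 - s, by omega⟩, by simp only; omega⟩
    have hspec := revlexPoly_spec hL (n - 1) m (n - 1 - s) (Nat.sub_le n 1) le_rfl (Nat.sub_le _ _)
    have hperp := revlexPoly_mem_perp hL (Nat.sub_le (n - 1) s) (by omega)
    refine ⟨swap (revlexPoly hL (n - 1) m (n - 1 - s) (Nat.sub_le n 1) le_rfl (Nat.sub_le _ _)),
      swap_mem_box.2 hperp.1, ?_, fun j hj => ?_, ?_⟩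
    · rw [coeff_swap]
      exact hspec.leading.ne'
    · rw [coeff_swap]
      by_contra h'
      obtain ⟨b, hb1, hb2, rfl | hb⟩ := hspec.mem_of_coeff_ne_zero h'
      · simp only at hb1; omega
      · simp only [revlexBelow, Set.mem_ofPred_eq] at hb
        omega
    · rw [LinearMap.comp_apply, AlgEquiv.toLinearMap_apply, swap_swap, LinearMap.flip_apply,
        hH.form_symm f]
      have h4 := eq_zero_of_triangular (N := n) (M := m) ((form (extend L)).flip
        (revlexPoly hL (n - 1) m (n - 1 - s) (Nat.sub_le n 1) le_rfl (Nat.sub_le _ _)))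
        (fun p hp => by
          rw [LinearMap.flip_apply, hH.form_symm (revlexPoly hL _ _ _ _ _ _ : Laurent),
            hperp.2 p hp, map_zero]) (fun r hr => ?_) hf.1
      · rw [LinearMap.flip_apply] at h4
        rw [h4, map_zero]
      obtain ⟨r, rfl⟩ : ∃ t : Fin m, r = m - 1 - t := ⟨⟨m - 1 - r, by omega⟩, by simp only; omega⟩
      have hspec' := lexPoly_spec hL n (m - 1) (m - 1 - r) le_rfl (Nat.sub_le m 1) (Nat.sub_le _ _)
      refine ⟨lexPoly hL n (m - 1) (m - 1 - r) le_rfl (Nat.sub_le m 1) (Nat.sub_le _ _),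
        (lexPoly_mem_perp hL (Nat.sub_le (m - 1) r) (by omega)).1, hspec'.leading.ne',
        fun j hj => ?_, ?_⟩
      · by_contra h'
        obtain ⟨b, hb1, hb2, rfl | hb⟩ := hspec'.mem_of_coeff_ne_zero h'
        · simp only at hb2; omega
        · simp only [lexBelow, Set.mem_ofPred_eq] at hb
          omega
      · rw [LinearMap.flip_apply, form_extend]
        exact congrFun (congrFun hK r) s
  · intro hs
    ext r s
    rw [matK, Matrix.of_apply, ← form_extend]
    exact hs _ (lexPoly_mem_perp hL (Nat.sub_le _ _) r.pos) _
      (revlexPoly_mem_perp hL (Nat.sub_le _ _) s.pos)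

theorem spectralMatching_iff {p : polySpace n m} (hq : NonvanishingOnTorus (p : Laurent)) :
    SpectralMatching L p ↔ ∀ k l : ℤ, |k| ≤ n → |l| ≤ m →
      extend L (monomial k l) = szego hq (monomial k l) := by
  refine forall₄_congr fun k l hk hl => ?_
  rw [extend_eq (monomial_mem_laurentSpace hk hl), szego_apply]
  simp only [density, eval_monomial]
  rfl

end extend

end Bicircle

end

/-! ### The theorem. -/

theorem mainTheorem3 (n m : ℕ) (L : Bicircle.laurentSpace n m →ₗ[ℂ] ℂ)
    (hL : Bicircle.PositiveDefinite L) :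
    (Bicircle.matK hL = 0 →
      Bicircle.IsStable (Bicircle.reverse (Bicircle.lexPoly hL n m m le_rfl le_rfl le_rfl)) ∧
      Bicircle.SpectralMatching L (Bicircle.lexPoly hL n m m le_rfl le_rfl le_rfl)) ∧
    (∀ π : Bicircle.polySpace n m, Bicircle.HasFullDegree π →
      Bicircle.IsStable (Bicircle.reverse π) → Bicircle.SpectralMatching L π →
      Bicircle.matK hL = 0) := by
  have hH := Bicircle.isHerm_extend hL
  have hP := Bicircle.posOn_extend hL
  refine ⟨fun hK => ?_, fun π _ hst hsm => ?_⟩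
  · have hs := (Bicircle.matK_eq_zero_iff hL).1 hK
    have hφ := Bicircle.isTop_lexPoly hL
    have hr : Bicircle.NonvanishingOnBidisk (Bicircle.rev n m
        (Bicircle.lexPoly hL n m m le_rfl le_rfl le_rfl : Bicircle.Laurent)) := fun z w hz hw =>
      Bicircle.eval_rev_top_ne_zero hH (Nat.cast_nonneg n) (Nat.cast_nonneg m) hP hs hφ hz hw
    refine ⟨hr, (Bicircle.spectralMatching_iff hr.of_rev).2 fun k l hk hl => ?_⟩
    obtain ⟨x, hx, y, hy, hxy⟩ := Bicircle.exists_monomial_mul_dagger hk hl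
    rw [hxy]
    exact Bicircle.form_eq_form_szego_of_top hr.of_rev hH hP hs hφ hr hx hy
  · have hr : Bicircle.NonvanishingOnBidisk (Bicircle.rev n m (π : Bicircle.Laurent)) := hst
    have hπ : (π : Bicircle.Laurent) ∈ Bicircle.box (n + 1) (m + 1) := by
      rw [← Bicircle.polySpace_eq_box]; exact π.2
    rw [Bicircle.matK_eq_zero_iff]
    have h := (Bicircle.spectralMatching_iff hr.of_rev).1 hsm
    exact (Bicircle.szego_splitOrthogonal hr.of_rev hπ hr).congr fun x hx y hy =>
      (Bicircle.form_congr h hx hy).symm
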